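/- **Setting.** Fix issues $x_1,\dots,x_n$ (propositional variables). A *ballot* is a map $r:\{x_1,\dots,x_n\}\to\{0,1\}$, and a *partial ballot* is a map $p:\{x_1,\dots,x_n\}\to\{0,1,\star\}$; $p$ *agrees with* $r$ if $p(x_i)=r(x_i)$ whenever $p(x_i)\neq\star$. An *integrity constraint* $\Gamma$ is a propositional formula, whose variables may include the issues and possibly other variables. A (partial) ballot is *consistent* with $\Gamma$ if some truth assignment satisfying $\Gamma$ extends it (its values different from $\star$). A ballot consistent with $\Gamma$ is called *rational*, and a *profile* $\boldsymbol r=(r_1,\dots,r_p)$, $p\ge 1$, is a finite sequence of rational ballots. Its *majority outcome* $m_{\boldsymbol r}$ is the partial ballot that gives an issue the value $b\in\{0,1\}$ if a strict majority of the $r_i$ does so, and $\star$ if there is no such $b$. A *judgment aggregation procedure* $F$ assigns, for all issues and integrity constraints, to each profile $\boldsymbol r$ a non-empty set $F(\boldsymbol r)$ of ballots. It is *majority consistent* if for each $\Gamma$ and each profile $\boldsymbol r$ such that $m_{\boldsymbol r}$ is consistent with $\Gamma$, the set $F(\boldsymbol r)$ consists of exactly the rational ballots that $m_{\boldsymbol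 r}$ agrees with. With $d_H$ the number of issues on which two (partial) ballots differ, the *Kemeny* procedure returns the rational ballots $r$ that minimize $\sum_i d_H(r,r_i)$, and the *Slater* procedure returns the rational ballots $r$ that minimize $d_H(r,m_{\boldsymbol r})$. $\mathrm{Outcome}(F)$ is the decision problem: given issues $x_1,\dots,x_n$, an integrity constraint $\Gamma$, a profile $\boldsymbol r$ and a partial ballot $s$, is there a ballot $r^*\in F(\boldsymbol r)$ such that $s$ agrees with $r^*$? A *Krom* (2CNF) formula is a conjunction of clauses with at most two literals each. **Theorem.** For every majority-consistent judgment aggregation procedure $F$, the problem $\mathrm{Outcome}(F)$ restricted to instances in which $\Gamma$ is a Krom formula is solvable in polynomial time (by a deterministic Turing machine). The Kemeny and Slater procedures are majority consistent, so this applies to them. Moreover, if $\Gamma$ is a Krom formula, then the majority outcome of every profile of $\Gamma$-rational ballots is consistent with $\Gamma$. -/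

import Mathlib

namespace JudgmentAggregation

/-! ### Propositional formulas -/

/-- Propositional formulas over the variables `0, 1, 2, …`. -/
inductive PropFormula where
  | tru : PropFormula
  | fls : PropFormula
  | var : ℕ → PropFormula
  | neg : PropFormula → PropFormula
  | and : PropFormula → PropFormula → PropFormula
  | or : PropFormula → PropFormula → PropFormula
  | imp : PropFormula → PropFormula → PropFormula

namespace PropFormula

/-- Truth value of a formula under a truth assignment. -/
def eval (v : ℕ → Bool) : PropFormula → Bool
  | tru => true
  | fls => false
  | var x => v x
  | neg φ => !(eval v φ)
  | and φ ψ => eval v φ && eval v ψ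
  | or φ ψ => eval v φ || eval v ψ
  | imp φ ψ => !(eval v φ) || eval v ψ

/-- A literal: a variable or a negated variable. -/
def IsLiteral : PropFormula → Prop
  | var _ => True
  | neg (var _) => True
  | _ => False

/-- A clause with at most two literals: the empty clause (falsum), a single literal,
or a disjunction of two literals. -/
def IsTwoClause : PropFormula → Prop
  | fls => True
  | or φ ψ => IsLiteral φ ∧ IsLiteral ψ
  | φ => IsLiteral φ

/-- Krom (2CNF) formulas: conjunctions, possibly empty, of clauses with at most two literals. -/
def IsKrom : PropFormula → Prop
  | tru => True
  | and φ ψ => IsKrom φ ∧ IsKrom ψ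
  | φ => IsTwoClause φ

end PropFormula

/-! ### Ballots, profiles and the majority outcome -/

/-- A ballot for `n` issues. The issues are the propositional variables `0, …, n - 1`. -/
abbrev Ballot (n : ℕ) : Type := Fin n → Bool

/-- A partial ballot for `n` issues; `none` is the undecided value `⋆`. -/
abbrev PartialBallot (n : ℕ) : Type := Fin n → Option Bool

/-- The partial ballot `p` agrees with the ballot `r`. -/
def AgreesWith {n : ℕ} (p : PartialBallot n) (r : Ballot n) : Prop :=
  ∀ (i : Fin n) (b : Bool), p i = some b → r i = b

/-- A partial ballot is consistent with `Γ` if some truth assignment extends it and satisfies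
`Γ`. (The constraint may also contain variables that are not issues.) -/
def IsConsistent {n : ℕ} (Γ : PropFormula) (p : PartialBallot n) : Prop :=
  ∃ v : ℕ → Bool, (∀ (i : Fin n) (b : Bool), p i = some b → v i = b) ∧ Γ.eval v = true

/-- A ballot is rational if it is consistent with the integrity constraint `Γ`. -/
def IsRational {n : ℕ} (Γ : PropFormula) (r : Ballot n) : Prop :=
  ∃ v : ℕ → Bool, (∀ i : Fin n, v i = r i) ∧ Γ.eval v = true

/-- A profile: a nonempty finite sequence of rational ballots. -/
structure Profile (n : ℕ) (Γ : PropFormula) where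
  ballots : List (Ballot n)
  ballots_ne_nil : ballots ≠ []
  rational : ∀ r ∈ ballots, IsRational Γ r

/-- The majority outcome: an issue gets a value if a strict majority of the ballots gives it
that value, and is undecided otherwise. -/
def majorityOutcome {n : ℕ} {Γ : PropFormula} (R : Profile n Γ) : PartialBallot n := fun i =>
  if R.ballots.length < 2 * R.ballots.countP (fun r => r i) then some true
  else if R.ballots.length < 2 * R.ballots.countP (fun r => !(r i)) then some false
  else none

/-! ### Judgment aggregation procedures -/

/-- A judgment aggregation procedure: for all sets of issues and all integrity constraints, a map
from profiles to nonempty sets of ballots. -/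
structure Procedure where
  outcome : ∀ {n : ℕ} {Γ : PropFormula}, Profile n Γ → Set (Ballot n)
  outcome_nonempty : ∀ {n : ℕ} {Γ : PropFormula} (R : Profile n Γ), (outcome R).Nonempty

/-- `F` is majority consistent: whenever the majority outcome of a profile is consistent with the
integrity constraint, `F` returns all and only the rational ballots that agree with it. -/
def Procedure.MajorityConsistent (F : Procedure) : Prop :=
  ∀ (n : ℕ) (Γ : PropFormula) (R : Profile n Γ), IsConsistent Γ (majorityOutcome R) →
    F.outcome R = {r | IsRational Γ r ∧ AgreesWith (majorityOutcome R) r}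

/-- The rational ballots of minimal cost. -/
def argminRational {n : ℕ} (Γ : PropFormula) (cost : Ballot n → ℕ) : Set (Ballot n) :=
  {r | IsRational Γ r ∧ ∀ r', IsRational Γ r' → cost r ≤ cost r'}

theorem argminRational_nonempty {n : ℕ} {Γ : PropFormula} (R : Profile n Γ)
    (cost : Ballot n → ℕ) : (argminRational Γ cost).Nonempty := by
  obtain ⟨r₀, h₀⟩ := List.exists_mem_of_ne_nil _ R.ballots_ne_nil
  have hfin : {r : Ballot n | IsRational Γ r}.Finite := Set.toFinite _
  obtain ⟨r, hr, hmin⟩ := Set.exists_min_image _ cost hfin ⟨r₀, R.rational r₀ h₀⟩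
  exact ⟨r, hr, hmin⟩

/-- The Kemeny (median) procedure: minimize the cumulative Hamming distance to the profile. -/
def kemeny : Procedure where
  outcome {_ Γ} R := argminRational Γ fun r => (R.ballots.map fun r' => hammingDist r r').sum
  outcome_nonempty R := argminRational_nonempty R _

/-- The Slater (max-card Condorcet) procedure: minimize the Hamming distance to the majority
outcome (an undecided issue differs from both truth values). -/
def slater : Procedure where
  outcome {_ Γ} R := argminRational Γ fun r =>
    hammingDist (fun i => some (r i)) (majorityOutcome R)
  outcome_nonempty R := argminRational_nonempty R _

/-! ### The outcome determination problem -/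

/-- An instance: issues, an integrity constraint, a profile and a partial ballot. -/
structure Instance where
  n : ℕ
  Γ : PropFormula
  profile : Profile n Γ
  s : PartialBallot n

/-- The question of `Outcome(F)`: does `s` agree with some ballot in `F(profile)`? -/
def Outcome (F : Procedure) (x : Instance) : Prop :=
  ∃ r ∈ F.outcome x.profile, AgreesWith x.s r

/-! ### Instances as strings -/

/-- The finite alphabet in which instances are written. -/
inductive Symb where
  | bit : Bool → Symb
  | star : Symb
  | delim : Symb
  | tru : Symb
  | fls : Symb
  | var : Symb
  | neg : Symb
  | and : Symb
  | or : Symb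
  | imp : Symb
  deriving DecidableEq, Fintype

/-- Formulas are written in prefix notation, with the indices of variables in binary. -/
def PropFormula.encode : PropFormula → List Symb
  | tru => [Symb.tru]
  | fls => [Symb.fls]
  | var x => Symb.var :: ((Computability.encodeNat x).map Symb.bit ++ [Symb.delim])
  | neg φ => Symb.neg :: encode φ
  | and φ ψ => Symb.and :: (encode φ ++ encode ψ)
  | or φ ψ => Symb.or :: (encode φ ++ encode ψ)
  | imp φ ψ => Symb.imp :: (encode φ ++ encode ψ)

/-- Partial ballots are written as words over `0`, `1`, `⋆`, closed by an end marker. -/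
def encodePartialBallot {n : ℕ} (p : PartialBallot n) : List Symb :=
  List.ofFn (fun i => (p i).elim Symb.star Symb.bit) ++ [Symb.delim]

/-- Ballots are written as binary words, closed by an end marker. -/
def encodeBallot {n : ℕ} (r : Ballot n) : List Symb :=
  List.ofFn (fun i => Symb.bit (r i)) ++ [Symb.delim]

/-- An instance is written as the constraint, the partial ballot and then all ballots of the
profile. -/
def Instance.encode (x : Instance) : List Symb :=
  x.Γ.encode ++ (encodePartialBallot x.s ++ x.profile.ballots.flatMap encodeBallot)

theorem append_delim_inj : ∀ {a a' t t' : List Symb}, Symb.delim ∉ a → Symb.delim ∉ a' →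
    a ++ Symb.delim :: t = a' ++ Symb.delim :: t' → a = a' ∧ t = t'
  | [], [], _, _, _, _, h => by simpa using h
  | [], c :: a', _, _, _, h', h => by
      simp only [List.nil_append, List.cons_append, List.cons.injEq] at h
      exact absurd (by simp [h.1]) h'
  | c :: a, [], _, _, h', _, h => by
      simp only [List.nil_append, List.cons_append, List.cons.injEq] at h
      exact absurd (by simp [h.1]) h'
  | c :: a, c' :: a', t, t', h₁, h₂, h => by
      simp only [List.cons_append, List.cons.injEq] at h
      have := append_delim_inj (fun m => h₁ (List.mem_cons_of_mem _ m))
        (fun m => h₂ (List.mem_cons_of_mem _ m)) h.2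
      exact ⟨by rw [h.1, this.1], this.2⟩

theorem PropFormula.encode_append_inj (φ : PropFormula) : ∀ (ψ : PropFormula) (t t' : List Symb),
    φ.encode ++ t = ψ.encode ++ t' → φ = ψ ∧ t = t' := by
  induction φ with
  | tru => intro ψ t t' h; cases ψ <;> simp_all [encode]
  | fls => intro ψ t t' h; cases ψ <;> simp_all [encode]
  | var x =>
    intro ψ t t' h
    cases ψ with
    | var y =>
      simp only [encode, List.cons_append, List.append_assoc, List.cons.injEq, true_and,
        List.nil_append] at h
      obtain ⟨h₁, h₂⟩ := append_delim_inj (by simp) (by simp) h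
      have h₃ : Computability.encodeNat x = Computability.encodeNat y :=
        List.map_injective_iff.2 (fun a b hab => by simpa using hab) h₁
      have h₄ := congrArg Computability.decodeNat h₃
      simp only [Computability.decode_encodeNat] at h₄
      exact ⟨by rw [h₄], h₂⟩
    | _ => simp [encode] at h
  | neg φ ih =>
    intro ψ t t' h
    cases ψ with
    | neg ψ =>
      simp only [encode, List.cons_append, List.cons.injEq, true_and] at h
      obtain ⟨h₁, h₂⟩ := ih _ _ _ h
      exact ⟨by rw [h₁], h₂⟩
    | _ => simp [encode] at h
  | and φ φ' ih ih' =>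
    intro ψ t t' h
    cases ψ with
    | and ψ ψ' =>
      simp only [encode, List.cons_append, List.append_assoc, List.cons.injEq, true_and] at h
      obtain ⟨h₁, h₂⟩ := ih _ _ _ h
      obtain ⟨h₃, h₄⟩ := ih' _ _ _ h₂
      exact ⟨by rw [h₁, h₃], h₄⟩
    | _ => simp [encode] at h
  | or φ φ' ih ih' =>
    intro ψ t t' h
    cases ψ with
    | or ψ ψ' =>
      simp only [encode, List.cons_append, List.append_assoc, List.cons.injEq, true_and] at h
      obtain ⟨h₁, h₂⟩ := ih _ _ _ h
      obtain ⟨h₃, h₄⟩ := ih' _ _ _ h₂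
      exact ⟨by rw [h₁, h₃], h₄⟩
    | _ => simp [encode] at h
  | imp φ φ' ih ih' =>
    intro ψ t t' h
    cases ψ with
    | imp ψ ψ' =>
      simp only [encode, List.cons_append, List.append_assoc, List.cons.injEq, true_and] at h
      obtain ⟨h₁, h₂⟩ := ih _ _ _ h
      obtain ⟨h₃, h₄⟩ := ih' _ _ _ h₂
      exact ⟨by rw [h₁, h₃], h₄⟩
    | _ => simp [encode] at h

theorem flatMap_encodeBallot_inj {n : ℕ} : ∀ {L L' : List (Ballot n)},
    L.flatMap encodeBallot = L'.flatMap encodeBallot → L = L'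
  | [], [], _ => rfl
  | [], r :: L', h => by simp [encodeBallot] at h
  | r :: L, [], h => by simp [encodeBallot] at h
  | r :: L, r' :: L', h => by
      simp only [List.flatMap_cons, encodeBallot, List.append_assoc, List.cons_append,
        List.nil_append] at h
      obtain ⟨h₁, h₂⟩ := append_delim_inj (by simp [List.mem_ofFn]) (by simp [List.mem_ofFn]) h
      have h₃ : r = r' := funext fun i => by simpa using congrFun (List.ofFn_injective h₁) i
      rw [h₃, flatMap_encodeBallot_inj h₂]

/-- Different instances are written differently. -/
theorem Instance.encode_injective : Function.Injective Instance.encode := by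
  rintro ⟨n, Γ, R, s⟩ ⟨n', Γ', R', s'⟩ h
  simp only [Instance.encode] at h
  obtain ⟨h₁, h₂⟩ := PropFormula.encode_append_inj _ _ _ _ h
  simp only [encodePartialBallot, List.append_assoc, List.cons_append, List.nil_append] at h₂
  have key : ∀ {m : ℕ} (p : PartialBallot m),
      Symb.delim ∉ List.ofFn (fun i => (p i).elim Symb.star Symb.bit) := by
    intro m p hm
    obtain ⟨i, hi⟩ := List.mem_ofFn.1 hm
    cases hp : p i <;> simp [hp] at hi
  obtain ⟨h₃, h₄⟩ := append_delim_inj (key s) (key s') h₂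
  have hn : n = n' := by simpa using congrArg List.length h₃
  subst hn
  subst h₁
  have hs : s = s' := funext fun i => by
    have := congrFun (List.ofFn_injective h₃) i
    cases hp : s i <;> cases hp' : s' i <;> simp_all
  subst hs
  obtain ⟨L, _, _⟩ := R
  obtain ⟨L', _, _⟩ := R'
  have hL : L = L' := flatMap_encodeBallot_inj h₄
  subst hL
  rfl

/-- `Outcome(F)` is solvable in polynomial time when the integrity constraint belongs to the
class `C`: some deterministic multi-stack Turing machine, on each instance whose constraint is in
`C`, halts with the correct answer within a number of steps that is polynomial in the length of
the written instance. -/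
def OutcomePolyTimeSolvable (F : Procedure) (C : PropFormula → Prop) : Prop :=
  open Classical in
  Nonempty (Turing.TM2ComputableInPolyTime
    (fun x : {x : Instance // C x.Γ} => x.1.encode)
    Computability.encodeBool
    (fun x => decide (Outcome F x.1)))

end JudgmentAggregation

/-!
Under a Krom constraint the majority outcome of a profile is always consistent. Each ballot extends
to a satisfying assignment; duplicate all these assignments and add one of them once more, so that
their number is odd and strict majorities are unaffected. The variable-wise majority of an odd
number of satisfying assignments satisfies every clause with at most two literals, because two
majorities have a member in common (`PropFormula.IsKrom.eval_majority`,
`isConsistent_majorityOutcome`). The Kemeny and Slater costs are sums of costs of the single issues,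
and the majority outcome minimizes each summand, so both procedures are majority consistent
(`argminRational_sum_eq`).

Hence for a majority-consistent procedure the outcome problem asks for an assignment that satisfies
the constraint and extends both the majority outcome and the given partial ballot (`outcome_iff`).
This is the satisfiability problem for clauses with two literals: the clauses of the constraint
together with unit clauses, one for each value that is prescribed. Such clauses are unsatisfiable if
and only if some literal and its complement reach each other in the implication graph
(`exists_holds_iff`).

For the time bound an actual machine is given. `Prog` is a language of structured stack programs
with a semantics `Prog.Exec` that counts steps; programs are compiled to multi-stack Turing machines
without overhead (`Prog.Exec.iterate_step`, `Prog.nonempty_tm2ComputableInPolyTime`). The program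
`decideOutcome` translates the constraint into a list of clauses (`runs_parse`), removes the columns
of the table of ballots one by one, taking the majority of each and adding the resulting unit
clauses (`runs_round`), and then saturates, for each literal and its complement, the set of literals
that it implies (`runs_solve`). The lemmas `runs_…` state the effect of a program part and a bound
on its running time; `decideTime` is the resulting polynomial bound.
-/

namespace JudgmentAggregation

/-! ### Structured stack programs -/

/-- Structured programs working on stacks indexed by `K` over the alphabet `A`, with a finite
control state `σ`. `loop k f p` pops a symbol from the stack `k`, lets `f` record the outcome in
the control state, and runs `p` and repeats if there was such a symbol. -/
inductive Prog (K A σ : Type) where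
  | push : K → (σ → A) → Prog K A σ
  | pop : K → (σ → Option A → σ) → Prog K A σ
  | set : (σ → σ) → Prog K A σ
  | seq : Prog K A σ → Prog K A σ → Prog K A σ
  | ite : (σ → Bool) → Prog K A σ → Prog K A σ → Prog K A σ
  | loop : K → (σ → Option A → σ) → Prog K A σ → Prog K A σ

namespace Prog

variable {K A σ : Type}

/-- `Exec p v S v' S' t`: started in control state `v` with stacks `S`, the program `p` terminates
in control state `v'` with stacks `S'` after exactly `t` steps. -/
inductive Exec [DecidableEq K] :
    Prog K A σ → σ → (K → List A) → σ → (K → List A) → ℕ → Prop where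
  | push (k f v S) : Exec (push k f) v S v (Function.update S k (f v :: S k)) 1
  | pop (k f v S) : Exec (pop k f) v S (f v (S k).head?) (Function.update S k (S k).tail) 1
  | set (f v S) : Exec (set f) v S (f v) S 1
  | seq {p q v S v₁ S₁ v₂ S₂ t₁ t₂} : Exec p v S v₁ S₁ t₁ → Exec q v₁ S₁ v₂ S₂ t₂ →
      Exec (seq p q) v S v₂ S₂ (t₁ + t₂)
  | ite_true {c p q v S v₁ S₁ t} : c v = true → Exec p v S v₁ S₁ t →
      Exec (ite c p q) v S v₁ S₁ (1 + t)
  | ite_false {c p q v S v₁ S₁ t} : c v = false → Exec q v S v₁ S₁ t →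
      Exec (ite c p q) v S v₁ S₁ (1 + t)
  | loop_nil {k f p v S} : S k = [] → Exec (loop k f p) v S (f v none) S 1
  | loop_cons {k f p v S a l v₁ S₁ v₂ S₂ t₁ t₂} : S k = a :: l →
      Exec p (f v (some a)) (Function.update S k l) v₁ S₁ t₁ →
      Exec (loop k f p) v₁ S₁ v₂ S₂ t₂ → Exec (loop k f p) v S v₂ S₂ (1 + t₁ + t₂)

/-! ### Compilation to multi-stack Turing machines -/

/-- The program points of a program. -/
def Label : Prog K A σ → Type
  | push _ _ => Unit
  | pop _ _ => Unit
  | set _ => Unit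
  | seq p q => Label p ⊕ Label q
  | ite _ p q => Option (Label p ⊕ Label q)
  | loop _ _ p => Option (Label p)

/-- The first program point. -/
def entry : (p : Prog K A σ) → Label p
  | push _ _ => ()
  | pop _ _ => ()
  | set _ => ()
  | seq p _ => Sum.inl (entry p)
  | ite _ _ _ => none
  | loop _ _ _ => none

instance labelFintype : (p : Prog K A σ) → Fintype (Label p)
  | push _ _ => inferInstanceAs (Fintype Unit)
  | pop _ _ => inferInstanceAs (Fintype Unit)
  | set _ => inferInstanceAs (Fintype Unit)
  | seq p q =>
    let _ := labelFintype p
    let _ := labelFintype q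
    inferInstanceAs (Fintype (Label p ⊕ Label q))
  | ite _ p q =>
    let _ := labelFintype p
    let _ := labelFintype q
    inferInstanceAs (Fintype (Option (Label p ⊕ Label q)))
  | loop _ _ p =>
    let _ := labelFintype p
    inferInstanceAs (Fintype (Option (Label p)))

/-- The alphabets of the stacks of the compiled machine: besides the stacks of the program there
is one additional stack for the Boolean output. -/
def alphabet (K A : Type) : Option K → Type
  | none => Bool
  | some _ => A

/-- The machine code of a program placed into a machine with labels `Λ` by `emb`, which leaves to
the label `next`. The control state of the machine has an additional bit, which tells whether the
last test of a loop was successful. -/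
def code {Λ : Type} : (p : Prog K A σ) → (Label p → Λ) → Λ → Label p →
    Turing.TM2.Stmt (alphabet K A) Λ (Bool × σ)
  | push k f, _, next, _ => .push (some k) (fun v => f v.2) (.goto fun _ => next)
  | pop k f, _, next, _ => .pop (some k) (fun v o => (v.1, f v.2 o)) (.goto fun _ => next)
  | set f, _, next, _ => .load (fun v => (v.1, f v.2)) (.goto fun _ => next)
  | seq p q, emb, _, Sum.inl l => code p (emb ∘ Sum.inl) (emb (Sum.inr (entry q))) l
  | seq _ q, emb, next, Sum.inr l => code q (emb ∘ Sum.inr) next l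
  | ite c p q, emb, _, none => .branch (fun v => c v.2)
      (.goto fun _ => emb (some (Sum.inl (entry p)))) (.goto fun _ => emb (some (Sum.inr (entry q))))
  | ite _ p _, emb, next, some (Sum.inl l) => code p (emb ∘ some ∘ Sum.inl) next l
  | ite _ _ q, emb, next, some (Sum.inr l) => code q (emb ∘ some ∘ Sum.inr) next l
  | loop k f p, emb, next, none => .pop (some k) (fun v o => (o.isSome, f v.2 o))
      (.branch (fun v => v.1) (.goto fun _ => emb (some (entry p))) (.goto fun _ => next))
  | loop _ _ p, emb, _, some l => code p (emb ∘ some) (emb none) l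

/-- The stacks of the compiled machine that correspond to the stacks of the program. -/
def stackOf (S : K → List A) : ∀ k : Option K, List (alphabet K A k)
  | none => []
  | some k => S k

theorem update_stackOf [DecidableEq K] (S : K → List A) (k : K) (l : List A) :
    (Function.update (stackOf S) (some k) l : ∀ k, List (alphabet K A k)) =
      stackOf (Function.update S k l) := by
  funext k'
  cases k' with
  | none => rfl
  | some k' =>
    by_cases h : k' = k
    · subst h
      exact (Function.update_self _ _ _).trans (Function.update_self (β := fun _ => List A) _ _ _).symm
    · exact (Function.update_of_ne (by simpa using h) _ _).trans
        (Function.update_of_ne (β := fun _ => List A) h _ _).symm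

theorem bind_step_eq [DecidableEq K] {Λ : Type} (M : Λ → Turing.TM2.Stmt (alphabet K A) Λ (Bool × σ))
    {l : Λ} {s : Turing.TM2.Stmt (alphabet K A) Λ (Bool × σ)} (h : M l = s) (v : Bool × σ)
    (S : ∀ k, List (alphabet K A k)) :
    flip bind (Turing.TM2.step M) (some ⟨some l, v, S⟩) = some (Turing.TM2.stepAux s v S) := by
  subst h
  rfl

/-- In a machine that contains the code of `p`, every execution of `p` is an execution of the
machine with the same number of steps. -/
theorem Exec.iterate_step [DecidableEq K] {Λ : Type} {p : Prog K A σ} {v v' : σ}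
    {S S' : K → List A} {t : ℕ} (h : Exec p v S v' S' t)
    (M : Λ → Turing.TM2.Stmt (alphabet K A) Λ (Bool × σ)) (emb : Label p → Λ) (next : Λ)
    (hM : ∀ l, M (emb l) = code p emb next l) (b : Bool) :
    ∃ b', (flip bind (Turing.TM2.step M))^[t] (some ⟨some (emb (entry p)), (b, v), stackOf S⟩) =
      some ⟨some next, (b', v'), stackOf S'⟩ := by
  induction h generalizing b next with
  | push k f v S =>
    exact ⟨b, (bind_step_eq M (hM ()) _ _).trans
      (congrArg (some <| Turing.TM2.Cfg.mk (some next) (b, v) ·) (update_stackOf S k _))⟩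
  | pop k f v S =>
    exact ⟨b, (bind_step_eq M (hM ()) _ _).trans
      (congrArg (some <| Turing.TM2.Cfg.mk (some next) (b, f v (S k).head?) ·) (update_stackOf S k _))⟩
  | set f v S => exact ⟨b, bind_step_eq M (hM ()) _ _⟩
  | @seq p q v S v₁ S₁ v₂ S₂ t₁ t₂ _ _ ih₁ ih₂ =>
    obtain ⟨b₁, h₁⟩ := ih₁ (emb ∘ Sum.inl) (emb (Sum.inr (entry q))) (fun l => hM (Sum.inl l)) b
    obtain ⟨b₂, h₂⟩ := ih₂ (emb ∘ Sum.inr) next (fun l => hM (Sum.inr l)) b₁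
    refine ⟨b₂, ?_⟩
    rw [Nat.add_comm, Function.iterate_add_apply]
    exact (congrArg _ h₁).trans h₂
  | @ite_true c p q v S v₁ S₁ t hc _ ih =>
    obtain ⟨b₁, h₁⟩ := ih (emb ∘ some ∘ Sum.inl) next (fun l => hM (some (Sum.inl l))) b
    refine ⟨b₁, ?_⟩
    rw [Nat.add_comm, Function.iterate_add_apply, ← h₁]
    refine congrArg _ ((bind_step_eq M (hM none) _ _).trans ?_)
    simp only [code, Turing.TM2.stepAux, hc, cond_true]
    rfl
  | @ite_false c p q v S v₁ S₁ t hc _ ih =>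
    obtain ⟨b₁, h₁⟩ := ih (emb ∘ some ∘ Sum.inr) next (fun l => hM (some (Sum.inr l))) b
    refine ⟨b₁, ?_⟩
    rw [Nat.add_comm, Function.iterate_add_apply, ← h₁]
    refine congrArg _ ((bind_step_eq M (hM none) _ _).trans ?_)
    simp only [code, Turing.TM2.stepAux, hc, cond_false]
    rfl
  | @loop_nil k f p v S hS =>
    refine ⟨false, (bind_step_eq M (hM none) _ _).trans ?_⟩
    have h₀ : Function.update S k (S k).tail = S := by
      rw [Function.update_eq_self_iff, hS]
      rfl
    have h₁ : stackOf S (some k) = [] := hS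
    simp only [code, Turing.TM2.stepAux, h₁]
    refine congrArg some ?_
    refine (congrArg (Turing.TM2.Cfg.mk (some next) (false, f v none)) ?_)
    refine Eq.trans ?_ ((update_stackOf S k _).trans (congrArg stackOf h₀))
    rw [hS]
    rfl
  | @loop_cons k f p v S a l v₁ S₁ v₂ S₂ t₁ t₂ hS _ _ ih₁ ih₂ =>
    obtain ⟨b₁, h₁⟩ := ih₁ (emb ∘ some) (emb none) (fun l => hM (some l)) true
    obtain ⟨b₂, h₂⟩ := ih₂ emb next hM b₁
    refine ⟨b₂, ?_⟩
    rw [Nat.add_comm, Function.iterate_add_apply, Nat.add_comm 1, Function.iterate_add_apply, ← h₂]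
    refine congrArg _ (Eq.trans (congrArg _ ?_) h₁)
    refine (bind_step_eq M (hM none) _ _).trans ?_
    have h₃ : stackOf S (some k) = a :: l := hS
    simp only [code, Turing.TM2.stepAux, h₃]
    exact congrArg (some <| Turing.TM2.Cfg.mk (some (emb (some (entry p)))) (true, f v (some a)) ·) (update_stackOf S k l)

/-- The machine that runs the program `p` with the input on the stack `inp`, and then writes the
answer that `ans` reads off the control state. -/
def machine [DecidableEq K] [Fintype K] [Fintype A] [Fintype σ] (p : Prog K A σ) (inp : K)
    (v₀ : σ) (ans : σ → Bool) : Turing.FinTM2 where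
  K := Option K
  k₀ := some inp
  k₁ := none
  Γ := alphabet K A
  Λ := Option (Label p)
  main := some (entry p)
  σ := Bool × σ
  initialState := (false, v₀)
  Γk₀Fin := inferInstanceAs (Fintype A)
  m
    | some l => code p some none l
    | none => .push (none : Option K) (fun v => ans v.2) (.load (fun _ => (false, v₀)) .halt)

/-- A program that solves a decision problem within polynomially many steps, and leaves its stacks
empty, yields a machine that solves the problem in polynomial time. -/
theorem nonempty_tm2ComputableInPolyTime [DecidableEq K] [Fintype K] [Fintype A] [Fintype σ]
    (p : Prog K A σ) (inp : K) (v₀ : σ) (ans : σ → Bool) {α : Type} (enc : α → List A)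
    (f : α → Bool) (time : Polynomial ℕ)
    (h : ∀ x, ∃ v t, t ≤ time.eval (enc x).length ∧ ans v = f x ∧
      Exec p v₀ (Function.update (fun _ => []) inp (enc x)) v (fun _ => []) t) :
    Nonempty (Turing.TM2ComputableInPolyTime enc Computability.encodeBool f) := by
  choose v t ht hv hx using h
  refine ⟨⟨⟨machine p inp v₀ ans, Equiv.refl A, Equiv.refl Bool⟩, time + 1, fun x => ?_⟩⟩
  refine ⟨⟨t x + 1, ?_⟩, by simpa using ht x⟩
  obtain ⟨b', hb⟩ := (hx x).iterate_step (machine p inp v₀ ans).m some none (fun l => rfl) false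
  have h₀ : Turing.initList (machine p inp v₀ ans) ((enc x).map (Equiv.refl A).invFun) =
      ⟨some (some (entry p)), (false, v₀),
        stackOf (Function.update (fun _ => []) inp (enc x))⟩ := by
    refine congrArg (Turing.TM2.Cfg.mk (some (some (entry p))) (false, v₀)) ?_
    funext k
    rcases k with _ | k
    · rfl
    · by_cases hk : k = inp
      · subst hk
        change _ = (Function.update (fun _ => []) k (enc x) : K → List A) k
        rw [Function.update_self]
        exact (dif_pos rfl).trans (List.map_id (enc x))
      · refine (dif_neg (by simpa [machine] using hk)).trans ?_
        exact (Function.update_of_ne (β := fun _ => List A) hk (enc x) fun _ => []).symm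
  rw [h₀, Nat.add_comm, Function.iterate_add_apply]
  refine (congrArg _ hb).trans ((bind_step_eq (machine p inp v₀ ans).m (l := none) rfl _ _).trans
    (congrArg some (congrArg (Turing.TM2.Cfg.mk none (false, v₀)) ?_)))
  funext k
  rcases k with _ | k
  · refine (Function.update_self (β := fun k => List (alphabet K A k)) none _ _).trans
      (Eq.trans ?_ (dif_pos rfl).symm)
    change [ans (v x)] = List.map id [f x]
    rw [hv, List.map_id]
  · split_ifs with hk
    · exact absurd hk (Option.some_ne_none k)
    · exact Function.update_of_ne (β := fun k => List (alphabet K A k)) (Option.some_ne_none k) _ _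

end Prog

/-! ### The registers and the control state -/

/-- The stacks of the program that solves the outcome determination problem. -/
inductive Reg where
  | inp | save | ctr | bal | cls | lits | cur | reach | cnt | scan | fst | snd | mem | wrd | qry
  | cmp | tmp
  deriving DecidableEq

instance : Fintype Reg :=
  Fintype.ofList [.inp, .save, .ctr, .bal, .cls, .lits, .cur, .reach, .cnt, .scan, .fst, .snd, .mem,
    .wrd, .qry, .cmp, .tmp] fun k => by cases k <;> simp

/-- The contents of the stacks. A structure rather than a function on `Reg`, so that reading and
writing of definite stacks can be evaluated by `rfl`. -/
@[ext]
structure Mem where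
  inp : List Symb
  save : List Symb
  ctr : List Symb
  bal : List Symb
  cls : List Symb
  lits : List Symb
  cur : List Symb
  reach : List Symb
  cnt : List Symb
  scan : List Symb
  fst : List Symb
  snd : List Symb
  mem : List Symb
  wrd : List Symb
  qry : List Symb
  cmp : List Symb
  tmp : List Symb

namespace Mem

/-- The content of a stack. -/
def get (m : Mem) : Reg → List Symb
  | .inp => m.inp | .save => m.save | .ctr => m.ctr | .bal => m.bal | .cls => m.cls
  | .lits => m.lits | .cur => m.cur | .reach => m.reach | .cnt => m.cnt | .scan => m.scan
  | .fst => m.fst | .snd => m.snd | .mem => m.mem | .wrd => m.wrd | .qry => m.qry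
  | .cmp => m.cmp | .tmp => m.tmp

/-- Replace the content of a stack. -/
def set (m : Mem) : Reg → List Symb → Mem
  | .inp, l => { m with inp := l } | .save, l => { m with save := l }
  | .ctr, l => { m with ctr := l } | .bal, l => { m with bal := l }
  | .cls, l => { m with cls := l } | .lits, l => { m with lits := l }
  | .cur, l => { m with cur := l } | .reach, l => { m with reach := l }
  | .cnt, l => { m with cnt := l } | .scan, l => { m with scan := l }
  | .fst, l => { m with fst := l } | .snd, l => { m with snd := l }
  | .mem, l => { m with mem := l } | .wrd, l => { m with wrd := l }
  | .qry, l => { m with qry := l } | .cmp, l => { m with cmp := l }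
  | .tmp, l => { m with tmp := l }

@[simp] theorem get_set_self (m : Mem) (k : Reg) (l : List Symb) : (m.set k l).get k = l := by
  cases k <;> rfl

theorem get_set_of_ne (m : Mem) {k k' : Reg} (h : k' ≠ k) (l : List Symb) :
    (m.set k l).get k' = m.get k' := by
  cases k <;> cases k' <;> first | rfl | exact absurd rfl h

@[simp] theorem set_set (m : Mem) (k : Reg) (l l' : List Symb) :
    (m.set k l).set k l' = m.set k l' := by
  cases k <;> rfl

@[simp] theorem set_get (m : Mem) (k : Reg) : m.set k (m.get k) = m := by
  cases k <;> rfl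

theorem set_comm (m : Mem) {k k' : Reg} (h : k' ≠ k) (l l' : List Symb) :
    (m.set k l).set k' l' = (m.set k' l').set k l := by
  cases k <;> cases k' <;> first | rfl | exact absurd rfl h

theorem get_set (m : Mem) (k k' : Reg) (l : List Symb) :
    (m.set k l).get k' = if k' = k then l else m.get k' := by
  split_ifs with h
  · rw [h, get_set_self]
  · exact get_set_of_ne m h l

theorem ext_get {m n : Mem} (h : ∀ k, m.get k = n.get k) : m = n := by
  ext1
  exacts [h .inp, h .save, h .ctr, h .bal, h .cls, h .lits, h .cur, h .reach, h .cnt, h .scan,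
    h .fst, h .snd, h .mem, h .wrd, h .qry, h .cmp, h .tmp]

theorem update_get (m : Mem) (k : Reg) (l : List Symb) :
    Function.update m.get k l = (m.set k l).get := by
  funext k'
  by_cases h : k' = k
  · subst h; simp
  · rw [Function.update_of_ne h, get_set_of_ne m h]

/-- The initial memory. -/
def init (w : List Symb) : Mem :=
  ⟨w, [], [], [], [], [], [], [], [], [], [], [], [], [], [], [], []⟩

end Mem

/-- The control state: the symbol read last, and flags. -/
@[ext]
structure Ctl where
  /-- the symbol read by the innermost running loop -/
  sym : Symb
  /-- the result of a comparison in progress -/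
  ok : Bool
  /-- the result of a search in progress -/
  found : Bool
  /-- the result of an earlier search -/
  prev : Bool
  /-- the second word of a pair is being read -/
  second : Bool
  /-- the clauses have been found to be unsatisfiable -/
  bad : Bool
  /-- the sign of the literal being read -/
  sign : Bool
  /-- the index of a variable is being read -/
  reading : Bool
  /-- the number of literals to come in the current disjunction -/
  todo : Fin 3
  /-- the constraint has been read completely -/
  past : Bool
  /-- the next symbol is the first one of its row -/
  start : Bool
  /-- the current row is the first one -/
  top : Bool
  /-- the carry bit of an increment -/
  carry : Bool
  /-- the symbol taken from a stack for inspection -/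
  aux : Option Symb

noncomputable instance : Fintype Ctl :=
  Fintype.ofInjective (fun c : Ctl => ((c.sym, c.ok, c.found, c.prev, c.second, c.bad, c.sign),
    (c.reading, c.todo, c.past, c.start, c.top, c.carry, c.aux))) fun c d h => by
      cases c
      cases d
      simpa [and_assoc] using h

/-- Store a symbol. -/
def Ctl.on (c : Ctl) (a : Symb) : Ctl := { c with sym := a }

@[simp] theorem Ctl.on_on (c : Ctl) (a b : Symb) : (c.on a).on b = c.on b := rfl

@[simp] theorem Ctl.on_sym (c : Ctl) : c.on c.sym = c := rfl

@[simp] theorem Ctl.sym_on (c : Ctl) (a : Symb) : (c.on a).sym = a := rfl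

/-- Store the symbol read by a loop; the end of the loop restores a fixed value. -/
def Ctl.read (c : Ctl) (o : Option Symb) : Ctl := c.on (o.getD .delim)

/-- Programs with the registers `Reg`. -/
abbrev RProg : Type := Prog Reg Symb Ctl

/-- The program `p` leads from control state `c` and memory `m` to `c'` and `m'` within at most `t`
steps. -/
def Runs (p : RProg) (c : Ctl) (m : Mem) (c' : Ctl) (m' : Mem) (t : ℕ) : Prop :=
  ∃ t' ≤ t, Prog.Exec p c m.get c' m'.get t'

namespace Runs

theorem congr {p : RProg} {c c' d : Ctl} {m m' n : Mem} {t u : ℕ} (h : Runs p c m c' m' t)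
    (hc : c' = d) (hm : m' = n) (ht : t ≤ u) : Runs p c m d n u := by
  subst hc hm
  obtain ⟨t', h', he⟩ := h
  exact ⟨t', h'.trans ht, he⟩

theorem congr_start {p : RProg} {c c' d : Ctl} {m m' n : Mem} {t : ℕ} (h : Runs p c m c' m' t)
    (hc : c = d) (hm : m = n) : Runs p d n c' m' t := by
  subst hc hm
  exact h

theorem mono {p : RProg} {c c' : Ctl} {m m' : Mem} {t u : ℕ} (h : Runs p c m c' m' t)
    (ht : t ≤ u) : Runs p c m c' m' u :=
  h.congr rfl rfl ht

theorem push (k : Reg) (f : Ctl → Symb) (c : Ctl) (m : Mem) :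
    Runs (.push k f) c m c (m.set k (f c :: m.get k)) 1 :=
  ⟨1, le_rfl, by rw [← Mem.update_get]; exact .push k f c _⟩

theorem pop (k : Reg) (f : Ctl → Option Symb → Ctl) (c : Ctl) (m : Mem) :
    Runs (.pop k f) c m (f c (m.get k).head?) (m.set k (m.get k).tail) 1 :=
  ⟨1, le_rfl, by rw [← Mem.update_get]; exact .pop k f c _⟩

theorem set (f : Ctl → Ctl) (c : Ctl) (m : Mem) : Runs (.set f) c m (f c) m 1 :=
  ⟨1, le_rfl, .set f c _⟩

theorem seq {p q : RProg} {c c₁ c₂ : Ctl} {m m₁ m₂ : Mem} {t₁ t₂ : ℕ}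
    (h₁ : Runs p c m c₁ m₁ t₁) (h₂ : Runs q c₁ m₁ c₂ m₂ t₂) :
    Runs (.seq p q) c m c₂ m₂ (t₁ + t₂) := by
  obtain ⟨s₁, hs₁, e₁⟩ := h₁
  obtain ⟨s₂, hs₂, e₂⟩ := h₂
  exact ⟨s₁ + s₂, add_le_add hs₁ hs₂, .seq e₁ e₂⟩

theorem ite_true {b : Ctl → Bool} {p : RProg} (q : RProg) {c c' : Ctl} {m m' : Mem} {t : ℕ}
    (hb : b c = true) (h : Runs p c m c' m' t) : Runs (.ite b p q) c m c' m' (1 + t) := by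
  obtain ⟨s, hs, e⟩ := h
  exact ⟨1 + s, by lia, .ite_true hb e⟩

theorem ite_false {b : Ctl → Bool} (p : RProg) {q : RProg} {c c' : Ctl} {m m' : Mem} {t : ℕ}
    (hb : b c = false) (h : Runs q c m c' m' t) : Runs (.ite b p q) c m c' m' (1 + t) := by
  obtain ⟨s, hs, e⟩ := h
  exact ⟨1 + s, by lia, .ite_false hb e⟩

end Runs

/-! ### Loops -/

/-- Run `p` for each symbol of the stack `k`, removing the symbols. -/
def each (k : Reg) (p : RProg) : RProg := .loop k Ctl.read p

theorem Runs.each_nil {k : Reg} (p : RProg) (c : Ctl) {m : Mem} (h : m.get k = []) :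
    Runs (each k p) c m (c.on .delim) m 1 :=
  ⟨1, le_rfl, .loop_nil (f := Ctl.read) h⟩

theorem Runs.each_cons {k : Reg} {p : RProg} {c c₁ c₂ : Ctl} {m m₁ m₂ : Mem} {t₁ t₂ : ℕ} {a : Symb}
    {l : List Symb} (h : m.get k = a :: l) (h₁ : Runs p (c.on a) (m.set k l) c₁ m₁ t₁)
    (h₂ : Runs (each k p) c₁ m₁ c₂ m₂ t₂) : Runs (each k p) c m c₂ m₂ (1 + t₁ + t₂) := by
  obtain ⟨s₁, hs₁, e₁⟩ := h₁
  obtain ⟨s₂, hs₂, e₂⟩ := h₂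
  rw [← Mem.update_get] at e₁
  exact ⟨1 + s₁ + s₂, by lia, .loop_cons (f := Ctl.read) h e₁ e₂⟩

/-- The rule for loops. The states at the loop head are given by the control state `G x` up to the
last symbol read, and by the memory `F x` with the symbols still to be read on the stack `k`. -/
theorem Runs.each_foldl {X : Type} {k : Reg} {p : RProg} (G : X → Ctl) (F : X → Mem)
    (f : X → Symb → X) (Inv : X → List Symb → Prop) (B : ℕ)
    (h : ∀ x a l, Inv x (a :: l) → Inv (f x a) l ∧ ∃ s, Runs p ((G x).on a)
      ((F x).set k l) ((G (f x a)).on s) ((F (f x a)).set k l) B) :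
    ∀ (l : List Symb) (x : X) (s : Symb), Inv x l →
      Runs (each k p) ((G x).on s) ((F x).set k l)
        ((G (l.foldl f x)).on .delim) ((F (l.foldl f x)).set k [])
        (1 + l.length * (B + 1)) := by
  intro l
  induction l with
  | nil =>
    intro x s _
    exact (Runs.each_nil p _ (by simp)).mono (by simp)
  | cons a l ih =>
    intro x s hx
    obtain ⟨hI, s', hs'⟩ := h x a l hx
    refine (Runs.each_cons (a := a) (l := l) (t₁ := B) (by simp) ?_ (ih (f x a) s' hI)).mono ?_
    · simpa using hs'
    · simp only [List.length_cons]
      linarith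

/-- The program that does nothing. -/
def skip : RProg := .set id

theorem runs_skip (c : Ctl) (m : Mem) : Runs skip c m c m 1 := Runs.set id c m

/-- Empty a stack. -/
def clear (k : Reg) : RProg := each k skip

theorem runs_clear (k : Reg) (c : Ctl) (m : Mem) :
    Runs (clear k) c m (c.on .delim) (m.set k []) (1 + (m.get k).length * 2) := by
  have := Runs.each_foldl (X := Unit) (k := k) (p := skip) (fun _ => c)
    (fun _ => m) (fun _ _ => ()) (fun _ _ => True) 1
    (fun _ a _ _ => ⟨trivial, a, runs_skip _ _⟩) (m.get k) () c.sym trivial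
  simpa [clear] using this

/-- Move the content of a stack to another one, reversing it. -/
def move (k k' : Reg) : RProg := each k (.push k' Ctl.sym)

theorem runs_move {k k' : Reg} (h : k ≠ k') (c : Ctl) (m : Mem) :
    Runs (move k k') c m (c.on .delim)
      ((m.set k' ((m.get k).reverse ++ m.get k')).set k []) (1 + (m.get k).length * 2) := by
  have := Runs.each_foldl (k := k) (p := .push k' Ctl.sym) (fun _ => c)
    (fun x => m.set k' x) (fun x a => a :: x) (fun _ _ => True) 1
    (fun x a l _ => ⟨trivial, a, (Runs.push k' _ _ _).congr rfl
      (by simp [Mem.set_comm _ h]) le_rfl⟩)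
    (m.get k) (m.get k') c.sym trivial
  rw [Mem.set_comm _ h, Mem.set_get, Mem.set_get, List.foldl_flip_cons_eq_append'] at this
  exact this

/-- Move the content of a stack to two other ones, reversing it. -/
def move₂ (k k' k'' : Reg) : RProg := each k (.seq (.push k' Ctl.sym) (.push k'' Ctl.sym))

theorem runs_move₂ {k k' k'' : Reg} (h : k ≠ k') (h₁ : k ≠ k'') (h₂ : k' ≠ k'') (c : Ctl) (m : Mem) :
    Runs (move₂ k k' k'') c m (c.on .delim)
      (((m.set k' ((m.get k).reverse ++ m.get k')).set k''
        ((m.get k).reverse ++ m.get k'')).set k []) (1 + (m.get k).length * 3) := by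
  have := Runs.each_foldl (k := k) (p := .seq (.push k' Ctl.sym) (.push k'' Ctl.sym)) (fun _ => c)
    (fun x => (m.set k' (x ++ m.get k')).set k'' (x ++ m.get k'')) (fun x a => a :: x)
    (fun _ _ => True) 2
    (fun x a l _ => ⟨trivial, a, ((Runs.push k' _ _ _).seq (Runs.push k'' _ _ _)).congr rfl
      (by simp [Mem.set_comm _ h, Mem.set_comm _ h₁, Mem.set_comm _ h₂,
        Mem.get_set_of_ne _ h₂]) le_rfl⟩)
    (m.get k) [] c.sym trivial
  simpa [move₂, Mem.set_comm _ h, Mem.set_comm _ h₁] using this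

/-- Copy the content of the stack `k` onto the stack `k'`, using the empty stack `t`. -/
def copy (k k' t : Reg) : RProg := .seq (move k t) (move₂ t k k')

theorem runs_copy {k k' t : Reg} (h : k ≠ k') (h₁ : k ≠ t) (h₂ : k' ≠ t) (c : Ctl) {m : Mem}
    (ht : m.get t = []) :
    Runs (copy k k' t) c m (c.on .delim) (m.set k' (m.get k ++ m.get k'))
      (2 + (m.get k).length * 5) := by
  refine ((runs_move h₁ c m).seq (runs_move₂ h₁.symm h₂.symm h _ _)).congr rfl ?_ ?_
  · refine Mem.ext_get fun r => ?_
    simp only [Mem.get_set]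
    split_ifs <;> simp_all
  · simp [ht, Mem.get_set_of_ne _ h₁.symm]
    lia

/-- Copy the content of the stack `k` in reverse order onto the stack `k'`, using the empty stack
`t`. -/
def copyRev (k k' t : Reg) : RProg := .seq (move₂ k t k') (move t k)

theorem runs_copyRev {k k' t : Reg} (h : k ≠ k') (h₁ : k ≠ t) (h₂ : k' ≠ t) (c : Ctl) {m : Mem}
    (ht : m.get t = []) :
    Runs (copyRev k k' t) c m (c.on .delim) (m.set k' ((m.get k).reverse ++ m.get k'))
      (2 + (m.get k).length * 5) := by
  refine ((runs_move₂ h₁ h h₂.symm c m).seq (runs_move h₁.symm _ _)).congr rfl ?_ ?_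
  · refine Mem.ext_get fun r => ?_
    simp only [Mem.get_set]
    split_ifs <;> simp_all
  · simp [ht, Mem.get_set_of_ne _ h₁.symm, Mem.get_set_of_ne _ h₂.symm]
    lia

/-! ### Literals and words -/

/-- Literals over variables with binary names: the sign and the name. -/
abbrev Lit : Type := Bool × List Bool

namespace Lit

/-- The complementary literal. -/
def neg (l : Lit) : Lit := (!l.1, l.2)

@[simp] theorem neg_neg (l : Lit) : l.neg.neg = l := by simp [neg]

/-- A literal as the content of a stack, with the sign on top. -/
def symbs (l : Lit) : List Symb := (l.1 :: l.2).map Symb.bit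

theorem symbs_injective : Function.Injective symbs := by
  rintro ⟨b, x⟩ ⟨b', x'⟩ h
  have := List.map_injective_iff.2 (fun a b hab => by simpa using hab) h
  simpa using this

/-- A literal as an entry of a list of literals: reading the entry, and pushing its symbols onto an
empty stack, yields the literal as the content of that stack. -/
def word (l : Lit) : List Symb := l.symbs.reverse ++ [Symb.delim]

theorem length_word (l : Lit) : l.word.length = l.symbs.length + 1 := by simp [word]

end Lit

/-- Lists of literals as contents of stacks. -/
def encLits (L : List Lit) : List Symb := L.flatMap Lit.word

/-- Lists of clauses with two literals as contents of stacks. -/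
def encClauses (L : List (Lit × Lit)) : List Symb := L.flatMap fun c => c.1.word ++ c.2.word

@[simp] theorem encLits_nil : encLits [] = [] := rfl

@[simp] theorem encLits_cons (l : Lit) (L : List Lit) : encLits (l :: L) = l.word ++ encLits L := rfl

@[simp] theorem encClauses_nil : encClauses [] = [] := rfl

@[simp] theorem encClauses_cons (c : Lit × Lit) (L : List (Lit × Lit)) :
    encClauses (c :: L) = c.1.word ++ (c.2.word ++ encClauses L) := by
  simp [encClauses]

/-- Collect the next word on the stack `k` into the stack `k'`. -/
theorem Runs.each_collect {k k' : Reg} (hk : k ≠ k') {p : RProg} {t t' : ℕ} {c c' : Ctl} {m' : Mem}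
    (hp : ∀ a, a ≠ Symb.delim → ∀ n, Runs p (c.on a) n (c.on a) (n.set k' (a :: n.get k')) t') :
    ∀ (w l : List Symb) (s : Symb) (m : Mem) (_ : Symb.delim ∉ w),
      (∀ s, Runs (each k p) (c.on s) ((m.set k l).set k' (w.reverse ++ m.get k')) c' m' t) →
      Runs (each k p) (c.on s) (m.set k (w ++ l)) c' m' (w.length * (t' + 1) + t) := by
  intro w
  induction w with
  | nil =>
    intro l s m _ h
    have e : (m.set k l).set k' (m.get k') = m.set k l := by
      rw [Mem.set_comm _ hk.symm, Mem.set_get]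
    simpa [e] using h s
  | cons a w ih =>
    intro l s m hw h
    simp only [List.mem_cons, not_or] at hw
    refine Runs.mono (Runs.each_cons (a := a) (l := w ++ l) (by simp) (hp a (Ne.symm hw.1) _)
      (t₂ := w.length * (t' + 1) + t) ?_) ?_
    · have := ih l a (m.set k' (a :: m.get k')) hw.2 (fun s => by
        simpa [Mem.set_comm _ hk] using h s)
      simpa [Mem.set_comm _ hk.symm, Mem.get_set_of_ne _ hk.symm] using this
    · simp only [List.length_cons]
      linarith

/-- For each word on the stack `k`: collect the word on the stack `k'`, and run `p`. -/
def forWords (k k' : Reg) (p : RProg) : RProg :=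
  each k (.ite (fun c => c.sym = .delim) p (.push k' Ctl.sym))

theorem Lit.delim_notMem_symbs (l : Lit) : Symb.delim ∉ l.symbs := by simp [Lit.symbs]

/-- The rule for loops over lists of literals. -/
theorem runs_forWords {X : Type} {k k' : Reg} (hk : k ≠ k') {p : RProg} (G : X → Ctl) (F : X → Mem)
    (f : X → Lit → X) (Inv : X → List Lit → Prop) (B : ℕ) (hF : ∀ x, (F x).get k' = [])
    (h : ∀ x a l, Inv x (a :: l) → Inv (f x a) l ∧ ∃ s, Runs p ((G x).on .delim)
      (((F x).set k (encLits l)).set k' a.symbs) ((G (f x a)).on s)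
      ((F (f x a)).set k (encLits l)) B) :
    ∀ (l : List Lit) (x : X) (s : Symb), Inv x l →
      Runs (forWords k k' p) ((G x).on s) ((F x).set k (encLits l))
        ((G (l.foldl f x)).on .delim) ((F (l.foldl f x)).set k [])
        (1 + (encLits l).length * (B + 3)) := by
  intro l
  induction l with
  | nil =>
    intro x s _
    exact (Runs.each_nil _ _ (by simp)).mono (by simp)
  | cons a l ih =>
    intro x s hx
    obtain ⟨hI, s', hs'⟩ := h x a l hx
    have key := Runs.each_collect hk (c := G x) (m' := (F (l.foldl f (f x a))).set k [])
      (c' := (G (l.foldl f (f x a))).on .delim)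
      (p := .ite (fun c => c.sym = .delim) p (.push k' Ctl.sym)) (t' := 2)
      (t := 1 + (1 + B) + (1 + (encLits l).length * (B + 3)))
      (fun a ha n => Runs.ite_false _ (by simp [ha]) (Runs.push k' _ _ _))
      a.symbs.reverse (.delim :: encLits l) s (F x) (by simpa using a.delim_notMem_symbs)
      (fun s => Runs.each_cons (a := .delim) (l := encLits l) (by simp [Mem.get_set_of_ne _ hk])
        (Runs.ite_true (t := B) _ (by simp) (by simpa [Mem.set_comm _ hk.symm, hF] using hs'))
        (ih (f x a) s' hI))
    refine Runs.mono (t := _) (by simpa [Lit.word, forWords] using key) ?_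
    simp [a.length_word]
    nlinarith

/-- For each pair of consecutive words on the stack `k`: collect the words on the stacks `k'` and
`k''`, and run `p`. -/
def forPairs (k k' k'' : Reg) (p : RProg) : RProg :=
  each k (.ite (fun c => c.sym = .delim)
    (.ite Ctl.second (.seq p (.set fun c => { c with second := false }))
      (.set fun c => { c with second := true }))
    (.ite Ctl.second (.push k'' Ctl.sym) (.push k' Ctl.sym)))

/-- The rule for loops over lists of clauses. -/
theorem runs_forPairs {X : Type} {k k' k'' : Reg} (hk : k ≠ k') (hk₁ : k ≠ k'') (hk₂ : k' ≠ k'')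
    {p : RProg} (G : X → Ctl) (F : X → Mem) (f : X → Lit × Lit → X)
    (Inv : X → List (Lit × Lit) → Prop) (B : ℕ) (hF : ∀ x, (F x).get k' = [])
    (hF₁ : ∀ x, (F x).get k'' = []) (hG : ∀ x, (G x).second = false)
    (h : ∀ x a l, Inv x (a :: l) → Inv (f x a) l ∧ ∃ s,
      Runs p { (G x).on .delim with second := true }
        ((((F x).set k (encClauses l)).set k' a.1.symbs).set k'' a.2.symbs)
        { (G (f x a)).on s with second := true } ((F (f x a)).set k (encClauses l)) B) :
    ∀ (l : List (Lit × Lit)) (x : X) (s : Symb), Inv x l →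
      Runs (forPairs k k' k'' p) ((G x).on s) ((F x).set k (encClauses l))
        ((G (l.foldl f x)).on .delim) ((F (l.foldl f x)).set k [])
        (1 + (encClauses l).length * (B + 5)) := by
  intro l
  induction l with
  | nil =>
    intro x s _
    exact (Runs.each_nil _ _ (by simp)).mono (by simp)
  | cons a l ih =>
    intro x s hx
    obtain ⟨hI, s', hs'⟩ := h x a l hx
    have key₂ : ∀ s, Runs (forPairs k k' k'' p) (Ctl.on { G x with second := true } s)
        (((F x).set k' a.1.symbs).set k (a.2.symbs.reverse ++ .delim :: encClauses l))
        ((G (l.foldl f (f x a))).on .delim) ((F (l.foldl f (f x a))).set k [])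
        (a.2.symbs.length * 4 + (1 + (1 + (1 + (B + 1))) + (1 + (encClauses l).length * (B + 5)))) := by
      intro s
      refine Runs.mono (Runs.each_collect hk₁ (c := { G x with second := true })
        (t' := 3)
        (fun a ha n => Runs.ite_false _ (by simp [ha]) (Runs.ite_true _ rfl (Runs.push k'' _ _ _)))
        a.2.symbs.reverse (.delim :: encClauses l) s ((F x).set k' a.1.symbs)
        (by simpa using a.2.delim_notMem_symbs)
        (fun s => Runs.each_cons (a := .delim) (l := encClauses l)
          (t₁ := 1 + (1 + (B + 1))) (c₁ := (G (f x a)).on s') (by simp [Mem.get_set_of_ne _ hk₁])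
          (Runs.ite_true _ (by simp) (Runs.ite_true _ rfl (Runs.seq (t₁ := B) (t₂ := 1)
            (c₁ := { (G (f x a)).on s' with second := true }) (m₁ := ((F (f x a)).set k (encClauses l)))
             ?_ ((Runs.set _ _ _).congr ?_ rfl le_rfl))))
          (ih (f x a) s' hI))) ?_
      · have e : Mem.get (Mem.set (F x) k' a.1.symbs) k'' = [] := by
          rw [Mem.get_set_of_ne _ hk₂.symm, hF₁]
        have e' : ((((F x).set k' a.1.symbs).set k (.delim :: encClauses l)).set k''
            (a.2.symbs.reverse.reverse ++ Mem.get (Mem.set (F x) k' a.1.symbs) k'')).set k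
              (encClauses l) =
            (((F x).set k (encClauses l)).set k' a.1.symbs).set k'' a.2.symbs := by
          simp [e, Mem.set_comm _ hk₁.symm, Mem.set_comm _ hk.symm]
        rw [e']
        exact hs'
      · rw [← hG (f x a)]
        rfl
      · simp
    have key := Runs.each_collect hk (c := G x) (m' := (F (l.foldl f (f x a))).set k [])
      (c' := (G (l.foldl f (f x a))).on .delim) (t' := 3)
      (p := .ite (fun c => c.sym = .delim)
        (.ite Ctl.second (.seq p (.set fun c => { c with second := false }))
          (.set fun c => { c with second := true }))
        (.ite Ctl.second (.push k'' Ctl.sym) (.push k' Ctl.sym)))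
      (fun a ha n => Runs.ite_false _ (by simp [ha])
        (Runs.ite_false (c := (G x).on a) _ (hG x) (Runs.push k' _ _ _)))
      a.1.symbs.reverse (.delim :: (a.2.symbs.reverse ++ .delim :: encClauses l)) s (F x)
      (by simpa using a.1.delim_notMem_symbs)
      (fun s => Runs.each_cons (a := .delim) (l := a.2.symbs.reverse ++ .delim :: encClauses l)
        (t₁ := 3) (by simp [Mem.get_set_of_ne _ hk])
        (Runs.ite_true _ (by simp) (Runs.ite_false (c := (G x).on .delim) _ (hG x) (Runs.set _ _ _)))
        (by
          simp only [List.reverse_reverse, hF, List.append_nil, Mem.set_comm _ hk.symm, Mem.set_set]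
          exact key₂ .delim))
    refine Runs.mono (t := _) (by simpa [Lit.word, forPairs] using key) ?_
    simp [Lit.length_word]
    nlinarith

/-! ### Searching a list of literals -/

/-- Compare the word on the stack `wrd` with the one on the stack `qry`, and remove the former. -/
def compare : RProg :=
  .seq (.set fun c => { c with ok := true }) <|
  .seq (copy .qry .cmp .tmp) <|
  .seq (each .wrd (.pop .cmp fun c o => { c with ok := c.ok && o = some c.sym })) <|
  .seq (.pop .cmp fun c o => { c with ok := c.ok && o.isNone }) <|
  .seq (clear .cmp) (.set fun c => { c with found := c.found || c.ok, ok := false })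

theorem foldl_compare (w : List Symb) : ∀ (b : Bool) (y : List Symb),
    let r := w.foldl (fun (x : Bool × List Symb) a => (x.1 && x.2.head? = some a, x.2.tail)) (b, y)
    (r.1 && r.2.head?.isNone) = (b && decide (w = y)) ∧ r.2.length ≤ y.length := by
  induction w with
  | nil => intro b y; cases y <;> simp
  | cons a w ih =>
    intro b y
    obtain ⟨h₁, h₂⟩ := ih (b && y.head? = some a) y.tail
    refine ⟨h₁.trans ?_, h₂.trans (by simp)⟩
    cases y with
    | nil => simp
    | cons a' y =>
      by_cases h : a = a'
      · subst h
        by_cases hw : w = y <;> simp [hw]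
      · simp [h, Ne.symm h]

theorem runs_compare (c : Ctl) {m : Mem} (hc : m.cmp = []) (ht : m.tmp = []) :
    Runs compare c m
      { c.on .delim with found := c.found || decide (m.wrd = m.qry), ok := false }
      (m.set .wrd []) (7 + 7 * m.qry.length + 2 * m.wrd.length) := by
  obtain ⟨hr, hl⟩ := foldl_compare m.wrd true m.qry
  set r := m.wrd.foldl (fun (x : Bool × List Symb) a => (x.1 && x.2.head? = some a, x.2.tail))
    (true, m.qry) with hr'
  have h₁ := Runs.set (fun c => { c with ok := true }) c m
  have h₂ := runs_copy (k := .qry) (k' := .cmp) (t := .tmp) (by decide) (by decide) (by decide)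
    { c with ok := true } (m := m) ht
  have h₃ := Runs.each_foldl (k := .wrd)
    (p := .pop .cmp fun c o => { c with ok := c.ok && o = some c.sym })
    (fun x : Bool × List Symb => { c with ok := x.1 }) (fun x => m.set .cmp x.2)
    (fun x a => (x.1 && x.2.head? = some a, x.2.tail)) (fun _ _ => True) 1
    (fun x a l _ => ⟨trivial, a, Runs.pop _ _ _ _⟩) m.wrd (true, m.qry) .delim trivial
  have h₄ := Runs.pop .cmp (fun c o => { c with ok := c.ok && o.isNone })
    ({ c.on .delim with ok := r.1 }) ((m.set .cmp r.2).set .wrd [])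
  have h₅ := runs_clear .cmp ({ c.on .delim with ok := r.1 && r.2.head?.isNone })
    ((m.set .cmp r.2.tail).set .wrd [])
  have h₆ := Runs.set (fun c => { c with found := c.found || c.ok, ok := false })
    ({ c.on .delim with ok := r.1 && r.2.head?.isNone }) ((m.set .wrd []).set .cmp [])
  have e : m.set .cmp (m.get .qry ++ m.get .cmp) = (m.set .cmp m.qry).set .wrd m.wrd := by
    change m.set .cmp (m.qry ++ m.cmp) = _
    rw [hc, List.append_nil]
    rfl
  rw [e] at h₂
  have e' : (m.set .wrd []).set .cmp [] = m.set .wrd [] := by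
    rw [← hc]
    rfl
  refine (h₁.seq (h₂.seq (h₃.seq (h₄.seq (h₅.seq h₆))))).congr ?_ e' ?_
  · simp only [Bool.true_and] at hr
    simp only [hr]
    rfl
  · have : (Mem.get ((m.set .cmp r.2.tail).set .wrd []) .cmp).length ≤ m.qry.length := by
      change r.2.tail.length ≤ _
      simp only [List.length_tail]
      lia
    change 1 + (2 + m.qry.length * 5 + (1 + m.wrd.length * 2 + (1 + (1 + _ * 2 + 1)))) ≤ _
    lia

/-- Search the list of literals on the stack `reach` for the literal on the stack `qry`. -/
def member : RProg :=
  .seq (.set fun c => { c with found := false, ok := false }) <|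
  .seq (copy .reach .mem .tmp) (forWords .mem .wrd compare)

theorem runs_member (c : Ctl) {m : Mem} (R : List Lit) (q : Lit) (N : ℕ) (hR : m.reach = encLits R)
    (hq : m.qry = q.symbs) (hm : m.mem = []) (hw : m.wrd = []) (hc : m.cmp = []) (ht : m.tmp = [])
    (hRN : (encLits R).length ≤ N) (hqN : q.symbs.length ≤ N) :
    Runs member c m { c.on .delim with found := decide (q ∈ R), ok := false } m
      (N * (9 * N + 15) + 4) := by
  have h₁ := Runs.set (fun c => { c with found := false, ok := false }) c m
  have h₂ := runs_copy (k := .reach) (k' := .mem) (t := .tmp) (by decide) (by decide) (by decide)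
    { c with found := false, ok := false } (m := m) ht
  have h₃ := runs_forWords (k := .mem) (k' := .wrd) (by decide) (p := compare)
    (fun x : Bool => { c with found := x, ok := false }) (fun _ => m)
    (fun x l => x || decide (l = q)) (fun _ ls => ∀ l ∈ ls, l.symbs.length ≤ N) (7 + 9 * N)
    (fun _ => hw) (fun x a l hI => ⟨fun b hb => hI b (List.mem_cons_of_mem _ hb), .delim, by
      refine (runs_compare ({ c.on .delim with found := x, ok := false })
        (m := (m.set .mem (encLits l)).set .wrd a.symbs) hc ht).congr ?_ ?_ ?_
      · change ({ c.on .delim with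
          found := x || decide (a.symbs = m.qry), ok := false } : Ctl) = _
        rw [hq]
        simp only [Lit.symbs_injective.eq_iff]
        rfl
      · rw [Mem.set_set, Mem.set_comm _ (by decide)]
        rw [← hw]
        rfl
      · have := hI a List.mem_cons_self
        change 7 + 7 * m.qry.length + 2 * a.symbs.length ≤ _
        rw [hq]
        lia⟩) R false .delim (fun l hl => by
          refine le_trans ?_ hRN
          obtain ⟨L₁, L₂, rfl⟩ := List.append_of_mem hl
          simp [encLits, Lit.length_word]
          lia)
  have e : m.set .mem (m.get .reach ++ m.get .mem) = m.set .mem (encLits R) := by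
    change m.set .mem (m.reach ++ m.mem) = _
    rw [hm, hR, List.append_nil]
  rw [e] at h₂
  refine (h₁.seq (h₂.seq h₃)).congr ?_ ?_ ?_
  · have : ∀ (R : List Lit) (x : Bool),
        R.foldl (fun x l => x || decide (l = q)) x = (x || decide (q ∈ R)) := by
      intro R
      induction R with
      | nil => simp
      | cons a R ih =>
        intro x
        rw [List.foldl_cons, ih]
        by_cases h : q = a
        · simp [h]
        · simp [h, Ne.symm h]
    rw [this, Bool.false_or]
    rfl
  · rw [← hm]
    rfl
  · change 1 + (2 + m.reach.length * 5 + (1 + _)) ≤ _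
    rw [hR]
    nlinarith

/-! ### Saturation of a set of literals -/

/-- Complement the literal on a stack. -/
def flipSign (k : Reg) : RProg :=
  .seq (.pop k Ctl.read) (.push k fun c => match c.sym with
    | .bit b => .bit !b
    | a => a)

theorem runs_flipSign (k : Reg) (c : Ctl) {m : Mem} (l : Lit) (h : m.get k = l.symbs) :
    Runs (flipSign k) c m (c.on (.bit l.1)) (m.set k l.neg.symbs) 2 := by
  refine ((Runs.pop _ _ _ _).seq (Runs.push _ _ _ _)).congr ?_ ?_ le_rfl
  · simp [h, Lit.symbs, Ctl.read]
  · simp [h, Lit.symbs, Ctl.read, Lit.neg]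

/-- If the complement of the literal on `k` is in the list on `reach`, then add the literal on `k'`
to that list. -/
def propagate (k k' : Reg) : RProg :=
  .seq (copy k .qry .tmp) <| .seq (flipSign .qry) <| .seq member <|
  .seq (.ite Ctl.found (.seq (.push .reach fun _ => .delim) (copyRev k' .reach .tmp)) skip) <|
  .seq (clear .qry) (.set fun c => { c with found := false })

/-- The clause `a ∨ b` forces `b` if the complement of `a` is in `R`. -/
def extend (R : List Lit) (a b : Lit) : List Lit := if a.neg ∈ R then b :: R else R

theorem Lit.length_symbs_neg (l : Lit) : l.neg.symbs.length = l.symbs.length := by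
  simp [Lit.symbs, Lit.neg]

theorem runs_propagate {k k' : Reg} (hk : k = .fst ∧ k' = .snd ∨ k = .snd ∧ k' = .fst) (c : Ctl)
    {m : Mem} (R : List Lit) (a b : Lit) (N : ℕ) (hR : m.reach = encLits R)
    (ha : m.get k = a.symbs) (hb : m.get k' = b.symbs) (hm : m.mem = []) (hw : m.wrd = [])
    (hq : m.qry = []) (hc : m.cmp = []) (ht : m.tmp = [])
    (hRN : (encLits R).length ≤ N) (haN : a.symbs.length ≤ N) (hbN : b.symbs.length ≤ N) :
    Runs (propagate k k') c m { c.on .delim with found := false, ok := false }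
      (m.set .reach (encLits (extend R a b))) (N * (9 * N + 27) + 14) := by
  have hk₁ : k ≠ .qry := by rcases hk with ⟨rfl, rfl⟩ | ⟨rfl, rfl⟩ <;> decide
  have hk₂ : k ≠ .tmp := by rcases hk with ⟨rfl, rfl⟩ | ⟨rfl, rfl⟩ <;> decide
  have hk₃ : k' ≠ .reach := by rcases hk with ⟨rfl, rfl⟩ | ⟨rfl, rfl⟩ <;> decide
  have hk₄ : k' ≠ .tmp := by rcases hk with ⟨rfl, rfl⟩ | ⟨rfl, rfl⟩ <;> decide
  have hk₅ : k' ≠ .qry := by rcases hk with ⟨rfl, rfl⟩ | ⟨rfl, rfl⟩ <;> decide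
  have h₁ := runs_copy (k := k) (k' := .qry) (t := .tmp) hk₁ hk₂ (by decide) c (m := m) ht
  have e₁ : m.set .qry (m.get k ++ m.get .qry) = m.set .qry a.symbs := by
    change m.set .qry (m.get k ++ m.qry) = _
    rw [ha, hq, List.append_nil]
  rw [e₁, ha] at h₁
  have h₂ := runs_flipSign .qry (c.on .delim) (m := m.set .qry a.symbs) a rfl
  rw [Mem.set_set] at h₂
  have h₃ := runs_member (c.on (.bit a.1)) (m := m.set .qry a.neg.symbs) R a.neg N hR rfl hm hw hc ht
    hRN (by rwa [Lit.length_symbs_neg])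
  have h₄ : Runs (.ite Ctl.found (.seq (.push .reach fun _ => .delim) (copyRev k' .reach .tmp)) skip)
      { c.on .delim with found := decide (a.neg ∈ R), ok := false } (m.set .qry a.neg.symbs)
      { c.on .delim with found := decide (a.neg ∈ R), ok := false }
      ((m.set .qry a.neg.symbs).set .reach (encLits (extend R a b))) (4 + 5 * N) := by
    by_cases hmem : a.neg ∈ R
    · refine Runs.mono (Runs.ite_true _ (by simpa using hmem) (((Runs.push _ _ _ _).seq
        (runs_copyRev hk₃ hk₄ (by decide) _ ?_)).congr rfl ?_ le_rfl)) ?_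
      · exact ht
      · rw [Mem.get_set_self, Mem.get_set_of_ne _ hk₃, Mem.get_set_of_ne _ hk₅, hb, Mem.set_set]
        change Mem.set _ _ (b.symbs.reverse ++ .delim :: m.reach) = _
        simp [hR, extend, hmem, Lit.word]
      · rw [Mem.get_set_of_ne _ hk₃, Mem.get_set_of_ne _ hk₅, hb]
        lia
    · refine Runs.mono (Runs.ite_false _ (by simpa using hmem) ((runs_skip _ _).congr rfl ?_ le_rfl))
        (by lia)
      simp only [extend, hmem, if_false]
      rw [← hR]
      rfl
  have h₅ := runs_clear .qry ({ c.on .delim with found := decide (a.neg ∈ R), ok := false })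
    ((m.set .qry a.neg.symbs).set .reach (encLits (extend R a b)))
  have h₆ := Runs.set (fun c => { c with found := false })
    ({ c.on .delim with found := decide (a.neg ∈ R), ok := false })
    ((m.set .reach (encLits (extend R a b))).set .qry [])
  refine (h₁.seq (h₂.seq (h₃.seq (h₄.seq (h₅.seq h₆))))).congr rfl ?_ ?_
  · rw [← hq]
    rfl
  · change 2 + a.symbs.length * 5 + (2 + (N * (9 * N + 15) + 4 + (4 + 5 * N +
      (1 + a.neg.symbs.length * 2 + 1)))) ≤ _
    rw [Lit.length_symbs_neg]
    nlinarith

theorem encLits_append (L L' : List Lit) : encLits (L ++ L') = encLits L ++ encLits L' := by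
  simp [encLits]

theorem length_encLits_extend_le (R : List Lit) (a b : Lit) :
    (encLits (extend R a b)).length ≤ (encLits R).length + b.word.length := by
  unfold extend
  split_ifs
  · simp [Nat.add_comm]
  · lia

/-- A clause read as two implications. -/
def absorb (R : List Lit) (c : Lit × Lit) : List Lit := extend (extend R c.1 c.2) c.2 c.1

theorem length_encLits_absorb_le (R : List Lit) (c : Lit × Lit) :
    (encLits (absorb R c)).length ≤ (encLits R).length + c.1.word.length + c.2.word.length := by
  have h₁ := length_encLits_extend_le R c.1 c.2
  have h₂ := length_encLits_extend_le (extend R c.1 c.2) c.2 c.1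
  unfold absorb
  lia

theorem length_encLits_foldl_absorb_le (cl : List (Lit × Lit)) : ∀ R : List Lit,
    (encLits (cl.foldl absorb R)).length ≤ (encLits R).length + (encClauses cl).length := by
  induction cl with
  | nil => simp
  | cons c cl ih =>
    intro R
    have h₁ := ih (absorb R c)
    have h₂ := length_encLits_absorb_le R c
    simp only [List.foldl_cons, encClauses_cons, List.length_append]
    lia

/-- Apply all clauses on the stack `cls` once to the list of literals on the stack `reach`. -/
def pass : RProg :=
  .seq (copy .cls .scan .tmp) <| forPairs .scan .fst .snd <|
    .seq (propagate .fst .snd) <| .seq (propagate .snd .fst) <| .seq (clear .fst) (clear .snd)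

theorem runs_pass (c : Ctl) {m : Mem} (cl : List (Lit × Lit)) (R : List Lit) (N : ℕ)
    (hf : c.found = false) (ho : c.ok = false) (hs : c.second = false)
    (hcl : m.cls = encClauses cl) (hR : m.reach = encLits R) (hsc : m.scan = []) (h₁ : m.fst = [])
    (h₂ : m.snd = []) (hm : m.mem = []) (hw : m.wrd = []) (hq : m.qry = []) (hc : m.cmp = [])
    (ht : m.tmp = []) (hN : (encLits R).length + (encClauses cl).length ≤ N) :
    Runs pass c m (c.on .delim) (m.set .reach (encLits (cl.foldl absorb R)))
      (N * (N * (18 * N + 58) + 40) + 3) := by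
  have e₁ := runs_copy (k := .cls) (k' := .scan) (t := .tmp) (by decide) (by decide) (by decide)
    c (m := m) ht
  have e : m.set .scan (m.get .cls ++ m.get .scan) =
      (m.set .reach (encLits R)).set .scan (encClauses cl) := by
    change m.set .scan (m.cls ++ m.scan) = _
    rw [hcl, hsc, List.append_nil, ← hR]
    rfl
  rw [e] at e₁
  have e₂ := runs_forPairs (k := .scan) (k' := .fst) (k'' := .snd) (by decide) (by decide)
    (by decide) (p := .seq (propagate .fst .snd) <| .seq (propagate .snd .fst) <|
      .seq (clear .fst) (clear .snd)) (fun _ => c) (fun R => m.set .reach (encLits R)) absorb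
    (fun R cl => (encLits R).length + (encClauses cl).length ≤ N) (N * (18 * N + 58) + 30)
    (fun _ => h₁) (fun _ => h₂) (fun _ => hs) (fun R a cl hI => by
      have hl := length_encLits_absorb_le R a
      have hl' := length_encLits_extend_le R a.1 a.2
      simp only [encClauses_cons, List.length_append] at hI
      have hl₁ := a.1.length_word
      have hl₂ := a.2.length_word
      refine ⟨by lia, .delim, ?_⟩
      have p₁ := runs_propagate (k := .fst) (k' := .snd) (Or.inl ⟨rfl, rfl⟩)
        ({ c.on .delim with second := true })
        (m := (((m.set .reach (encLits R)).set .scan (encClauses cl)).set .fst a.1.symbs).set .snd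
          a.2.symbs) R a.1 a.2 N rfl rfl rfl hm hw hq hc ht (by lia) (by lia) (by lia)
      have p₂ := runs_propagate (k := .snd) (k' := .fst) (Or.inr ⟨rfl, rfl⟩)
        ({ c.on .delim with second := true, found := false, ok := false })
        (m := (((m.set .reach (encLits (extend R a.1 a.2))).set .scan (encClauses cl)).set .fst
          a.1.symbs).set .snd a.2.symbs) (extend R a.1 a.2) a.2 a.1 N rfl rfl rfl hm hw hq hc ht
          (by lia) (by lia) (by lia)
      have p₃ := runs_clear .fst ({ c.on .delim with second := true, found := false, ok := false })
        ((((m.set .reach (encLits (absorb R a))).set .scan (encClauses cl)).set .fst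
          a.1.symbs).set .snd a.2.symbs)
      have p₄ := runs_clear .snd ({ c.on .delim with second := true, found := false, ok := false })
        ((((m.set .reach (encLits (absorb R a))).set .scan (encClauses cl)).set .snd
          a.2.symbs).set .fst [])
      refine (p₁.seq (p₂.seq (p₃.seq p₄))).congr ?_ ?_ ?_
      · ext1 <;> first | rfl | exact hf.symm | exact ho.symm
      · change ((((m.set .reach (encLits (absorb R a))).set .scan (encClauses cl)).set .fst
          []).set .snd []) = _
        ext1 <;> first | rfl | exact h₁.symm | exact h₂.symm
      · change _ + (_ + (1 + a.1.symbs.length * 2 + (1 + a.2.symbs.length * 2))) ≤ _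
        nlinarith) cl R .delim hN
  refine (e₁.seq e₂).congr rfl ?_ ?_
  · rw [← hsc]
    rfl
  · change 2 + m.cls.length * 5 + (1 + _) ≤ _
    rw [hcl]
    have : (encClauses cl).length ≤ N := by lia
    nlinarith [Nat.mul_le_mul_right (N * (18 * N + 58) + 30 + 5) this]

/-- The list of all literals of a list of clauses. -/
def literals (cl : List (Lit × Lit)) : List Lit := cl.flatMap fun c => [c.1, c.2]

theorem encLits_literals (cl : List (Lit × Lit)) : encLits (literals cl) = encClauses cl := by
  induction cl with
  | nil => rfl
  | cons c cl ih =>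
    rw [encClauses_cons, ← ih]
    simp [literals, encLits]

/-- The literals that `l` forces: all clauses are applied as often as the word for the clauses has
symbols. -/
def saturate (cl : List (Lit × Lit)) (l : Lit) : List Lit :=
  (fun R => cl.foldl absorb R)^[(encClauses cl).length] [l]

/-- Decide whether the literal on the stack `cur` forces its complement. -/
def explore : RProg :=
  .seq (.push .reach fun _ => .delim) <| .seq (copyRev .cur .reach .tmp) <|
  .seq (copy .cls .cnt .tmp) <| .seq (each .cnt pass) <|
  .seq (copy .cur .qry .tmp) <| .seq (flipSign .qry) <| .seq member <|
  .seq (clear .qry) (clear .reach)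

/-- A time bound for `explore`. -/
def exploreTime (N : ℕ) : ℕ := N * (N * (N * (18 * N + 58) + 40) + 9 * N + 38) + 16

theorem runs_explore (c : Ctl) {m : Mem} (cl : List (Lit × Lit)) (l : Lit) (N : ℕ)
    (hf : c.found = false) (ho : c.ok = false) (hs : c.second = false)
    (hcl : m.cls = encClauses cl) (hl : m.cur = l.symbs) (hR : m.reach = []) (hn : m.cnt = [])
    (hsc : m.scan = []) (h₁ : m.fst = [])
    (h₂ : m.snd = []) (hm : m.mem = []) (hw : m.wrd = []) (hq : m.qry = []) (hc : m.cmp = [])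
    (ht : m.tmp = []) (hN : l.word.length + (encClauses cl).length * (encClauses cl).length ≤ N)
    (hN' : (encClauses cl).length ≤ N) :
    Runs explore c m { c.on .delim with found := decide (l.neg ∈ saturate cl l) } m
      (exploreTime N) := by
  have p₁ := Runs.push .reach (fun _ => .delim) c m
  have p₂ := runs_copyRev (k := .cur) (k' := .reach) (t := .tmp) (by decide) (by decide)
    (by decide) c (m := m.set .reach (.delim :: m.get .reach)) ht
  have e₂ : (m.set .reach (.delim :: m.get .reach)).set .reach
      ((Mem.get (m.set .reach (.delim :: m.get .reach)) .cur).reverse ++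
        Mem.get (m.set .reach (.delim :: m.get .reach)) .reach) =
      m.set .reach (encLits [l]) := by
    change m.set .reach (m.cur.reverse ++ .delim :: m.reach) = _
    rw [hl, hR]
    simp [Lit.word]
  rw [e₂] at p₂
  have p₃ := runs_copy (k := .cls) (k' := .cnt) (t := .tmp) (by decide) (by decide)
    (by decide) (c.on .delim) (m := m.set .reach (encLits [l])) ht
  have e₃ : (m.set .reach (encLits [l])).set .cnt
      (Mem.get (m.set .reach (encLits [l])) .cls ++ Mem.get (m.set .reach (encLits [l])) .cnt) =
      (m.set .reach (encLits [l])).set .cnt (encClauses cl) := by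
    change (m.set .reach (encLits [l])).set .cnt (m.cls ++ m.cnt) = _
    rw [hcl, hn, List.append_nil]
  rw [e₃] at p₃
  -- the copy of the clauses on `cnt` only counts the passes; a pass lengthens the list on `reach` by
  -- at most the length of the clauses, so that `N` bounds the length of that list throughout
  have p₄ := Runs.each_foldl (k := .cnt) (p := pass) (fun _ => c)
    (fun R => m.set .reach (encLits R)) (fun R _ => cl.foldl absorb R)
    (fun R l => (encLits R).length + l.length * (encClauses cl).length ≤ N)
    (N * (N * (18 * N + 58) + 40) + 3) (fun R a l hI => by
      simp only [List.length_cons, Nat.succ_mul] at hI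
      refine ⟨?_, .delim, ?_⟩
      · have := length_encLits_foldl_absorb_le cl R
        lia
      · exact runs_pass (c.on a) (m := (m.set .reach (encLits R)).set .cnt l) cl R N hf ho hs hcl
          rfl hsc h₁ h₂ hm hw hq hc ht (by lia)) (encClauses cl) [l] .delim (by simpa using hN)
  have hfold : ∀ (w : List Symb) (R : List Lit), w.foldl (fun R _ => cl.foldl absorb R) R =
      (fun R => cl.foldl absorb R)^[w.length] R := by
    intro w
    induction w with
    | nil => simp
    | cons a w ih => intro R; simp [ih]
  have hlen : ∀ (k : ℕ) (R : List Lit), (encLits ((fun R => cl.foldl absorb R)^[k] R)).length ≤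
      (encLits R).length + k * (encClauses cl).length := by
    intro k
    induction k with
    | zero => simp
    | succ k ih =>
      intro R
      have := ih (cl.foldl absorb R)
      have := length_encLits_foldl_absorb_le cl R
      rw [Function.iterate_succ_apply, Nat.succ_mul]
      lia
  rw [hfold] at p₄
  change Runs _ _ _ _ ((m.set .reach (encLits (saturate cl l))).set .cnt []) _ at p₄
  have e₄ : (m.set .reach (encLits (saturate cl l))).set .cnt [] =
      m.set .reach (encLits (saturate cl l)) := by
    rw [← hn]
    rfl
  rw [e₄] at p₄
  have p₅ := runs_copy (k := .cur) (k' := .qry) (t := .tmp) (by decide) (by decide)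
    (by decide) (c.on .delim) (m := m.set .reach (encLits (saturate cl l))) ht
  have e₅ : (m.set .reach (encLits (saturate cl l))).set .qry
      (Mem.get (m.set .reach (encLits (saturate cl l))) .cur ++
        Mem.get (m.set .reach (encLits (saturate cl l))) .qry) =
      (m.set .reach (encLits (saturate cl l))).set .qry l.symbs := by
    change (m.set .reach (encLits (saturate cl l))).set .qry (m.cur ++ m.qry) = _
    rw [hl, hq, List.append_nil]
  rw [e₅] at p₅
  have p₆ := runs_flipSign .qry (c.on .delim)
    (m := (m.set .reach (encLits (saturate cl l))).set .qry l.symbs) l rfl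
  rw [Mem.set_set] at p₆
  have hword := l.length_word
  have p₇ := runs_member (c.on (.bit l.1))
    (m := (m.set .reach (encLits (saturate cl l))).set .qry l.neg.symbs) (saturate cl l) l.neg N
    rfl rfl hm hw hc ht (by
      have := hlen (encClauses cl).length [l]
      simp only [encLits_cons, encLits_nil, List.append_nil] at this
      exact this.trans hN) (by rw [Lit.length_symbs_neg]; lia)
  have p₈ := runs_clear .qry
    ({ c.on .delim with found := decide (l.neg ∈ saturate cl l), ok := false })
    ((m.set .reach (encLits (saturate cl l))).set .qry l.neg.symbs)
  have p₉ := runs_clear .reach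
    ({ c.on .delim with found := decide (l.neg ∈ saturate cl l), ok := false })
    ((m.set .qry []).set .reach (encLits (saturate cl l)))
  refine (p₁.seq (p₂.seq (p₃.seq (p₄.seq (p₅.seq (p₆.seq (p₇.seq (p₈.seq p₉)))))))).congr ?_ ?_ ?_
  · rw [← ho]
    rfl
  · change (m.set .qry []).set .reach [] = m
    ext1 <;> first | rfl | exact hq.symm | exact hR.symm
  · have := hlen (encClauses cl).length [l]
    simp only [encLits_cons, encLits_nil, List.append_nil] at this
    have h' : (encLits (saturate cl l)).length ≤ N := this.trans hN
    change 1 + (2 + m.cur.length * 5 + (2 + m.cls.length * 5 + (1 + (encClauses cl).length *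
      (N * (N * (18 * N + 58) + 40) + 3 + 1) + (2 + m.cur.length * 5 + (2 + (N * (9 * N + 15) + 4 +
      (1 + l.neg.symbs.length * 2 + (1 + (encLits (saturate cl l)).length * 2)))))))) ≤ _
    have e : exploreTime N = N * (N * (N * (18 * N + 58) + 40) + 3 + 1) + N * (9 * N + 15) +
        19 * N + 16 := by
      rw [exploreTime]
      ring
    rw [hcl, hl, Lit.length_symbs_neg, e]
    have := Nat.mul_le_mul_right (N * (N * (18 * N + 58) + 40) + 3 + 1) hN'
    have : l.symbs.length ≤ N := by lia
    linarith

/-- Record in the flag `bad` whether the literal on the stack `cur` and its complement force each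
other. -/
def refute : RProg :=
  .seq explore <| .seq (.set fun c => { c with prev := c.found, found := false }) <|
  .seq (flipSign .cur) <| .seq explore <|
  .seq (.set fun c => { c with bad := c.bad || (c.prev && c.found), prev := false, found := false })
    (clear .cur)

/-- Whether a literal and its complement force each other. -/
def Refuted (cl : List (Lit × Lit)) (l : Lit) : Prop :=
  l.neg ∈ saturate cl l ∧ l ∈ saturate cl l.neg

instance (cl : List (Lit × Lit)) (l : Lit) : Decidable (Refuted cl l) :=
  inferInstanceAs (Decidable (_ ∧ _))

/-- Record in the flag `bad` whether the clauses on the stack `cls` are unsatisfiable. -/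
def solve : RProg := .seq (copy .cls .lits .tmp) (forWords .lits .cur refute)

/-- A time bound for `solve`. -/
def solveTime (L : ℕ) : ℕ := L * (2 * exploreTime (L + L * L) + 2 * L + 15) + 3

theorem runs_solve (c : Ctl) {m : Mem} (cl : List (Lit × Lit))
    (hf : c.found = false) (ho : c.ok = false) (hp : c.prev = false) (hs : c.second = false)
    (hcl : m.cls = encClauses cl) (hli : m.lits = []) (hl : m.cur = []) (hR : m.reach = [])
    (hn : m.cnt = []) (hsc : m.scan = []) (h₁ : m.fst = [])
    (h₂ : m.snd = []) (hm : m.mem = []) (hw : m.wrd = []) (hq : m.qry = []) (hc : m.cmp = [])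
    (ht : m.tmp = []) :
    Runs solve c m { c.on .delim with bad := c.bad || decide (∃ l ∈ literals cl, Refuted cl l) } m
      (solveTime (encClauses cl).length) := by
  set L := (encClauses cl).length with hL
  have p₁ := runs_copy (k := .cls) (k' := .lits) (t := .tmp) (by decide) (by decide)
    (by decide) c (m := m) ht
  have e₁ : m.set .lits (m.get .cls ++ m.get .lits) = m.set .lits (encLits (literals cl)) := by
    change m.set .lits (m.cls ++ m.lits) = _
    rw [hcl, hli, List.append_nil, encLits_literals]
  rw [e₁] at p₁
  have p₂ := runs_forWords (k := .lits) (k' := .cur) (by decide) (p := refute)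
    (fun x : Bool => { c with bad := x }) (fun _ => m) (fun x l => x || decide (Refuted cl l))
    (fun _ ls => ∀ l ∈ ls, l.word.length ≤ L) (2 * exploreTime (L + L * L) + 2 * L + 5)
    (fun _ => hl) (fun x l ls hI => ⟨fun b hb => hI b (List.mem_cons_of_mem _ hb), .delim, by
      have hlL := hI l List.mem_cons_self
      have hword := l.length_word
      have hword' := l.neg.length_word
      rw [Lit.length_symbs_neg] at hword'
      have q₁ := runs_explore ({ c.on .delim with bad := x })
        (m := (m.set .lits (encLits ls)).set .cur l.symbs) cl l (L + L * L) hf ho hs hcl rfl hR hn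
        hsc h₁ h₂ hm hw hq hc ht (by lia) (by lia)
      have q₂ := Runs.set (fun c => { c with prev := c.found, found := false })
        ({ c.on .delim with bad := x, found := decide (l.neg ∈ saturate cl l) })
        ((m.set .lits (encLits ls)).set .cur l.symbs)
      have q₃ := runs_flipSign .cur
        ({ c.on .delim with bad := x, prev := decide (l.neg ∈ saturate cl l), found := false })
        (m := (m.set .lits (encLits ls)).set .cur l.symbs) l rfl
      rw [Mem.set_set] at q₃
      have q₄ := runs_explore ({ c.on (.bit l.1) with
          bad := x, prev := decide (l.neg ∈ saturate cl l), found := false })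
        (m := (m.set .lits (encLits ls)).set .cur l.neg.symbs) cl l.neg (L + L * L) rfl ho hs hcl
        rfl hR hn hsc h₁ h₂ hm hw hq hc ht (by lia) (by lia)
      have q₅ := Runs.set (fun c => { c with
          bad := c.bad || (c.prev && c.found), prev := false, found := false })
        ({ c.on .delim with bad := x, prev := decide (l.neg ∈ saturate cl l),
                            found := decide (l.neg.neg ∈ saturate cl l.neg) })
        ((m.set .lits (encLits ls)).set .cur l.neg.symbs)
      have q₆ := runs_clear .cur ({ c.on .delim with
          bad := x || (decide (l.neg ∈ saturate cl l) && decide (l.neg.neg ∈ saturate cl l.neg)),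
          prev := false, found := false })
        ((m.set .lits (encLits ls)).set .cur l.neg.symbs)
      refine (q₁.seq (q₂.seq (q₃.seq (q₄.seq (q₅.seq q₆))))).congr ?_ ?_ ?_
      · have : (decide (l.neg ∈ saturate cl l) && decide (l.neg.neg ∈ saturate cl l.neg)) =
            decide (Refuted cl l) := by
          rw [Lit.neg_neg, ← Bool.decide_and]
          rfl
        ext1 <;> first | rfl | exact hp.symm | exact hf.symm | exact congrArg (x || ·) this
      · rw [Mem.set_set, ← hl]
        rfl
      · change _ + (1 + (2 + (_ + (1 + (1 + l.neg.symbs.length * 2))))) ≤ _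
        rw [Lit.length_symbs_neg]
        lia⟩) (literals cl) c.bad .delim (fun l hl => by
          rw [hL, ← encLits_literals]
          obtain ⟨L₁, L₂, e⟩ := List.append_of_mem hl
          rw [e, encLits_append, encLits_cons]
          simp only [List.length_append]
          lia)
  have hfold : ∀ (ls : List Lit) (x : Bool),
      ls.foldl (fun x l => x || decide (Refuted cl l)) x =
        (x || decide (∃ l ∈ ls, Refuted cl l)) := by
    intro ls
    induction ls with
    | nil => simp
    | cons l ls ih =>
      intro x
      rw [List.foldl_cons, ih, Bool.eq_iff_iff]
      simp [or_assoc]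
  rw [hfold] at p₂
  refine (p₁.seq p₂).congr rfl ?_ ?_
  · rw [← hli]
    rfl
  · rw [encLits_literals]
    change 2 + m.cls.length * 5 + (1 + (encClauses cl).length * _) ≤ _
    rw [hcl, ← hL, solveTime]
    nlinarith

/-! ### Reading the constraint -/

/-- Add the word on the stack `fst` to the list on the stack `cls`. -/
def emit : RProg := .seq (.push .cls fun _ => .delim) (copyRev .fst .cls .tmp)

theorem runs_emit (c : Ctl) {m : Mem} (ht : m.tmp = []) :
    Runs emit c m (c.on .delim) (m.set .cls (m.fst.reverse ++ .delim :: m.cls))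
      (3 + m.fst.length * 5) := by
  refine ((Runs.push .cls (fun _ => .delim) c m).seq (runs_copyRev (k := .fst) (k' := .cls)
    (t := .tmp) (by decide) (by decide) (by decide) c (m := m.set .cls (.delim :: m.get .cls))
    ht)).congr rfl rfl ?_
  change 1 + (2 + m.fst.length * 5) ≤ _
  lia

/-- Finish reading a literal: add it to the clauses, twice if it stands for itself. -/
def finish : RProg :=
  .seq (.push .fst fun c => .bit c.sign) <| .seq emit <|
  .seq (.ite (fun c => c.todo = 0) emit skip) <| .seq (clear .fst)
    (.set fun c => { c with sign := true, reading := false, todo := if c.todo = 2 then 1 else 0 })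

/-- The effect of a symbol outside of literals. -/
def Ctl.token (c : Ctl) : Ctl :=
  match c.sym with
  | .fls => { c with bad := true }
  | .neg => { c with sign := false }
  | .var => { c with reading := true }
  | .or => { c with todo := 2 }
  | .bit _ => { c with past := true }
  | .star => { c with past := true }
  | .delim => { c with past := true }
  | _ => c

/-- Process a symbol of the input. -/
def parse : RProg :=
  .ite Ctl.past (.push .save Ctl.sym) <|
  .ite Ctl.reading (.ite (fun c => c.sym = .delim) finish (.push .fst Ctl.sym)) <|
  .seq (.set Ctl.token) (.ite Ctl.past (.push .save Ctl.sym) skip)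

/-- The name of a variable. -/
def varName (x : ℕ) : List Bool := (Computability.encodeNat x).reverse

/-- The literal denoted by a formula. -/
def PropFormula.toLit : PropFormula → Lit
  | var x => (true, varName x)
  | neg (var x) => (false, varName x)
  | _ => (true, [])

/-- The clauses of a Krom formula, apart from empty ones. Single literals are doubled. The order is
the one in which a stack holds the clauses when they have been read from left to right. -/
def PropFormula.clauses : PropFormula → List (Lit × Lit)
  | tru => []
  | fls => []
  | and φ ψ => clauses ψ ++ clauses φ
  | or φ ψ => [(ψ.toLit, φ.toLit)]
  | φ => [(φ.toLit, φ.toLit)]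

/-- Whether a Krom formula has an empty clause. -/
def PropFormula.hasFalsum : PropFormula → Bool
  | fls => true
  | and φ ψ => hasFalsum φ || hasFalsum ψ
  | _ => false

theorem runs_finish (c : Ctl) {m : Mem} (x : List Bool) (h : m.fst = x.map .bit) (ht : m.tmp = []) :
    Runs finish c m
      { c.on .delim with sign := true, reading := false, todo := if c.todo = 2 then 1 else 0 }
      ((m.set .cls (if c.todo = 0 then Lit.word (c.sign, x) ++ (Lit.word (c.sign, x) ++ m.cls)
        else Lit.word (c.sign, x) ++ m.cls)).set .fst []) (22 + x.length * 12) := by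
  have hfst : Symb.bit c.sign :: m.get .fst = Lit.symbs (c.sign, x) := by
    change Symb.bit c.sign :: m.fst = _
    rw [h]
    rfl
  have hlen : (Lit.symbs (c.sign, x)).length = x.length + 1 := by simp [Lit.symbs]
  have h₁ := Runs.push .fst (fun c => .bit c.sign) c m
  simp only [hfst] at h₁
  have hw : ∀ l, (Lit.symbs (c.sign, x)).reverse ++ Symb.delim :: l = Lit.word (c.sign, x) ++ l := by
    simp [Lit.word]
  have h₂ := runs_emit c (m := m.set .fst (Lit.symbs (c.sign, x))) ht
  have h₃ : Runs (.ite (fun c => c.todo = 0) emit skip) (c.on .delim)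
      ((m.set .fst (Lit.symbs (c.sign, x))).set .cls (Lit.word (c.sign, x) ++ m.cls)) (c.on .delim)
      ((m.set .fst (Lit.symbs (c.sign, x))).set .cls
        (if c.todo = 0 then Lit.word (c.sign, x) ++ (Lit.word (c.sign, x) ++ m.cls)
        else Lit.word (c.sign, x) ++ m.cls)) (4 + (x.length + 1) * 5) := by
    by_cases h0 : c.todo = 0
    · refine (Runs.ite_true _ (by simp [Ctl.on, h0]) (runs_emit (c.on .delim) (m := (m.set .fst
        (Lit.symbs (c.sign, x))).set .cls (Lit.word (c.sign, x) ++ m.cls)) ht)).congr rfl ?_ ?_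
      · rw [if_pos h0, Mem.set_set]
        change Mem.set _ _ ((Lit.symbs (c.sign, x)).reverse ++ Symb.delim :: _) = _
        rw [hw]
        rfl
      · change 1 + (3 + (Lit.symbs (c.sign, x)).length * 5) ≤ _
        lia
    · refine (Runs.ite_false _ (by simp [Ctl.on, h0]) (runs_skip _ _)).congr rfl ?_ (by lia)
      rw [if_neg h0]
  have h₄ := runs_clear .fst (c.on .delim) ((m.set .fst (Lit.symbs (c.sign, x))).set .cls
        (if c.todo = 0 then Lit.word (c.sign, x) ++ (Lit.word (c.sign, x) ++ m.cls)
        else Lit.word (c.sign, x) ++ m.cls))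
  have h₅ := Runs.set (fun c => { c with
      sign := true, reading := false, todo := if c.todo = 2 then 1 else 0 }) (c.on .delim)
    ((m.set .cls (if c.todo = 0 then Lit.word (c.sign, x) ++ (Lit.word (c.sign, x) ++ m.cls)
        else Lit.word (c.sign, x) ++ m.cls)).set .fst [])
  rw [show ((m.set .fst (Lit.symbs (c.sign, x))).set .cls
      ((Mem.fst (m.set .fst (Lit.symbs (c.sign, x)))).reverse ++
        .delim :: Mem.cls (m.set .fst (Lit.symbs (c.sign, x))))) =
      ((m.set .fst (Lit.symbs (c.sign, x))).set .cls (Lit.word (c.sign, x) ++ m.cls)) from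
    congrArg _ (hw _)] at h₂
  refine (h₁.seq (h₂.seq (h₃.seq (h₄.seq h₅)))).congr rfl rfl ?_
  change 1 + (3 + (Lit.symbs (c.sign, x)).length * 5 + (4 + (x.length + 1) * 5 +
    (1 + (Lit.symbs (c.sign, x)).length * 2 + 1))) ≤ _
  lia

theorem runs_parse_past (c : Ctl) (m : Mem) (h : c.past = true) :
    Runs parse c m c (m.set .save (c.sym :: m.save)) 2 :=
  Runs.ite_true _ h (Runs.push .save Ctl.sym c m)

theorem runs_parse_collect (c : Ctl) (m : Mem) (hp : c.past = false) (hr : c.reading = true)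
    (hs : c.sym ≠ .delim) : Runs parse c m c (m.set .fst (c.sym :: m.fst)) 4 :=
  Runs.ite_false _ hp (Runs.ite_true _ hr (Runs.ite_false _ (by simpa using hs)
    (Runs.push .fst Ctl.sym c m)))

theorem runs_parse_finish (c : Ctl) {m : Mem} (x : List Bool) (hp : c.past = false)
    (hr : c.reading = true) (hs : c.sym = .delim) (h : m.fst = x.map .bit) (ht : m.tmp = []) :
    Runs parse c m
      { c.on .delim with sign := true, reading := false, todo := if c.todo = 2 then 1 else 0 }
      ((m.set .cls (if c.todo = 0 then Lit.word (c.sign, x) ++ (Lit.word (c.sign, x) ++ m.cls)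
        else Lit.word (c.sign, x) ++ m.cls)).set .fst []) (25 + x.length * 12) :=
  (Runs.ite_false _ hp (Runs.ite_true _ hr (Runs.ite_true _ (by simpa using hs)
    (runs_finish c x h ht)))).mono (by lia)

theorem runs_parse_token (c : Ctl) (m : Mem) (hp : c.past = false) (hr : c.reading = false)
    (ht : c.token.past = false) : Runs parse c m c.token m 5 :=
  Runs.ite_false _ hp (Runs.ite_false _ hr ((Runs.set _ _ _).seq
    (Runs.ite_false _ ht (runs_skip _ _))))

theorem runs_parse_token_past (c : Ctl) (m : Mem) (hp : c.past = false) (hr : c.reading = false)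
    (ht : c.token.past = true) :
    Runs parse c m c.token (m.set .save (c.token.sym :: m.save)) 5 :=
  Runs.ite_false _ hp (Runs.ite_false _ hr ((Runs.set _ _ _).seq
    (Runs.ite_true _ ht (Runs.push .save Ctl.sym _ _))))

/-- Reading a variable. Here and in the two following lemmas on `each .inp parse`, the last hypothesis
describes the rest of the run of the loop. -/
theorem runs_parse_var (c : Ctl) (m : Mem) (x : ℕ) (w : List Symb) (hp : c.past = false)
    (hr : c.reading = false) (hf : m.fst = []) (ht : m.tmp = []) (s : Symb) {c' : Ctl} {m' : Mem}
    {t : ℕ}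
    (h : ∀ s, Runs (each .inp parse)
      (Ctl.on { c with sign := true, todo := if c.todo = 2 then 1 else 0 } s)
      ((m.set .cls (if c.todo = 0 then Lit.word (c.sign, varName x) ++
        (Lit.word (c.sign, varName x) ++ m.cls) else Lit.word (c.sign, varName x) ++ m.cls)).set
          .inp w) c' m' t) :
    Runs (each .inp parse) (c.on s) (m.set .inp ((PropFormula.var x).encode ++ w)) c' m'
      (20 * (PropFormula.var x).encode.length + t) := by
  set n := Computability.encodeNat x with hn
  have hlen : (PropFormula.var x).encode.length = n.length + 2 := by simp [PropFormula.encode, hn]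
  have h₂ := Runs.each_collect (k := .inp) (k' := .fst) (by decide) (p := parse) (t' := 4)
    (c := { c with reading := true }) (c' := c') (m' := m')
    (t := 1 + (25 + n.length * 12) + t) (fun a ha n => by
      exact runs_parse_collect _ n hp rfl ha)
    (n.map Symb.bit) (.delim :: w) .var m (by simp) (fun s => by
      have hfin := runs_parse_finish (Ctl.on { c with reading := true } .delim)
        (m := (m.set .inp w).set .fst ((n.map Symb.bit).reverse)) n.reverse hp rfl rfl
        (List.map_reverse.symm) ht
      refine Runs.each_cons (a := .delim) (l := w) (t₁ := 25 + n.length * 12) rfl ?_ (h .delim)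
      rw [show m.get .fst = [] from hf, List.append_nil]
      refine hfin.congr ?_ ?_ ?_
      · ext1 <;> first | rfl | exact hr.symm
      · ext1 <;> first | rfl | exact hf.symm
      · simp)
  have e : (PropFormula.var x).encode ++ w = .var :: (n.map Symb.bit ++ .delim :: w) := by
    simp [PropFormula.encode, hn]
  rw [e]
  refine Runs.mono (Runs.each_cons (a := .var) rfl (runs_parse_token (c.on .var) _ hp hr hp) h₂) ?_
  rw [hlen]
  simp
  lia

/-- Reading a literal: it is added to the clauses, twice if it stands for itself. -/
theorem runs_parse_literal {φ : PropFormula} (hφ : φ.IsLiteral) (c : Ctl) (m : Mem) (w : List Symb)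
    (hp : c.past = false) (hr : c.reading = false) (hs : c.sign = true) (hf : m.fst = [])
    (ht : m.tmp = []) (s : Symb) {c' : Ctl} {m' : Mem} {t : ℕ}
    (h : ∀ s, Runs (each .inp parse) (Ctl.on { c with todo := if c.todo = 2 then 1 else 0 } s)
      ((m.set .cls (if c.todo = 0 then φ.toLit.word ++ (φ.toLit.word ++ m.cls)
        else φ.toLit.word ++ m.cls)).set .inp w) c' m' t) :
    Runs (each .inp parse) (c.on s) (m.set .inp (φ.encode ++ w)) c' m'
      (20 * φ.encode.length + t) := by
  have hc : c = { c with sign := true } := by ext1 <;> first | rfl | exact hs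
  match φ with
  | .var x =>
    refine runs_parse_var c m x w hp hr hf ht s (fun s => ?_)
    rw [hs]
    exact (h s).congr_start (by rw [hc]) rfl
  | .neg (.var x) =>
    have := runs_parse_var { c with sign := false } m x w hp hr hf ht .neg
      (fun s => (h s).congr_start (by rw [hc]) rfl)
    refine Runs.mono (Runs.each_cons (a := .neg) rfl (runs_parse_token (c.on .neg) _ hp hr hp) this) ?_
    simp [PropFormula.encode]
    lia

/-- Reading a Krom formula. There are at most `20` steps for each symbol. -/
theorem runs_parse_formula (φ : PropFormula) : ∀ (_ : φ.IsKrom) (c : Ctl) (m : Mem)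
    (cl : List (Lit × Lit)) (w : List Symb) (_ : c.past = false) (_ : c.reading = false)
    (_ : c.sign = true) (_ : c.todo = 0) (_ : m.fst = []) (_ : m.tmp = []) (s : Symb) {c' : Ctl}
    {m' : Mem} {t : ℕ}
    (_ : ∀ s, Runs (each .inp parse) (Ctl.on { c with bad := c.bad || φ.hasFalsum } s)
      ((m.set .cls (encClauses (φ.clauses ++ cl))).set .inp w) c' m' t),
    Runs (each .inp parse) (c.on s) ((m.set .cls (encClauses cl)).set .inp (φ.encode ++ w)) c' m'
      (20 * φ.encode.length + t) := by
  have hlit : ∀ (φ : PropFormula) (_ : φ.IsLiteral) (c : Ctl) (m : Mem)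
      (cl : List (Lit × Lit)) (w : List Symb) (_ : c.past = false) (_ : c.reading = false)
      (_ : c.sign = true) (_ : c.todo = 0) (_ : m.fst = []) (_ : m.tmp = []) (s : Symb) {c' : Ctl}
      {m' : Mem} {t : ℕ} (_ : ∀ s, Runs (each .inp parse) (c.on s)
        ((m.set .cls (encClauses ((φ.toLit, φ.toLit) :: cl))).set .inp w) c' m' t),
      Runs (each .inp parse) (c.on s) ((m.set .cls (encClauses cl)).set .inp (φ.encode ++ w)) c' m'
        (20 * φ.encode.length + t) := by
    intro φ hφ c m cl w hp hr hs htd hf ht s c' m' t h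
    refine runs_parse_literal hφ c (m.set .cls (encClauses cl)) w hp hr hs hf ht s (fun s => ?_)
    refine (h s).congr_start ?_ ?_
    · ext1 <;> first | rfl | simp [Ctl.on, htd]
    · simp [htd]
      rfl
  induction φ with
  | tru =>
    intro _ c m cl w hp hr hs htd hf ht s c' m' t h
    refine Runs.mono (Runs.each_cons (a := .tru) rfl (runs_parse_token (c.on .tru) _ hp hr hp)
      ((h .tru).congr_start ?_ rfl)) ?_
    · simp [PropFormula.hasFalsum]
      rfl
    · simp [PropFormula.encode]
  | fls =>
    intro _ c m cl w hp hr hs htd hf ht s c' m' t h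
    refine Runs.mono (Runs.each_cons (a := .fls) rfl (runs_parse_token (c.on .fls) _ hp hr hp)
      ((h .fls).congr_start ?_ rfl)) ?_
    · simp [PropFormula.hasFalsum]
      rfl
    · simp [PropFormula.encode]
  | var x =>
    intro hK c m cl w hp hr hs htd hf ht s c' m' t h
    exact hlit (.var x) hK c m cl w hp hr hs htd hf ht s fun s =>
      (h s).congr_start (by simp [PropFormula.hasFalsum]) rfl
  | neg φ ih =>
    intro hK c m cl w hp hr hs htd hf ht s c' m' t h
    exact hlit (.neg φ) hK c m cl w hp hr hs htd hf ht s fun s =>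
      (h s).congr_start (by simp [PropFormula.hasFalsum]) rfl
  | imp φ ψ =>
    intro hK
    exact absurd hK (by simp [PropFormula.IsKrom, PropFormula.IsTwoClause, PropFormula.IsLiteral])
  | and φ ψ ih₁ ih₂ =>
    intro hK c m cl w hp hr hs htd hf ht s c' m' t h
    have h₂ := ih₁ hK.1 c m cl (ψ.encode ++ w) hp hr hs htd hf ht .and (fun s =>
      ih₂ hK.2 { c with bad := c.bad || φ.hasFalsum } m (φ.clauses ++ cl) w hp hr hs htd hf ht s
        (fun s => (h s).congr_start (by simp [PropFormula.hasFalsum, Bool.or_assoc])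
          (by simp [PropFormula.clauses])))
    refine Runs.mono (Runs.each_cons (a := .and) rfl (runs_parse_token (c.on .and) _ hp hr hp)
      (h₂.congr_start rfl ?_)) ?_
    · simp
    · simp [PropFormula.encode]
      lia
  | or φ ψ =>
    intro hK c m cl w hp hr hs htd hf ht s c' m' t h
    have h₂ := runs_parse_literal (φ := φ) hK.1 { c with todo := 2 } (m.set .cls (encClauses cl))
      (ψ.encode ++ w) hp hr hs hf ht .or (fun s =>
        runs_parse_literal (φ := ψ) hK.2 { c with todo := 1 } (m.set .cls (φ.toLit.word ++
          encClauses cl)) w hp hr hs hf ht s (fun s => (h s).congr_start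
            (by ext1 <;> first | rfl | exact htd | simp [PropFormula.hasFalsum, Ctl.on])
            (by
              simp [PropFormula.clauses]
              rfl)))
    refine Runs.mono (Runs.each_cons (a := .or) rfl (runs_parse_token (c.on .or) _ hp hr hp)
      (h₂.congr_start rfl ?_)) ?_
    · simp
    · simp [PropFormula.encode]
      lia

theorem runs_parse_rest (c : Ctl) (m : Mem) (l : List Symb) (hp : c.past = true) (s : Symb) :
    Runs (each .inp parse) (c.on s) (m.set .inp l) (c.on .delim)
      ((m.set .save (l.reverse ++ m.save)).set .inp []) (1 + l.length * 3) := by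
  have := Runs.each_foldl (k := .inp) (p := parse) (fun _ => c) (fun x => m.set .save x)
    (fun x a => a :: x) (fun _ _ => True) 2
    (fun x a l _ => ⟨trivial, a, runs_parse_past (c.on a) _ hp⟩) l m.save s trivial
  rw [List.foldl_flip_cons_eq_append'] at this
  exact this

/-- Reading the whole input: the clauses of the constraint are collected, and the remaining input
is moved to the stack `save`. -/
theorem runs_parse (φ : PropFormula) (hφ : φ.IsKrom) (c : Ctl) (m : Mem) (a : Symb) (w : List Symb)
    (ha : ({ c with sym := a }).token = { c with sym := a, past := true })
    (hp : c.past = false) (hr : c.reading = false)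
    (hs : c.sign = true) (htd : c.todo = 0) (hf : m.fst = []) (ht : m.tmp = []) (hc : m.cls = [])
    (hsv : m.save = []) :
    Runs (each .inp parse) c (m.set .inp (φ.encode ++ a :: w))
      { c.on .delim with bad := c.bad || φ.hasFalsum, past := true }
      (((m.set .cls (encClauses φ.clauses)).set .save (a :: w).reverse).set .inp [])
      (20 * φ.encode.length + (7 + w.length * 3)) := by
  refine (runs_parse_formula φ hφ c m [] (a :: w) hp hr hs htd hf ht c.sym fun s => ?_).congr_start
    rfl ?_
  · have ha' : (Ctl.on { c with bad := c.bad || φ.hasFalsum } a).token =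
        Ctl.on { c with bad := c.bad || φ.hasFalsum, past := true } a := by
      cases a <;> first | rfl | (simp [Ctl.token, Ctl.ext_iff, hp] at ha)
    have h₁ := runs_parse_token_past (Ctl.on { c with bad := c.bad || φ.hasFalsum } a)
      ((m.set .cls (encClauses φ.clauses)).set .inp w) hp hr (by rw [ha']; rfl)
    rw [ha'] at h₁
    refine Runs.mono (Runs.each_cons (a := a) (l := w) rfl (h₁.congr_start rfl ?_)
      ((runs_parse_rest { c with bad := c.bad || φ.hasFalsum, past := true }
        ((m.set .cls (encClauses φ.clauses)).set .save [a]) w rfl a).congr_start rfl ?_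
        |>.congr rfl ?_ le_rfl)) ?_
    · simp
    · ext1 <;> first | rfl | exact congrArg (a :: ·) hsv.symm
    · ext1 <;> first | rfl | simp [Mem.set]
    · lia
  · ext1 <;> first | rfl | exact hc.symm

/-! ### Binary counting -/

/-- The successor of a binary number with the least significant digit first. -/
def binSucc : List Bool → List Bool
  | [] => [true]
  | false :: l => true :: l
  | true :: l => false :: binSucc l

theorem encodePosNum_succ (n : PosNum) :
    Computability.encodePosNum n.succ = binSucc (Computability.encodePosNum n) := by
  induction n with
  | one => rfl
  | bit1 n ih => simp [PosNum.succ, Computability.encodePosNum, binSucc, ih]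
  | bit0 n _ => rfl

theorem encodeNat_succ (n : ℕ) :
    Computability.encodeNat (n + 1) = binSucc (Computability.encodeNat n) := by
  simp only [Computability.encodeNat, Nat.cast_succ, Num.add_one]
  cases (n : Num) with
  | zero => rfl
  | pos p => exact encodePosNum_succ p

theorem length_binSucc_le (l : List Bool) : (binSucc l).length ≤ l.length + 1 := by
  induction l with
  | nil => simp [binSucc]
  | cons b l ih => cases b <;> simp [binSucc]; lia

/-- Increment the binary number on the stack `ctr`. -/
def increment : RProg :=
  .seq (.set fun c => { c with carry := true }) <|
  .seq (each .ctr (.ite Ctl.carry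
    (.ite (fun c => c.sym = .bit true) (.push .tmp fun _ => .bit false)
      (.seq (.push .tmp fun _ => .bit true) (.set fun c => { c with carry := false })))
    (.push .tmp Ctl.sym))) <|
  .seq (.ite Ctl.carry (.seq (.push .tmp fun _ => .bit true)
    (.set fun c => { c with carry := false })) skip) (move .tmp .ctr)

theorem foldl_binSucc (l : List Bool) : ∀ (x : List Symb) (b : Bool),
    let r := (l.map Symb.bit).foldl (fun (x : List Symb × Bool) a =>
      if x.2 then (if a = .bit true then (.bit false :: x.1, true) else (.bit true :: x.1, false))
      else (a :: x.1, false)) (x, b)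
    (if r.2 then .bit true :: r.1 else r.1).reverse =
      x.reverse ++ (if b then binSucc l else l).map Symb.bit ∧ r.1.length = x.length + l.length := by
  induction l with
  | nil => intro x b; cases b <;> simp [binSucc]
  | cons a l ih =>
    intro x b
    have h₁ := ih (.bit a :: x) false
    have h₂ := ih (.bit false :: x) true
    have h₃ := ih (.bit true :: x) false
    cases a <;> cases b <;> simp_all [binSucc] <;> lia

theorem runs_increment (c : Ctl) {m : Mem} (l : List Bool) (hc : c.carry = false)
    (hl : m.ctr = l.map .bit) (ht : m.tmp = []) :
    Runs increment c m (c.on .delim) (m.set .ctr ((binSucc l).map .bit)) (9 + l.length * 8) := by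
  obtain ⟨hr, hlen⟩ := foldl_binSucc l [] true
  set r := (l.map Symb.bit).foldl (fun (x : List Symb × Bool) a =>
      if x.2 then (if a = .bit true then (.bit false :: x.1, true) else (.bit true :: x.1, false))
      else (a :: x.1, false)) ([], true) with hrdef
  have h₁ := Runs.set (fun c => { c with carry := true }) c m
  have h₂ := Runs.each_foldl (k := .ctr) (p := .ite Ctl.carry
    (.ite (fun c => c.sym = .bit true) (.push .tmp fun _ => .bit false)
      (.seq (.push .tmp fun _ => .bit true) (.set fun c => { c with carry := false })))
    (.push .tmp Ctl.sym)) (fun x : List Symb × Bool => { c with carry := x.2 })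
    (fun x => m.set .tmp x.1) (fun (x : List Symb × Bool) a =>
      if x.2 then (if a = .bit true then (.bit false :: x.1, true) else (.bit true :: x.1, false))
      else (a :: x.1, false)) (fun _ _ => True) 4 (fun x a l _ => ⟨trivial, a, by
        obtain ⟨x, b⟩ := x
        cases b
        · exact (Runs.ite_false _ rfl (Runs.push _ _ _ _)).mono (by lia)
        · by_cases ha : a = .bit true
          · subst ha
            exact (Runs.ite_true _ rfl (Runs.ite_true _ rfl (Runs.push _ _ _ _))).mono (by lia)
          · simp only [if_pos, if_neg ha]
            exact (Runs.ite_true _ rfl (Runs.ite_false _ (by simp [ha])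
              ((Runs.push _ _ _ _).seq (Runs.set _ _ _)))).mono (by lia)⟩)
    (l.map .bit) ([], true) c.sym trivial
  rw [← hrdef] at h₂
  have h₃ : Runs (.ite Ctl.carry (.seq (.push .tmp fun _ => .bit true)
      (.set fun c => { c with carry := false })) skip) (Ctl.on { c with carry := r.2 } .delim)
      ((m.set .tmp r.1).set .ctr []) (c.on .delim)
      ((m.set .tmp (if r.2 then .bit true :: r.1 else r.1)).set .ctr []) 3 := by
    cases hb : r.2
    · refine (Runs.ite_false _ rfl (runs_skip _ _)).congr ?_ ?_ (by lia)
      · ext1 <;> first | rfl | exact hc.symm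
      · simp
    · refine (Runs.ite_true _ rfl ((Runs.push _ _ _ _).seq (Runs.set _ _ _))).congr ?_ ?_ le_rfl
      · ext1 <;> first | rfl | exact hc.symm
      · rfl
  have h₄ := runs_move (k := .tmp) (k' := .ctr) (by decide) (c.on .delim)
    ((m.set .tmp (if r.2 then .bit true :: r.1 else r.1)).set .ctr [])
  have e : ((m.set .tmp []).set .ctr (l.map .bit)) = m := by
    ext1 <;> first | rfl | exact ht.symm | exact hl.symm
  rw [e] at h₂
  refine (h₁.seq (h₂.seq (h₃.seq h₄))).congr rfl ?_ ?_
  · change (m.set .ctr ((if r.2 then Symb.bit true :: r.1 else r.1).reverse ++ [])).set .tmp [] = _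
    rw [hr]
    ext1 <;> first | rfl | exact ht.symm | simp [Mem.set]
  · change 1 + (1 + (l.map Symb.bit).length * (4 + 1) + (3 + (1 +
      (if r.2 then Symb.bit true :: r.1 else r.1).length * 2))) ≤ _
    have : (if r.2 then Symb.bit true :: r.1 else r.1).length ≤ l.length + 1 := by
      split_ifs <;> simp [hlen]
    simp only [List.length_map]
    lia

/-! ### Reading the ballots -/

/-- The unit clause consisting of the literal with sign `a` and the variable with binary index `n`,
as two words. -/
def unitWords (n : List Symb) (a : Symb) : List Symb :=
  n ++ a :: .delim :: (n ++ [a, .delim])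

/-- The unit clause for a sign that may be missing. -/
def unitOf (n : List Symb) (o : Option Symb) : List Symb := o.elim [] (unitWords n)

/-- Add the unit clause with the sign in the control state, and the variable with the index on the
stack `ctr`. -/
def emitUnit : RProg :=
  .seq (copyRev .ctr .fst .tmp) <| .seq (.push .fst fun c => c.aux.getD .delim) <|
  .seq emit <| .seq emit <| .seq (clear .fst) (.set fun c => { c with aux := none })

theorem runs_emitUnit (c : Ctl) {m : Mem} (a : Symb) (hf : m.fst = []) (ht : m.tmp = []) :
    Runs emitUnit { c with aux := some a } m { c.on .delim with aux := none }
      (m.set .cls (unitWords m.ctr a ++ m.cls)) (23 + 17 * m.ctr.length) := by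
  have h₁ := runs_copyRev (k := .ctr) (k' := .fst) (t := .tmp) (by decide) (by decide) (by decide)
    { c with aux := some a } (m := m) ht
  have e₁ : m.set .fst ((m.get .ctr).reverse ++ m.get .fst) = m.set .fst m.ctr.reverse := by
    change m.set .fst (m.ctr.reverse ++ m.fst) = _
    rw [hf, List.append_nil]
  rw [e₁] at h₁
  have h₂ := Runs.push .fst (fun c => c.aux.getD .delim) ({ c.on .delim with aux := some a })
    (m.set .fst m.ctr.reverse)
  have h₃ := runs_emit ({ c.on .delim with aux := some a }) (m := m.set .fst (a :: m.ctr.reverse)) ht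
  have h₄ := runs_emit ({ c.on .delim with aux := some a })
    (m := (m.set .fst (a :: m.ctr.reverse)).set .cls
      ((a :: m.ctr.reverse).reverse ++ .delim :: m.cls)) ht
  have h₅ := runs_clear .fst ({ c.on .delim with aux := some a })
    ((m.set .cls ((a :: m.ctr.reverse).reverse ++ .delim ::
      ((a :: m.ctr.reverse).reverse ++ .delim :: m.cls))).set .fst (a :: m.ctr.reverse))
  have h₆ := Runs.set (fun c => { c with aux := none }) ({ c.on .delim with aux := some a })
    ((m.set .cls ((a :: m.ctr.reverse).reverse ++ .delim ::
      ((a :: m.ctr.reverse).reverse ++ .delim :: m.cls))).set .fst [])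
  refine (h₁.seq (h₂.seq (h₃.seq (h₄.seq (h₅.seq h₆))))).congr rfl ?_ ?_
  · ext1 <;> first | rfl | exact hf.symm | simp [Mem.set, unitWords]
  · change 2 + m.ctr.length * 5 + (1 + (3 + (a :: m.ctr.reverse).length * 5 +
      (3 + (a :: m.ctr.reverse).length * 5 + (1 + (a :: m.ctr.reverse).length * 2 + 1)))) ≤ _
    simp only [List.length_cons, List.length_reverse]
    lia

/-- Whether a symbol is a truth value. -/
def Symb.isBit : Symb → Bool
  | .bit _ => true
  | _ => false

/-- Add a vote to a stack that holds the surplus of one of the truth values over the other. -/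
def balStep : List Symb → Symb → List Symb
  | [], a => [a]
  | b :: l, a => if b = a then a :: a :: l else l

/-- Process a symbol of the rows. The first symbol of a row is removed: in the first row, which is
the partial ballot, a truth value yields a unit clause, and in the other rows the symbol is counted
as a vote. All other symbols are kept on the stack `save`. -/
def columnStep : RProg :=
  .ite (fun c => c.sym = .delim)
    (.seq (.push .save Ctl.sym) (.set fun c => { c with start := true, top := false })) <|
  .ite Ctl.start
    (.seq (.ite Ctl.top
      (.ite (fun c => c.sym.isBit) (.seq (.set fun c => { c with aux := some c.sym }) emitUnit) skip)
      (.seq (.pop .bal fun c o => { c with aux := o }) <|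
        .seq (.ite (fun c => c.aux = none) (.push .bal Ctl.sym)
          (.ite (fun c => c.aux = some c.sym)
            (.seq (.push .bal Ctl.sym) (.push .bal Ctl.sym)) skip))
          (.set fun c => { c with aux := none })))
      (.set fun c => { c with start := false }))
    (.push .save Ctl.sym)

/-- The variable part of the state while a column is being removed. -/
structure Col where
  save : List Symb
  cls : List Symb
  bal : List Symb
  start : Bool
  top : Bool

/-- The effect of `columnStep`. -/
def Col.step (n : List Symb) (x : Col) (a : Symb) : Col :=
  if a = .delim then { x with save := a :: x.save, start := true, top := false }
  else if x.start then
    if x.top then { x with cls := unitOf n ((some a).filter Symb.isBit) ++ x.cls, start := false }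
    else { x with bal := balStep x.bal a, start := false }
  else { x with save := a :: x.save }

/-- The control state while a column is being removed. -/
def Col.ctl (c : Ctl) (x : Col) : Ctl := { c with start := x.start, top := x.top }

/-- The memory while a column is being removed. -/
def Col.mem (m : Mem) (x : Col) : Mem := { m with save := x.save, cls := x.cls, bal := x.bal }

theorem runs_columnStep (c : Ctl) (m : Mem) (hc : c.aux = none) (hf : m.fst = []) (ht : m.tmp = [])
    (x : Col) (a : Symb) (l : List Symb) :
    ∃ s, Runs columnStep ((Col.ctl c x).on a) ((Col.mem m x).set .inp l)
      ((Col.ctl c (x.step m.ctr a)).on s) ((Col.mem m (x.step m.ctr a)).set .inp l)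
      (30 + 17 * m.ctr.length) := by
  by_cases ha : a = .delim
  · subst ha
    refine ⟨.delim, ((Runs.ite_true _ rfl ((Runs.push _ _ _ _).seq (Runs.set _ _ _))).congr
      (t := 3) ?_ ?_ (by lia))⟩
    · simp [Col.step, Col.ctl]
      rfl
    · simp [Col.step, Col.ctl]
      rfl
  · obtain ⟨sv, cl, bl, st, tp⟩ := x
    cases st
    · refine ⟨a, ((Runs.ite_false _ (by simp [ha]) (Runs.ite_false _ rfl
        (Runs.push _ _ _ _))).congr (t := 3) ?_ ?_ (by lia))⟩
      · simp [Col.step, Col.ctl, ha]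
      · simp [Col.step, ha]
        rfl
    · cases tp
      · have h₁ : Runs (.seq (.pop .bal fun c o => { c with aux := o }) <|
            .seq (.ite (fun c => c.aux = none) (.push .bal Ctl.sym)
            (.ite (fun c => c.aux = some c.sym)
            (.seq (.push .bal Ctl.sym) (.push .bal Ctl.sym)) skip))
            (.set fun c => { c with aux := none })) ((Col.ctl c ⟨sv, cl, bl, true, false⟩).on a)
            ((Col.mem m ⟨sv, cl, bl, true, false⟩).set .inp l)
            ((Col.ctl c ⟨sv, cl, bl, true, false⟩).on a)
            ((Col.mem m ⟨sv, cl, balStep bl a, true, false⟩).set .inp l) (1 + (4 + 1)) := by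
          have p₁ := Runs.pop .bal (fun c o => { c with aux := o })
            ((Col.ctl c ⟨sv, cl, bl, true, false⟩).on a)
            ((Col.mem m ⟨sv, cl, bl, true, false⟩).set .inp l)
          have hc' : ∀ o, (Ctl.mk a c.ok c.found c.prev c.second c.bad c.sign c.reading c.todo c.past
              true false c.carry o) = { (Col.ctl c ⟨sv, cl, bl, true, false⟩).on a with aux := o } :=
            fun o => rfl
          have p₃ : ∀ o (m : Mem), Runs (.set fun c => { c with aux := none })
              ({ (Col.ctl c ⟨sv, cl, bl, true, false⟩).on a with aux := o }) m
              ((Col.ctl c ⟨sv, cl, bl, true, false⟩).on a) m 1 := fun o m =>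
            (Runs.set _ _ _).congr (by ext1 <;> first | rfl | exact hc.symm) rfl le_rfl
          refine p₁.seq (Runs.seq ?_ (p₃ bl.head? _))
          cases bl with
          | nil => exact (Runs.ite_true _ rfl (Runs.push _ _ _ _)).mono (by lia)
          | cons b bl =>
            by_cases hb : b = a
            · subst hb
              refine (Runs.ite_false _ rfl (Runs.ite_true _ (by exact decide_eq_true rfl)
                ((Runs.push _ _ _ _).seq (Runs.push _ _ _ _)))).congr rfl ?_ le_rfl
              simp [balStep]
              rfl
            · refine (Runs.ite_false _ rfl (Runs.ite_false _
                (by exact decide_eq_false (fun h => hb (Option.some.inj h))) (runs_skip _ _))).congr rfl ?_ (by lia)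
              simp [balStep, hb]
              rfl
        refine ⟨a, (Runs.ite_false _ (by simp [ha]) (Runs.ite_true _ rfl
          ((Runs.ite_false _ rfl h₁).seq (Runs.set _ _ _)))).congr ?_ ?_ (by lia)⟩
        · simp [Col.step, Col.ctl, ha]
          rfl
        · simp [Col.step, ha]
          rfl
      · cases hb : a.isBit
        · refine ⟨a, (Runs.ite_false _ (by simp [ha]) (Runs.ite_true _ rfl
            ((Runs.ite_true _ rfl (Runs.ite_false _ hb (runs_skip _ _))).seq
              (Runs.set _ _ _)))).congr ?_ ?_ (by lia)⟩
          · simp [Col.step, Col.ctl, ha]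
            rfl
          · simp [Col.step, ha, hb, unitOf, Option.filter]
            rfl
        · have h₁ := runs_emitUnit ((Col.ctl c ⟨sv, cl, bl, true, true⟩).on a)
            (m := (Col.mem m ⟨sv, cl, bl, true, true⟩).set .inp l) a hf ht
          refine ⟨.delim, (Runs.ite_false _ (by simp [ha]) (Runs.ite_true _ rfl
            ((Runs.ite_true _ rfl (Runs.ite_true _ hb ((Runs.set _ _ _).seq h₁))).seq
              (Runs.set _ _ _)))).congr ?_ ?_ ?_⟩
          · simp [Col.step, Col.ctl, ha]
            ext1 <;> first | rfl | exact hc.symm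
          · simp [Col.step, ha, hb, unitOf, Option.filter]
            rfl
          · change 1 + (1 + (1 + (1 + (1 + (23 + 17 * m.ctr.length))) + 1)) ≤ _
            lia

/-- Rows of symbols, each closed by an end marker. -/
def encRows (rows : List (List Symb)) : List Symb := rows.flatMap fun r => r ++ [.delim]

@[simp] theorem encRows_cons (r : List Symb) (rows : List (List Symb)) :
    encRows (r :: rows) = r ++ .delim :: encRows rows := by simp [encRows]

@[simp] theorem encRows_nil : encRows [] = [] := rfl

/-- The effect of `columnStep` on a row with its end marker, starting at the first symbol. -/
theorem Col.foldl_step_row (n r : List Symb) (hr : Symb.delim ∉ r) (sv cl bl : List Symb) (tp : Bool) :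
    (r ++ [Symb.delim]).foldl (Col.step n) ⟨sv, cl, bl, true, tp⟩ =
      ⟨.delim :: (r.tail.reverse ++ sv),
        if tp then unitOf n (r.head?.filter Symb.isBit) ++ cl else cl,
        if tp then bl else r.head?.elim bl (balStep bl), true, false⟩ := by
  have key : ∀ (r : List Symb) (_ : Symb.delim ∉ r) (sv cl bl : List Symb) (tp : Bool),
      (r ++ [Symb.delim]).foldl (Col.step n) ⟨sv, cl, bl, false, tp⟩ =
        ⟨.delim :: (r.reverse ++ sv), cl, bl, true, false⟩ := by
    intro r
    induction r with
    | nil => intro _ sv cl bl tp; simp [Col.step]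
    | cons a r ih =>
      intro hr sv cl bl tp
      simp only [List.mem_cons, not_or] at hr
      simp only [List.cons_append, List.foldl_cons]
      rw [show Col.step n ⟨sv, cl, bl, false, tp⟩ a = ⟨a :: sv, cl, bl, false, tp⟩ by
        simp [Col.step, Ne.symm hr.1], ih hr.2]
      simp
  cases r with
  | nil => cases tp <;> simp [Col.step, unitOf]
  | cons a r =>
    simp only [List.mem_cons, not_or] at hr
    simp only [List.cons_append, List.foldl_cons]
    cases tp
    · rw [show Col.step n ⟨sv, cl, bl, true, false⟩ a = ⟨sv, cl, balStep bl a, false, false⟩ by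
        simp [Col.step, Ne.symm hr.1], key r hr.2]
      simp
    · rw [show Col.step n ⟨sv, cl, bl, true, true⟩ a =
        ⟨sv, unitOf n ((some a).filter Symb.isBit) ++ cl, bl, false, true⟩ by
        simp [Col.step, Ne.symm hr.1], key r hr.2]
      simp

theorem Col.foldl_step_rows (n : List Symb) (rows : List (List Symb))
    (hr : ∀ r ∈ rows, Symb.delim ∉ r) : ∀ (sv cl bl : List Symb),
    (encRows rows).foldl (Col.step n) ⟨sv, cl, bl, true, false⟩ =
      ⟨(encRows (rows.map List.tail)).reverse ++ sv, cl, (rows.filterMap List.head?).foldl balStep bl,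
        true, false⟩ := by
  induction rows with
  | nil => simp
  | cons r rows ih =>
    intro sv cl bl
    have h₁ := Col.foldl_step_row n r (hr r List.mem_cons_self) sv cl bl false
    have e : encRows (r :: rows) = (r ++ [.delim]) ++ encRows rows := by simp
    rw [e, List.foldl_append, h₁, ih fun r h => hr r (List.mem_cons_of_mem _ h)]
    cases r <;> simp [List.filterMap_cons]

theorem length_encRows_tail_le (rows : List (List Symb)) :
    (encRows (rows.map List.tail)).length ≤ (encRows rows).length := by
  induction rows with
  | nil => simp
  | cons r rows ih =>
    simp
    lia

/-- The surplus of votes in the first column. -/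
def balance (rows : List (List Symb)) : List Symb := (rows.filterMap List.head?).foldl balStep []

theorem length_balance_le (rows : List (List Symb)) : (balance rows).length ≤ (encRows rows).length := by
  have h₁ : ∀ (l : List Symb) (bl : List Symb), (l.foldl balStep bl).length ≤ bl.length + l.length := by
    intro l
    induction l with
    | nil => simp
    | cons a l ih =>
      intro bl
      refine (ih _).trans ?_
      cases bl with
      | nil => simp [balStep]; lia
      | cons b bl =>
        simp only [balStep]
        split_ifs <;> simp <;> lia
  refine (h₁ _ _).trans ?_
  induction rows with
  | nil => simp
  | cons r rows ih =>
    rw [List.filterMap_cons]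
    cases r <;> simp <;> lia

/-- The unit clauses for the first column: those of the partial ballot `s` and of the majority
outcome. -/
def columnUnits (n : List Symb) (s : List Symb) (rows : List (List Symb)) : List Symb :=
  unitOf n (balance rows).head? ++ unitOf n (s.head?.filter Symb.isBit)

/-- Remove the first column of the rows on the stack `inp`, and add the unit clauses that it
determines. -/
def round : RProg :=
  .seq (.set fun c => { c with start := true, top := true }) <|
  .seq (each .inp columnStep) <| .seq (.set fun c => { c with start := false, top := false }) <|
  .seq (move .save .inp) <| .seq (.pop .bal fun c o => { c with aux := o }) <|
  .seq (.ite (fun c => c.aux = none) skip emitUnit) <| .seq (clear .bal) increment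

theorem runs_round (c : Ctl) {m : Mem} (n : List Bool) (s : List Symb) (rows : List (List Symb))
    (hs : Symb.delim ∉ s) (hrows : ∀ r ∈ rows, Symb.delim ∉ r) (ha : c.aux = none)
    (hst : c.start = false) (htp : c.top = false) (hcy : c.carry = false)
    (hi : m.inp = encRows (s :: rows)) (hn : m.ctr = n.map .bit) (hsv : m.save = [])
    (hb : m.bal = []) (hf : m.fst = []) (ht : m.tmp = []) :
    Runs round c m (c.on .delim)
      (((m.set .inp (encRows (s.tail :: rows.map List.tail))).set .cls
        (columnUnits (n.map .bit) s rows ++ m.cls)).set .ctr ((binSucc n).map .bit))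
      ((encRows (s :: rows)).length * (35 + 17 * n.length) + 40 + 25 * n.length) := by
  have h₁ := Runs.set (fun c => { c with start := true, top := true }) c m
  have h₂ := Runs.each_foldl (k := .inp) (p := columnStep) (Col.ctl c) (Col.mem m)
    (Col.step m.ctr) (fun _ _ => True) (30 + 17 * m.ctr.length)
    (fun x a l _ => ⟨trivial, runs_columnStep c m ha hf ht x a l⟩) (encRows (s :: rows))
    ⟨[], m.cls, [], true, true⟩ c.sym trivial
  have e : (encRows (s :: rows)).foldl (Col.step m.ctr) ⟨[], m.cls, [], true, true⟩ =
      ⟨(encRows (s.tail :: rows.map List.tail)).reverse,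
        unitOf m.ctr (s.head?.filter Symb.isBit) ++ m.cls, balance rows, true, false⟩ := by
    have e' : encRows (s :: rows) = (s ++ [.delim]) ++ encRows rows := by simp
    rw [e', List.foldl_append, Col.foldl_step_row _ _ hs, Col.foldl_step_rows _ _ hrows]
    simp only [if_true, encRows_cons, List.reverse_append, List.reverse_cons, List.append_assoc,
      List.append_nil, List.singleton_append]
    rfl
  rw [e] at h₂
  obtain ⟨q, hq⟩ : ∃ q, q = encRows (s.tail :: rows.map List.tail) := ⟨_, rfl⟩
  obtain ⟨w, hw⟩ : ∃ w, w = unitOf m.ctr (s.head?.filter Symb.isBit) ++ m.cls := ⟨_, rfl⟩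
  obtain ⟨b, hb'⟩ : ∃ b, b = balance rows := ⟨_, rfl⟩
  have hbl : b.length ≤ (encRows (s :: rows)).length := by
    have := length_balance_le rows
    rw [hb', encRows_cons]
    simp
    lia
  have hql : q.length ≤ (encRows (s :: rows)).length := by
    rw [hq]
    exact length_encRows_tail_le (s :: rows)
  rw [← hq, ← hw, ← hb'] at h₂
  have h₃ := Runs.set (fun c => { c with start := false, top := false })
    ((Col.ctl c ⟨q.reverse, w, b, true, false⟩).on .delim)
    ((Col.mem m ⟨q.reverse, w, b, true, false⟩).set .inp [])
  have h₄ := runs_move (k := .save) (k' := .inp) (by decide) (c.on .delim)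
    ((Col.mem m ⟨q.reverse, w, b, true, false⟩).set .inp [])
  have h₅ := Runs.pop .bal (fun c o => { c with aux := o }) (c.on .delim)
    ((((m.set .bal b).set .cls w).set .inp q))
  have h₆ : Runs (.ite (fun c => c.aux = none) skip emitUnit) { c.on .delim with aux := b.head? }
      ((((m.set .bal b.tail).set .cls w).set .inp q)) (c.on .delim)
      ((((m.set .bal b.tail).set .cls (unitOf m.ctr b.head? ++ w)).set .inp q))
      (1 + (23 + 17 * m.ctr.length)) := by
    cases b with
    | nil =>
      refine (Runs.ite_true _ rfl (runs_skip _ _)).congr ?_ rfl (by lia)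
      ext1 <;> first | rfl | exact ha.symm
    | cons a b =>
      refine (Runs.ite_false (b := fun c => decide (c.aux = none))
        (c := { c.on .delim with aux := some a }) _ rfl
        (runs_emitUnit (c.on .delim)
        (m := ((m.set .bal b).set .cls w).set .inp q) a hf ht)).congr ?_ rfl le_rfl
      ext1 <;> first | rfl | exact ha.symm
  have h₇ := runs_clear .bal (c.on .delim)
    ((((m.set .bal b.tail).set .cls (unitOf m.ctr b.head? ++ w)).set .inp q))
  have h₈ := runs_increment (c.on .delim)
    (m := (((m.set .bal []).set .cls (unitOf m.ctr b.head? ++ w)).set .inp q)) n hcy hn ht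
  refine (h₁.seq ((h₂.congr_start ?_ ?_).seq ((h₃.congr ?_ rfl le_rfl).seq
    ((h₄.congr rfl (m' := _) ?_ le_rfl).seq (h₅.seq (h₆.seq (h₇.seq h₈))))))).congr rfl ?_ ?_
  · rfl
  · ext1 <;> first | rfl | exact hi.symm | exact hsv.symm | exact hb.symm
  · ext1 <;> first | rfl | exact hst.symm | exact htp.symm
  · ext1 <;> first | rfl | exact hsv.symm | simp [Col.mem, Mem.set, Mem.get]
  · rw [columnUnits, ← hn, List.append_assoc, ← hw, ← hb', hq]
    ext1 <;> first | rfl | exact hb.symm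
  · have hcl : m.ctr.length = n.length := by simp [hn]
    have e₁ : (Mem.get ((Col.mem m ⟨q.reverse, w, b, true, false⟩).set .inp []) .save).length =
      q.length := List.length_reverse
    have e₂ : (Mem.get ((((m.set .bal b.tail).set .cls (unitOf m.ctr b.head? ++ w)).set .inp q))
      .bal).length = b.length - 1 := List.length_tail
    rw [e₁, e₂, hcl]
    generalize (encRows (s :: rows)).length = r at *
    have : r * (30 + 17 * n.length + 1) + 4 * r = r * (35 + 17 * n.length) := by ring
    lia

/-- The state between rounds: the binary index of the first remaining column, what remains of the
partial ballot and of the ballots, and the clauses found so far. -/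
structure Table where
  ctr : List Bool
  top : List Symb
  rows : List (List Symb)
  cls : List Symb

namespace Table

/-- The effect of a round. -/
def next (x : Table) : Table :=
  ⟨binSucc x.ctr, x.top.tail, x.rows.map List.tail,
    columnUnits (x.ctr.map .bit) x.top x.rows ++ x.cls⟩

/-- The rows on the tape. -/
def word (x : Table) : List Symb := encRows (x.top :: x.rows)

/-- The memory between rounds. -/
def mem (m : Mem) (x : Table) : Mem :=
  { m with inp := x.word, ctr := x.ctr.map .bit, cls := x.cls }

theorem delim_notMem_next {x : Table} (h : ∀ r ∈ x.top :: x.rows, Symb.delim ∉ r) :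
    ∀ r ∈ x.next.top :: x.next.rows, Symb.delim ∉ r := by
  intro r hr
  have hr' : r ∈ (x.top :: x.rows).map List.tail := by simpa [next] using hr
  obtain ⟨r', h₁, rfl⟩ := List.mem_map.1 hr'
  exact fun hd => h r' h₁ (List.mem_of_mem_tail hd)

theorem length_unitOf_le (n : List Symb) (o : Option Symb) :
    (unitOf n o).length ≤ 2 * n.length + 4 := by
  cases o
  · simp [unitOf]
  · simp [unitOf, unitWords]
    lia

theorem iterate_next_bounds {x : Table} {L : ℕ} (h : ∀ r ∈ x.top :: x.rows, Symb.delim ∉ r)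
    (hL : x.word.length ≤ L) (hx : x.ctr = []) (k : ℕ) (hk : k ≤ L) :
    (∀ r ∈ (next^[k] x).top :: (next^[k] x).rows, Symb.delim ∉ r) ∧
      (next^[k] x).word.length ≤ L ∧ (next^[k] x).ctr.length ≤ k ∧
      (next^[k] x).cls.length ≤ x.cls.length + k * (4 * L + 8) := by
  induction k with
  | zero => exact ⟨h, hL, by simp [hx], by simp⟩
  | succ k ih =>
    obtain ⟨h₁, h₂, h₃, h₄⟩ := ih (by lia)
    rw [Function.iterate_succ_apply']
    set y := next^[k] x
    refine ⟨delim_notMem_next h₁, (length_encRows_tail_le (y.top :: y.rows)).trans h₂,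
      (length_binSucc_le _).trans (by lia), ?_⟩
    have h₅ := length_unitOf_le (y.ctr.map .bit) (balance y.rows).head?
    have h₆ := length_unitOf_le (y.ctr.map .bit) (y.top.head?.filter Symb.isBit)
    rw [List.length_map] at h₅ h₆
    simp only [next, columnUnits, List.length_append]
    have : (k + 1) * (4 * L + 8) = k * (4 * L + 8) + (4 * L + 8) := by ring
    lia

end Table

/-- All rounds, one for each symbol of `l`. -/
theorem runs_each_round (c : Ctl) (m : Mem) (x : Table) (ha : c.aux = none)
    (hst : c.start = false) (htp : c.top = false) (hcy : c.carry = false) (hsv : m.save = [])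
    (hb : m.bal = []) (hf : m.fst = []) (ht : m.tmp = []) (l : List Symb) (hl : x.word.length = l.length)
    (hd : ∀ r ∈ x.top :: x.rows, Symb.delim ∉ r) (hx : x.ctr = []) :
    Runs (each .cnt round) c ((Table.mem m x).set .cnt l) (c.on .delim)
      ((Table.mem m (Table.next^[l.length] x)).set .cnt [])
      (1 + l.length * (l.length * (35 + 17 * l.length) + 40 + 25 * l.length + 1)) := by
  have h := Runs.each_foldl (k := .cnt) (p := round) (fun _ => c)
    (fun k : ℕ => Table.mem m (Table.next^[k] x)) (fun k _ => k + 1)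
    (fun k l' => k + l'.length ≤ l.length)
    (l.length * (35 + 17 * l.length) + 40 + 25 * l.length) ?_ l 0 c.sym (by simp)
  · have e : l.foldl (fun k _ => k + 1) 0 = l.length := by
      simp
    rw [e] at h
    exact h
  · intro k a l' hk
    simp only [List.length_cons] at hk
    refine ⟨by lia, .delim, ?_⟩
    obtain ⟨h₁, h₂, h₃, -⟩ := Table.iterate_next_bounds hd hl.le hx k (by lia)
    rw [Function.iterate_succ_apply']
    set y := Table.next^[k] x
    refine (runs_round (c.on a) (m := (Table.mem m y).set .cnt l') y.ctr y.top y.rows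
      (h₁ _ List.mem_cons_self) (fun r hr => h₁ r (List.mem_cons_of_mem _ hr)) ha hst htp hcy rfl rfl
      hsv hb hf ht).congr rfl rfl ?_
    have h₄ := Nat.mul_le_mul h₂ (show 35 + 17 * y.ctr.length ≤ 35 + 17 * l.length by lia)
    rw [Table.word] at h₄
    lia

/-! ### The whole program -/

/-- Decide whether there is a truth assignment that satisfies the constraint and extends both the
partial ballot and the majority outcome of the profile. The rows are copied to the stack `cnt`, to
run as many rounds as they have symbols. These are more rounds than there are issues, but the
superfluous ones do not add clauses. -/
def decideOutcome : RProg :=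
  .seq (each .inp parse) <| .seq (move .save .inp) <| .seq (copy .inp .cnt .tmp) <|
  .seq (each .cnt round) <| .seq (clear .inp) <| .seq (clear .ctr) <| .seq solve (clear .cls)

/-- The initial control state. -/
def Ctl.init : Ctl :=
  ⟨.delim, false, false, false, false, false, true, false, 0, false, false, false, false, none⟩

/-- A bound for the number of symbols of the clauses, for an input of length `N`: at most `2 * N`
symbols for the constraint, and at most `4 * N + 8` symbols added in each of at most `N` rounds. -/
def clauseBound (N : ℕ) : ℕ := 4 * N * N + 10 * N

/-- A time bound for `decideOutcome`. -/
def decideTime (N : ℕ) : ℕ :=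
  N * (N * (35 + 17 * N) + 40 + 25 * N + 1) + solveTime (clauseBound N) + 2 * clauseBound N + 34 * N + 20

theorem exploreTime_mono {a b : ℕ} (h : a ≤ b) : exploreTime a ≤ exploreTime b := by
  unfold exploreTime
  gcongr

theorem solveTime_mono {a b : ℕ} (h : a ≤ b) : solveTime a ≤ solveTime b := by
  unfold solveTime
  have := exploreTime_mono (show a + a * a ≤ b + b * b by gcongr)
  gcongr

theorem length_word_toLit_le {φ : PropFormula} (h : φ.IsLiteral) :
    φ.toLit.word.length ≤ φ.encode.length := by
  match φ, h with
  | .var x, _ =>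
    simp [PropFormula.toLit, PropFormula.encode, Lit.word, Lit.symbs, varName]
  | .neg (.var x), _ =>
    simp [PropFormula.toLit, PropFormula.encode, Lit.word, Lit.symbs, varName]

theorem length_encClauses_le {φ : PropFormula} (h : φ.IsKrom) :
    (encClauses φ.clauses).length ≤ 2 * φ.encode.length := by
  induction φ with
  | tru => simp [PropFormula.clauses]
  | fls => simp [PropFormula.clauses]
  | var x =>
    have := length_word_toLit_le (φ := .var x) trivial
    simp [PropFormula.clauses]
    lia
  | neg ψ _ =>
    have := length_word_toLit_le (φ := .neg ψ) h
    simp [PropFormula.clauses]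
    lia
  | and φ ψ ih ih' =>
    have h₁ := ih h.1
    have h₂ := ih' h.2
    have e : encClauses (PropFormula.clauses ψ ++ PropFormula.clauses φ) =
      encClauses ψ.clauses ++ encClauses φ.clauses := List.flatMap_append
    simp only [PropFormula.clauses, PropFormula.encode, e, List.length_append, List.length_cons]
    lia
  | or φ ψ _ _ =>
    have h₁ := length_word_toLit_le h.1
    have h₂ := length_word_toLit_le h.2
    simp [PropFormula.clauses, PropFormula.encode]
    lia
  | imp φ ψ _ _ => exact h.elim

/-- The clauses `cl` are those of the constraint and the unit clauses collected in all rounds. -/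
theorem runs_decideOutcome (φ : PropFormula) (hφ : φ.IsKrom) (s : List Symb) (rows : List (List Symb))
    (hs : ∀ a ∈ s, a = .star ∨ ∃ b, a = .bit b) (hrows : ∀ r ∈ rows, Symb.delim ∉ r)
    (cl : List (Lit × Lit))
    (hcl : (Table.next^[(encRows (s :: rows)).length]
      ⟨[], s, rows, encClauses φ.clauses⟩).cls = encClauses cl) :
    Runs decideOutcome Ctl.init (Mem.init (φ.encode ++ encRows (s :: rows)))
      { Ctl.init with bad := φ.hasFalsum || decide (∃ l ∈ literals cl, Refuted cl l), past := true }
      (Mem.init []) (decideTime (φ.encode ++ encRows (s :: rows)).length) := by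
  obtain ⟨a, w, haw⟩ : ∃ a w, encRows (s :: rows) = a :: w := by
    cases s
    · exact ⟨_, _, encRows_cons [] rows⟩
    · exact ⟨_, _, encRows_cons (_ :: _) rows⟩
  -- the symbol after the constraint is a value of the partial ballot or an end marker, and so it
  -- ends the first phase
  have ha : ({ Ctl.init with sym := a }).token = { Ctl.init with sym := a, past := true } := by
    cases s with
    | nil =>
      rw [encRows_cons] at haw
      cases haw
      rfl
    | cons b s =>
      rw [encRows_cons] at haw
      cases haw
      rcases hs a List.mem_cons_self with rfl | ⟨b, rfl⟩ <;> rfl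
  obtain ⟨x, hx⟩ : ∃ x : Table, x = ⟨[], s, rows, encClauses φ.clauses⟩ := ⟨_, rfl⟩
  have hxw : x.word = a :: w := by rw [hx, ← haw]; rfl
  have hd : ∀ r ∈ x.top :: x.rows, Symb.delim ∉ r := by
    rw [hx]
    intro r hr
    rcases List.mem_cons.1 hr with rfl | hr
    · exact fun h => by rcases hs _ h with h | ⟨b, h⟩ <;> cases h
    · exact hrows r hr
  rw [← hx, haw] at hcl
  obtain ⟨-, hb₁, hb₂, hb₃⟩ := Table.iterate_next_bounds hd (L := (a :: w).length) (by rw [hxw])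
    (by rw [hx]) (a :: w).length le_rfl
  have hφl := length_encClauses_le hφ
  obtain ⟨c, hc⟩ : ∃ c : Ctl, c = { Ctl.init with bad := φ.hasFalsum, past := true } := ⟨_, rfl⟩
  have hcd : c.on .delim = c := by rw [hc]; rfl
  have h₁ := runs_parse φ hφ Ctl.init (Mem.init []) a w ha rfl rfl rfl rfl rfl rfl rfl rfl
  have h₂ := runs_move (k := .save) (k' := .inp) (by decide) c
    ((((Mem.init []).set .cls x.cls).set .save (a :: w).reverse).set .inp [])
  have h₃ := runs_copy (k := .inp) (k' := .cnt) (t := .tmp) (by decide) (by decide) (by decide) c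
    (m := Table.mem (Mem.init []) x) rfl
  have h₄ := runs_each_round c (Mem.init []) x (by rw [hc]; rfl) (by rw [hc]; rfl) (by rw [hc]; rfl)
    (by rw [hc]; rfl) rfl rfl rfl rfl (a :: w) (by rw [hxw]) hd (by rw [hx])
  set y := Table.next^[(a :: w).length] x with hy
  have h₅ := runs_clear .inp c (Table.mem (Mem.init []) y)
  have h₆ := runs_clear .ctr c ((Table.mem (Mem.init []) y).set .inp [])
  have h₇ := runs_solve c (m := (Mem.init []).set .cls y.cls) cl (by rw [hc]; rfl)
    (by rw [hc]; rfl) (by rw [hc]; rfl) (by rw [hc]; rfl) hcl rfl rfl rfl rfl rfl rfl rfl rfl rfl rfl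
    rfl rfl
  have h₈ := runs_clear .cls
    { c with bad := c.bad || decide (∃ l ∈ literals cl, Refuted cl l) }
    ((Mem.init []).set .cls y.cls)
  rw [hcd] at h₂ h₃ h₄ h₅ h₆ h₇
  refine (((h₁.congr (d := c) ?_ (n := (((Mem.init []).set .cls x.cls).set .save
    (a :: w).reverse).set .inp []) ?_ le_rfl).seq
    ((h₂.congr rfl (n := Table.mem (Mem.init []) x) ?_ le_rfl).seq
    ((h₃.congr rfl (n := (Table.mem (Mem.init []) x).set .cnt (a :: w)) ?_ le_rfl).seq
    (h₄.seq (h₅.seq (h₆.seq (h₇.seq h₈))))))).congr_start rfl ?_).congr ?_ ?_ ?_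
  · rw [hc]; rfl
  · rw [hx]
  · rw [← hxw, hx]
    ext1 <;> first | rfl | simp [Table.mem, Mem.set, Mem.get, Mem.init]
  · change (Table.mem (Mem.init []) x).set .cnt (x.word ++ []) = _
    rw [hxw, List.append_nil]
  · rw [haw]; rfl
  · rw [hc]; rfl
  · rfl
  · have hN : y.cls.length ≤ clauseBound (φ.encode ++ a :: w).length := by
      have hx' : x.cls.length ≤ 2 * φ.encode.length := by rw [hx]; exact hφl
      have h₉ : (a :: w).length * (4 * (a :: w).length + 8) ≤
          (φ.encode ++ a :: w).length * (4 * (φ.encode ++ a :: w).length + 8) := by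
        rw [List.length_append]
        gcongr <;> lia
      have h₁₀ : φ.encode.length ≤ (φ.encode ++ a :: w).length := by simp
      rw [clauseBound]
      linarith
    have hS := solveTime_mono hN
    rw [haw, ← hcl]
    change 20 * φ.encode.length + (7 + w.length * 3) + (1 + (a :: w).reverse.length * 2 +
      (2 + x.word.length * 5 + (1 + (a :: w).length * ((a :: w).length * (35 + 17 * (a :: w).length) +
        40 + 25 * (a :: w).length + 1) + (1 + y.word.length * 2 + (1 + (y.ctr.map Symb.bit).length * 2 +
        (solveTime y.cls.length + (1 + y.cls.length * 2))))))) ≤ _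
    rw [hxw, List.length_reverse, List.length_map, decideTime]
    have hL : (a :: w).length ≤ (φ.encode ++ a :: w).length := by simp
    have h₉ : (a :: w).length * ((a :: w).length * (35 + 17 * (a :: w).length) +
        40 + 25 * (a :: w).length + 1) ≤ (φ.encode ++ a :: w).length * ((φ.encode ++ a :: w).length *
        (35 + 17 * (φ.encode ++ a :: w).length) + 40 + 25 * (φ.encode ++ a :: w).length + 1) := by
      gcongr
    have h₁₀ : (φ.encode ++ a :: w).length = φ.encode.length + (a :: w).length := List.length_append
    have h₁₁ : (a :: w).length = w.length + 1 := rfl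
    lia

/-- `decideTime` as a polynomial. -/
noncomputable def decidePolynomial : Polynomial ℕ :=
  let X : Polynomial ℕ := .X
  let B := 4 * X * X + 10 * X
  let S := B + B * B
  let E := S * (S * (S * (18 * S + 58) + 40) + 9 * S + 38) + 16
  X * (X * (35 + 17 * X) + 40 + 25 * X + 1) + (B * (2 * E + 2 * B + 15) + 3) + 2 * B + 34 * X + 20

theorem eval_decidePolynomial (N : ℕ) : decidePolynomial.eval N = decideTime N := by
  simp [decidePolynomial, decideTime, solveTime, exploreTime, clauseBound]

/-! ### Implication graphs of clauses with two literals -/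

/-- The truth value of a literal under an assignment of truth values to names. -/
def Lit.Holds (u : List Bool → Bool) (l : Lit) : Prop := u l.2 = l.1

theorem Lit.holds_neg (u : List Bool → Bool) (l : Lit) : l.neg.Holds u ↔ ¬ l.Holds u := by
  rcases l with ⟨b, x⟩
  cases b <;> simp [Lit.Holds, Lit.neg]

theorem Lit.neg_ne (l : Lit) : l.neg ≠ l := by
  rcases l with ⟨b, x⟩
  cases b <;> simp [Lit.neg]

/-- The edges of the implication graph: a clause `¬a ∨ b` leads from `a` to `b`. -/
def Implies (cl : List (Lit × Lit)) (a b : Lit) : Prop := (a.neg, b) ∈ cl ∨ (b, a.neg) ∈ cl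

/-- Reachability in the implication graph. -/
abbrev Reaches (cl : List (Lit × Lit)) : Lit → Lit → Prop := Relation.ReflTransGen (Implies cl)

theorem mem_literals {cl : List (Lit × Lit)} {a : Lit} :
    a ∈ literals cl ↔ ∃ b, (a, b) ∈ cl ∨ (b, a) ∈ cl := by
  simp only [literals, List.mem_flatMap, List.mem_cons, List.not_mem_nil, or_false]
  constructor
  · rintro ⟨⟨x, y⟩, h, rfl | rfl⟩
    exacts [⟨_, .inl h⟩, ⟨_, .inr h⟩]
  · rintro ⟨b, h | h⟩
    exacts [⟨_, h, .inl rfl⟩, ⟨_, h, .inr rfl⟩]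

theorem Implies.mem_literals {cl : List (Lit × Lit)} {a b : Lit} (h : Implies cl a b) :
    b ∈ literals cl :=
  JudgmentAggregation.mem_literals.2 ⟨a.neg, h.symm⟩

theorem Implies.contrapose {cl : List (Lit × Lit)} {a b : Lit} (h : Implies cl a b) :
    Implies cl b.neg a.neg := by
  simpa [Implies] using h.symm

theorem Reaches.contrapose {cl : List (Lit × Lit)} {a b : Lit} (h : Reaches cl a b) :
    Reaches cl b.neg a.neg := by
  induction h with
  | refl => exact .refl
  | tail _ h ih => exact .head h.contrapose ih

theorem Reaches.holds {cl : List (Lit × Lit)} {u : List Bool → Bool}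
    (hu : ∀ c ∈ cl, c.1.Holds u ∨ c.2.Holds u) {a b : Lit} (h : Reaches cl a b) (ha : a.Holds u) :
    b.Holds u := by
  induction h with
  | refl => exact ha
  | @tail b c _ h ih =>
    have hb : ¬ b.neg.Holds u := fun hn => (b.holds_neg u).1 hn ih
    rcases h with h | h
    · exact (hu _ h).resolve_left hb
    · exact (hu _ h).resolve_right hb

/-! ### Saturation computes reachability -/

theorem mem_extend {R : List Lit} {a b x : Lit} :
    x ∈ extend R a b ↔ x ∈ R ∨ (a.neg ∈ R ∧ x = b) := by
  unfold extend
  split_ifs with h <;> simp [h, or_comm]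

theorem mem_absorb_of_mem {R : List Lit} {c : Lit × Lit} {x : Lit} (h : x ∈ R) : x ∈ absorb R c := by
  simp [absorb, mem_extend, h]

theorem mem_foldl_absorb_of_mem {cl : List (Lit × Lit)} {R : List Lit} {x : Lit} (h : x ∈ R) :
    x ∈ cl.foldl absorb R := by
  induction cl generalizing R with
  | nil => exact h
  | cons c cl ih => exact ih (mem_absorb_of_mem h)

theorem mem_foldl_absorb_of_implies {cl : List (Lit × Lit)} {R : List Lit} {a b : Lit} (ha : a ∈ R)
    (h : Implies cl a b) : b ∈ cl.foldl absorb R := by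
  induction cl generalizing R with
  | nil => simp [Implies] at h
  | cons c cl ih =>
    by_cases hc : Implies cl a b
    · exact ih (mem_absorb_of_mem ha) hc
    · refine mem_foldl_absorb_of_mem (cl := cl) ?_
      simp only [Implies, List.mem_cons, not_or] at h hc
      rcases h with (rfl | h) | (rfl | h)
      · simp [absorb, mem_extend, ha]
      · exact absurd h hc.1
      · simp [absorb, mem_extend, ha]
      · exact absurd h hc.2

theorem foldl_absorb_induction {cl : List (Lit × Lit)} {P : Lit → Prop}
    (hP : ∀ a b, P a → Implies cl a b → P b) {R : List Lit} (hR : ∀ x ∈ R, P x) :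
    ∀ x ∈ cl.foldl absorb R, P x := by
  have key : ∀ (cl' : List (Lit × Lit)) (_ : ∀ c ∈ cl', c ∈ cl) (R : List Lit) (_ : ∀ x ∈ R, P x),
      ∀ x ∈ cl'.foldl absorb R, P x := by
    intro cl'
    induction cl' with
    | nil => exact fun _ _ h => h
    | cons c cl' ih =>
      intro hc R hR
      refine ih (fun c h => hc c (List.mem_cons_of_mem _ h)) _ fun x hx => ?_
      have hmem := hc c List.mem_cons_self
      have h₁ : ∀ x ∈ extend R c.1 c.2, P x := by
        intro x hx
        rcases mem_extend.1 hx with h | ⟨h, rfl⟩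
        · exact hR x h
        · exact hP _ _ (hR _ h) (.inl (by simpa using hmem))
      rcases mem_extend.1 hx with h | ⟨h, rfl⟩
      · exact h₁ x h
      · exact hP _ _ (h₁ _ h) (.inr (by simpa using hmem))
  exact key cl (fun _ h => h) R hR

theorem length_literals_le (cl : List (Lit × Lit)) :
    (literals cl).length ≤ (encClauses cl).length := by
  induction cl with
  | nil => simp [literals]
  | cons c cl ih =>
    have e : literals (c :: cl) = c.1 :: c.2 :: literals cl := rfl
    simp only [e, List.length_cons, encClauses_cons, List.length_append, Lit.length_word]
    lia

/-- There are enough passes: a pass that does not complete the set of reachable literals adds one of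
the literals that occur in the clauses. -/
theorem mem_saturate {cl : List (Lit × Lit)} {l x : Lit} : x ∈ saturate cl l ↔ Reaches cl l x := by
  set F : List Lit → List Lit := fun R => cl.foldl absorb R with hF
  have hmono : ∀ {x R} (k), x ∈ R → x ∈ F^[k] R := by
    intro x R k h
    induction k with
    | zero => exact h
    | succ k ih => rw [Function.iterate_succ_apply']; exact mem_foldl_absorb_of_mem ih
  have hind : ∀ {P : Lit → Prop} (_ : ∀ a b, P a → Implies cl a b → P b) (_ : P l) (k : ℕ),
      ∀ x ∈ F^[k] [l], P x := by
    intro P hP hl k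
    induction k with
    | zero => simpa using hl
    | succ k ih =>
      rw [Function.iterate_succ_apply']
      exact foldl_absorb_induction hP ih
  constructor
  · exact fun h => hind (P := Reaches cl l) (fun a b h h' => h.tail h') .refl _ x h
  · intro h
    set M := (encClauses cl).length with hM
    -- either the set of literals is closed under implication after some pass, and then it contains
    -- all reachable literals, or each of `M + 1` passes adds a literal that occurs in the clauses
    by_cases hk : ∃ k ≤ M, ∀ a b, a ∈ F^[k] [l] → Implies cl a b → b ∈ F^[k] [l]
    · obtain ⟨k, hk, hcl⟩ := hk
      have hx : x ∈ F^[k] [l] := by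
        induction h with
        | refl => exact hmono k (by simp)
        | tail _ h ih => exact hcl _ _ ih h
      have e : saturate cl l = F^[M - k] (F^[k] [l]) := by
        rw [← Function.iterate_add_apply, Nat.sub_add_cancel hk]
        rfl
      rw [e]
      exact hmono _ hx
    · push Not at hk
      have hcard : ∀ k ≤ M + 1, k + 1 ≤ (F^[k] [l]).toFinset.card := by
        intro k
        induction k with
        | zero => simp
        | succ k ih =>
          intro hkM
          obtain ⟨a, b, ha, hab, hb⟩ := hk k (by lia)
          refine (Nat.succ_le_succ (ih (by lia))).trans (Finset.card_lt_card ?_)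
          rw [Function.iterate_succ_apply', Finset.ssubset_iff_of_subset]
          · refine ⟨b, ?_, by simpa using hb⟩
            simpa using mem_foldl_absorb_of_implies ha hab
          · intro y hy
            simpa using mem_foldl_absorb_of_mem (by simpa using hy)
      have h₁ := hcard (M + 1) le_rfl
      have h₂ : (F^[M + 1] [l]).toFinset ⊆ (l :: literals cl).toFinset := by
        intro y hy
        rw [List.mem_toFinset] at hy ⊢
        exact hind (P := fun y => y ∈ l :: literals cl)
          (fun a b _ h => List.mem_cons_of_mem _ h.mem_literals) List.mem_cons_self _ y hy
      have h₃ := (Finset.card_le_card h₂).trans (List.toFinset_card_le _)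
      have h₄ := length_literals_le cl
      simp only [List.length_cons] at h₃
      lia

theorem refuted_iff {cl : List (Lit × Lit)} {l : Lit} :
    Refuted cl l ↔ Reaches cl l l.neg ∧ Reaches cl l.neg l := by
  rw [Refuted, mem_saturate, mem_saturate]

/-! ### Satisfiability of clauses with two literals -/

/-- A maximal set of literals that is closed under implication and free of contradictions decides
every literal, unless some literal is equivalent to its complement. -/
theorem exists_total_of_not_reaches {cl : List (Lit × Lit)}
    (h : ∀ l, ¬ (Reaches cl l l.neg ∧ Reaches cl l.neg l)) :
    ∃ S : Set Lit, (∀ a ∈ S, ∀ b, Implies cl a b → b ∈ S) ∧ (∀ a ∈ S, a.neg ∉ S) ∧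
      ∀ a, a ∈ S ∨ a.neg ∈ S := by
  obtain ⟨S, hS⟩ := zorn_subset
    {S : Set Lit | (∀ a ∈ S, ∀ b, Implies cl a b → b ∈ S) ∧ ∀ a ∈ S, a.neg ∉ S} (by
      refine fun C hC hchain => ⟨⋃₀ C, ⟨?_, ?_⟩, fun s hs => Set.subset_sUnion_of_mem hs⟩
      · rintro a ⟨s, hs, ha⟩ b hab
        exact ⟨s, hs, (hC hs).1 a ha b hab⟩
      · rintro a ⟨s, hs, ha⟩ ⟨t, ht, hna⟩
        rcases hchain.total hs ht with hst | hst
        · exact (hC ht).2 a (hst ha) hna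
        · exact (hC hs).2 a ha (hst hna))
  obtain ⟨hcl, hcons⟩ := hS.prop
  have hreach : ∀ {a b}, a ∈ S → Reaches cl a b → b ∈ S := by
    intro a b ha hab
    induction hab with
    | refl => exact ha
    | tail _ hs ih => exact hcl _ ih _ hs
  -- a literal that does not imply its complement can be added with all that it implies
  have hadd : ∀ a, ¬ Reaches cl a a.neg → a.neg ∉ S → a ∈ S := by
    intro a ha hna
    refine hS.le_of_ge (y := S ∪ {b | Reaches cl a b}) ⟨?_, ?_⟩ Set.subset_union_left
      (Or.inr .refl)
    · rintro b (hb | hb) c hbc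
      exacts [.inl (hcl b hb c hbc), .inr (hb.tail hbc)]
    · rintro b (hb | hb) (hnb | hnb)
      · exact hcons b hb hnb
      · exact hna (hreach hb (by simpa using Reaches.contrapose hnb))
      · exact hna (hreach hnb (Reaches.contrapose hb))
      · exact ha (Relation.ReflTransGen.trans hb (by simpa using Reaches.contrapose hnb))
  refine ⟨S, hcl, hcons, fun a => ?_⟩
  by_contra hno
  rw [not_or] at hno
  refine h a ⟨by_contra fun hr => hno.1 (hadd a hr hno.2), by_contra fun hr => hno.2 (hadd a.neg ?_ ?_)⟩
  · simpa using hr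
  · simpa using hno.1

/-- Clauses with two literals are satisfiable unless a literal and its complement imply each other. -/
theorem exists_holds_iff (cl : List (Lit × Lit)) :
    (∃ u : List Bool → Bool, ∀ c ∈ cl, c.1.Holds u ∨ c.2.Holds u) ↔
      ¬ ∃ l ∈ literals cl, Refuted cl l := by
  constructor
  · rintro ⟨u, hu⟩ ⟨l, -, hl⟩
    obtain ⟨h₁, h₂⟩ := refuted_iff.1 hl
    by_cases h : l.Holds u
    · exact (l.holds_neg u).1 (h₁.holds hu h) h
    · exact h (h₂.holds hu ((l.holds_neg u).2 h))
  · intro hno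
    obtain ⟨S, hcl, hcons, htot⟩ := exists_total_of_not_reaches (cl := cl) (by
      rintro l ⟨h₁, h₂⟩
      rcases Relation.ReflTransGen.cases_tail h₂ with h | ⟨b, -, h⟩
      · exact l.neg_ne h.symm
      · exact hno ⟨l, h.mem_literals, refuted_iff.2 ⟨h₁, h₂⟩⟩)
    classical
    refine ⟨fun x => decide ((true, x) ∈ S), ?_⟩
    have hS : ∀ a : Lit, a ∈ S → a.Holds fun x => decide ((true, x) ∈ S) := by
      rintro ⟨b, x⟩ ha
      cases b
      · exact decide_eq_false (hcons _ ha)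
      · exact decide_eq_true ha
    rintro ⟨a, b⟩ hab
    rcases htot a with ha | ha
    · exact .inl (hS a ha)
    · exact .inr (hS b (hcl _ ha b (.inl (by simpa using hab))))

/-! ### Majorities under Krom constraints -/

namespace PropFormula

/-- The issue-wise majority of an odd number of truth assignments. -/
def majority (W : List (ℕ → Bool)) (x : ℕ) : Bool := decide (W.length < 2 * W.countP fun v => v x)

theorem IsLiteral.eval_majority {φ : PropFormula} (hφ : φ.IsLiteral) {W : List (ℕ → Bool)}
    (hW : Odd W.length) :
    φ.eval (majority W) = true ↔ W.length < 2 * W.countP fun v => φ.eval v := by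
  match φ, hφ with
  | .var x, _ => simp [eval, majority]
  | .neg (.var x), _ =>
    have h := List.length_eq_countP_add_countP (fun v : ℕ → Bool => v x) (l := W)
    have e : W.countP (fun v => !v x) = W.countP fun v => decide ¬ (v x = true) := by simp
    obtain ⟨k, hk⟩ := hW
    simp only [eval, majority, Bool.not_eq_true', decide_eq_false_iff_not]
    lia

theorem length_le_countP_add_countP {α : Type*} {p q : α → Bool} {W : List α}
    (h : ∀ v ∈ W, p v = true ∨ q v = true) : W.length ≤ W.countP p + W.countP q := by
  induction W with
  | nil => simp
  | cons v W ih =>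
    have h₁ := ih fun v hv => h v (List.mem_cons_of_mem _ hv)
    simp only [List.length_cons, List.countP_cons]
    rcases h v List.mem_cons_self with h₂ | h₂ <;> simp only [h₂, if_true] <;> lia

/-- Two majorities have a member in common. Hence the majority of an odd number of satisfying
assignments does not violate a clause with two literals. -/
theorem IsKrom.eval_majority {φ : PropFormula} (hφ : φ.IsKrom) {W : List (ℕ → Bool)}
    (hW : Odd W.length) (h : ∀ v ∈ W, φ.eval v = true) : φ.eval (majority W) = true := by
  have hpos : 0 < W.length := hW.pos
  have hlit : ∀ {ψ : PropFormula}, ψ.IsLiteral → (∀ v ∈ W, ψ.eval v = true) →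
      ψ.eval (majority W) = true := by
    intro ψ hψ h
    rw [hψ.eval_majority hW, List.countP_eq_length.2 h]
    lia
  induction φ with
  | tru => rfl
  | fls =>
    obtain ⟨v, hv⟩ := List.exists_mem_of_length_pos hpos
    exact absurd (h v hv) (by simp [eval])
  | var x => exact hlit trivial h
  | neg ψ _ => exact hlit hφ h
  | and φ ψ ih ih' =>
    simp only [eval, Bool.and_eq_true] at h ⊢
    exact ⟨ih hφ.1 fun v hv => (h v hv).1, ih' hφ.2 fun v hv => (h v hv).2⟩
  | imp φ ψ _ _ => exact hφ.elim
  | or φ ψ _ _ =>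
    have h₁ := IsLiteral.eval_majority hφ.1 hW
    have h₂ := IsLiteral.eval_majority hφ.2 hW
    simp only [eval, Bool.or_eq_true]
    by_contra hno
    rw [h₁, h₂] at hno
    have h₃ : W.length ≤ (W.countP fun v => φ.eval v) + W.countP fun v => ψ.eval v := by
      exact length_le_countP_add_countP fun v hv => by simpa [eval] using h v hv
    obtain ⟨k, hk⟩ := hW
    lia

end PropFormula

/-- Doubling all the satisfying assignments that extend the ballots, and adding one of them once
more, makes their number odd without affecting strict majorities. -/
theorem isConsistent_majorityOutcome {n : ℕ} {Γ : PropFormula} (hΓ : Γ.IsKrom) (R : Profile n Γ) :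
    IsConsistent Γ (majorityOutcome R) := by
  have hex : ∀ r : Ballot n, ∃ v : ℕ → Bool,
      IsRational Γ r → (∀ i : Fin n, v i = r i) ∧ Γ.eval v = true := by
    intro r
    by_cases hr : IsRational Γ r
    · obtain ⟨v, hv⟩ := hr
      exact ⟨v, fun _ => hv⟩
    · exact ⟨fun _ => false, fun h => absurd h hr⟩
  choose g hg using hex
  obtain ⟨r₀, hr₀⟩ := List.exists_mem_of_ne_nil _ R.ballots_ne_nil
  set V := R.ballots.map g with hV
  have hsat : ∀ v ∈ V, Γ.eval v = true := by
    intro v hv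
    obtain ⟨r, hr, rfl⟩ := List.mem_map.1 hv
    exact (hg r (R.rational r hr)).2
  have hcount : ∀ (i : Fin n), V.countP (fun v => v i) = R.ballots.countP fun r => r i := by
    intro i
    rw [hV, List.countP_map]
    refine List.countP_congr fun r hr => ?_
    simp [(hg r (R.rational r hr)).1 i]
  have hlen : V.length = R.ballots.length := by simp [hV]
  -- for `p` ballots a strict majority is at least `(p + 1) / 2` of them, which is doubled to more than
  -- half of `2 * p + 1`
  refine ⟨PropFormula.majority (g r₀ :: (V ++ V)), fun i b hb => ?_, hΓ.eval_majority ⟨V.length, ?_⟩ ?_⟩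
  · have hc : (g r₀ :: (V ++ V)).countP (fun v => v i) =
        2 * (R.ballots.countP fun r => r i) + if r₀ i then 1 else 0 := by
      rw [List.countP_cons, List.countP_append, hcount, (hg r₀ (R.rational r₀ hr₀)).1]
      lia
    have hl : (g r₀ :: (V ++ V)).length = 2 * R.ballots.length + 1 := by
      rw [List.length_cons, List.length_append, hlen]
      lia
    have h := List.length_eq_countP_add_countP (fun r : Ballot n => r i) (l := R.ballots)
    have e : R.ballots.countP (fun r => !r i) = R.ballots.countP fun r => decide ¬ (r i = true) := by
      simp
    rw [PropFormula.majority, hc, hl]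
    simp only [majorityOutcome] at hb
    split_ifs at hb with h₁ h₂
    · cases hb
      refine decide_eq_true ?_
      lia
    · cases hb
      refine decide_eq_false ?_
      split_ifs <;> lia
  · rw [List.length_cons, List.length_append]
    lia
  · intro v hv
    simp only [List.mem_cons, List.mem_append, or_self] at hv
    rcases hv with rfl | hv
    exacts [(hg r₀ (R.rational r₀ hr₀)).2, hsat v hv]

/-! ### Issue-wise minimization -/

/-- If a cost is the sum of costs of the issues, and a partial ballot gives the cheaper value for
those issues for which the costs of the values differ, then the rational ballots of minimal cost are
those that the partial ballot agrees with, provided that there are any. -/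
theorem argminRational_sum_eq {n : ℕ} {Γ : PropFormula} {m : PartialBallot n} (c : Fin n → Bool → ℕ)
    (h₁ : ∀ i b, m i = some b → c i b < c i !b) (h₂ : ∀ i, m i = none → ∀ b b', c i b ≤ c i b')
    (hm : IsConsistent Γ m) :
    argminRational Γ (fun r => ∑ i, c i (r i)) = {r | IsRational Γ r ∧ AgreesWith m r} := by
  have hle : ∀ r r' : Ballot n, AgreesWith m r → ∀ i, c i (r i) ≤ c i (r' i) := by
    intro r r' hr i
    cases hi : m i with
    | none => exact h₂ i hi _ _
    | some b =>
      rw [hr i b hi]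
      by_cases hb : r' i = b
      · rw [hb]
      · rw [Bool.eq_not_iff.2 hb]
        exact (h₁ i b hi).le
  obtain ⟨v, hv, hΓ⟩ := hm
  ext r
  refine ⟨fun ⟨hr, hmin⟩ => ⟨hr, fun i b hb => ?_⟩,
    fun ⟨hr, hag⟩ => ⟨hr, fun r' _ => Finset.sum_le_sum fun i _ => hle r r' hag i⟩⟩
  by_contra hne
  refine (hmin (fun i => v i) ⟨v, fun _ => rfl, hΓ⟩).not_gt
    (Finset.sum_lt_sum (fun i _ => hle _ r hv i) ⟨i, Finset.mem_univ i, ?_⟩)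
  change c i (v i) < c i (r i)
  rw [hv i b hb, Bool.eq_not_iff.2 hne]
  exact h₁ i b hb

theorem sum_hammingDist {n : ℕ} (r : Ballot n) (L : List (Ballot n)) :
    (L.map fun r' => hammingDist r r').sum = ∑ i, L.countP fun r' => decide (r i ≠ r' i) := by
  induction L with
  | nil => simp
  | cons r' L ih =>
    simp only [List.map_cons, List.sum_cons, ih, List.countP_cons, Finset.sum_add_distrib]
    rw [add_comm, hammingDist, Finset.card_filter]
    simp

theorem kemeny_majorityConsistent : kemeny.MajorityConsistent := by
  intro n Γ R hm
  have h := argminRational_sum_eq (fun i b => R.ballots.countP fun r' => decide (b ≠ r' i)) ?_ ?_ hm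
  · rw [← h]
    simp only [kemeny, sum_hammingDist]
  all_goals
    intro i
    have h := List.length_eq_countP_add_countP (fun r : Ballot n => r i) (l := R.ballots)
    have e : R.ballots.countP (fun r => !r i) = R.ballots.countP fun r => decide ¬ (r i = true) := by
      simp
    have e₁ : R.ballots.countP (fun r => decide (false ≠ r i)) = R.ballots.countP fun r => r i :=
      List.countP_congr fun r _ => by simp
    have e₂ : R.ballots.countP (fun r => decide (true ≠ r i)) = R.ballots.countP fun r => !r i :=
      List.countP_congr fun r _ => by simp
  · intro b hb
    simp only [majorityOutcome] at hb
    split_ifs at hb <;> cases hb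
    · rw [Bool.not_true, e₁, e₂]
      lia
    · rw [Bool.not_false, e₁, e₂]
      lia
  · intro hb b b'
    simp only [majorityOutcome] at hb
    split_ifs at hb
    cases b <;> cases b' <;> simp only [e₁, e₂] <;> lia

theorem slater_majorityConsistent : slater.MajorityConsistent := by
  intro n Γ R hm
  have h := argminRational_sum_eq
    (fun i b => if some b ≠ majorityOutcome R i then 1 else 0) ?_ ?_ hm
  · rw [← h]
    simp only [slater, hammingDist, Finset.card_filter]
  · intro i b hb
    simp [hb]
  · intro i hb b b'
    simp [hb]

/-! ### The clauses that the program collects -/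

/-- The assignment to names that corresponds to an assignment to variables. -/
def nameAssignment (v : ℕ → Bool) (x : List Bool) : Bool := v (Computability.decodeNat x.reverse)

@[simp] theorem nameAssignment_varName (v : ℕ → Bool) (x : ℕ) :
    nameAssignment v (varName x) = v x := by
  simp [nameAssignment, varName, Computability.decode_encodeNat]

theorem PropFormula.IsLiteral.holds_toLit {φ : PropFormula} (hφ : φ.IsLiteral)
    (u : List Bool → Bool) : φ.toLit.Holds u ↔ φ.eval (fun x => u (varName x)) = true := by
  match φ, hφ with
  | .var x, _ => rfl
  | .neg (.var x), _ => simp [PropFormula.toLit, Lit.Holds, PropFormula.eval]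

/-- A Krom formula is equivalent to its list of clauses, unless it has an empty clause. -/
theorem PropFormula.IsKrom.eval_iff {φ : PropFormula} (hφ : φ.IsKrom) (u : List Bool → Bool) :
    φ.eval (fun x => u (varName x)) = true ↔
      φ.hasFalsum = false ∧ ∀ c ∈ φ.clauses, c.1.Holds u ∨ c.2.Holds u := by
  induction φ with
  | tru => simp [PropFormula.eval, PropFormula.hasFalsum, PropFormula.clauses]
  | fls => simp [PropFormula.eval, PropFormula.hasFalsum]
  | var x =>
    rw [← IsLiteral.holds_toLit (φ := .var x) trivial]
    simp [PropFormula.hasFalsum, PropFormula.clauses]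
  | neg ψ _ =>
    rw [← IsLiteral.holds_toLit (φ := .neg ψ) hφ]
    simp [PropFormula.hasFalsum, PropFormula.clauses]
  | and φ ψ ih ih' =>
    simp only [PropFormula.eval, Bool.and_eq_true, ih hφ.1, ih' hφ.2, PropFormula.hasFalsum,
      PropFormula.clauses, List.mem_append, or_imp, forall_and, Bool.or_eq_false_iff]
    tauto
  | or φ ψ _ _ =>
    simp only [PropFormula.eval, Bool.or_eq_true, ← IsLiteral.holds_toLit hφ.1,
      ← IsLiteral.holds_toLit hφ.2, PropFormula.hasFalsum, PropFormula.clauses, List.mem_singleton,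
      forall_eq, true_and]
    exact or_comm
  | imp φ ψ _ _ => exact hφ.elim

/-- The clauses that fix the value of an issue, if a value is given. -/
def unitClauses (k : ℕ) (o : Option Bool) : List (Lit × Lit) :=
  o.elim [] fun b => [((b, varName k), (b, varName k))]

theorem encClauses_append (cl cl' : List (Lit × Lit)) :
    encClauses (cl ++ cl') = encClauses cl ++ encClauses cl' := List.flatMap_append

theorem unitOf_eq_encClauses (k : ℕ) (o : Option Bool) :
    unitOf ((Computability.encodeNat k).map .bit) (o.map .bit) = encClauses (unitClauses k o) := by
  cases o <;> simp [unitOf, unitWords, unitClauses, Lit.word, Lit.symbs, varName]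

theorem holds_unitClauses (u : List Bool → Bool) (k : ℕ) (o : Option Bool) :
    (∀ c ∈ unitClauses k o, c.1.Holds u ∨ c.2.Holds u) ↔ ∀ b, o = some b → u (varName k) = b := by
  cases o <;> simp [unitClauses, Lit.Holds]

/-- The value of the issue with a given number, if there is such an issue. -/
def PartialBallot.value {n : ℕ} (p : PartialBallot n) (k : ℕ) : Option Bool :=
  if h : k < n then p ⟨k, h⟩ else none

/-- The clauses that are added in the first `k` rounds. -/
def issueClauses {n : ℕ} (p q : PartialBallot n) : ℕ → List (Lit × Lit)
  | 0 => []
  | k + 1 => unitClauses k (p.value k) ++ unitClauses k (q.value k) ++ issueClauses p q k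

theorem holds_issueClauses {n : ℕ} (p q : PartialBallot n) (u : List Bool → Bool) (k : ℕ) :
    (∀ c ∈ issueClauses p q k, c.1.Holds u ∨ c.2.Holds u) ↔
      ∀ j < k, (∀ b, p.value j = some b → u (varName j) = b) ∧
        ∀ b, q.value j = some b → u (varName j) = b := by
  induction k with
  | zero => simp [issueClauses]
  | succ k ih =>
    simp only [issueClauses, List.mem_append, or_imp, forall_and, ih, holds_unitClauses,
      Nat.lt_succ_iff_lt_or_eq, forall_eq]
    tauto

theorem forall_value_iff {n : ℕ} (p : PartialBallot n) (v : ℕ → Bool) {k : ℕ} (hk : n ≤ k) :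
    (∀ j < k, ∀ b, p.value j = some b → v j = b) ↔ ∀ (i : Fin n) b, p i = some b → v i = b := by
  constructor
  · intro h i b hb
    exact h i (i.2.trans_le hk) b (by simpa [PartialBallot.value] using hb)
  · intro h j _ b hb
    unfold PartialBallot.value at hb
    split_ifs at hb with hj
    exact h ⟨j, hj⟩ b hb

/-! ### The columns of the table -/

/-- The word for a partial ballot, without end marker. -/
def PartialBallot.row {n : ℕ} (p : PartialBallot n) : List Symb :=
  List.ofFn fun i => (p i).elim .star .bit

/-- The word for a ballot, without end marker. -/
def Ballot.row {n : ℕ} (r : Ballot n) : List Symb := List.ofFn fun i => .bit (r i)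

theorem head?_drop_ofFn {α : Type*} {n : ℕ} (f : Fin n → α) (k : ℕ) :
    ((List.ofFn f).drop k).head? = if h : k < n then some (f ⟨k, h⟩) else none := by
  rw [List.head?_drop, List.getElem?_ofFn]

theorem filter_head?_row {n : ℕ} (p : PartialBallot n) (k : ℕ) :
    (p.row.drop k).head?.filter Symb.isBit = (p.value k).map .bit := by
  rw [PartialBallot.row, head?_drop_ofFn, PartialBallot.value]
  split_ifs with h
  · cases hp : p ⟨k, h⟩ <;> rfl
  · rfl

/-- The content of the stack that counts votes, after `t` votes for and `f` votes against. -/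
def surplus (t f : ℕ) : List Symb :=
  if f ≤ t then List.replicate (t - f) (.bit true) else List.replicate (f - t) (.bit false)

theorem balStep_surplus (t f : ℕ) (b : Bool) :
    balStep (surplus t f) (.bit b) = surplus (t + b.toNat) (f + (!b).toNat) := by
  have h₁ : ∀ t k, surplus (t + k) t = List.replicate k (.bit true) := fun t k => by simp [surplus]
  have h₂ : ∀ t k, surplus t (t + k) = List.replicate k (.bit false) := fun t k => by
    cases k <;> simp [surplus]
  rcases le_or_gt f t with h | h
  · obtain ⟨k, rfl⟩ := Nat.exists_eq_add_of_le h
    rw [h₁]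
    cases b
    · cases k with
      | zero => exact (h₂ f 1).symm
      | succ k => exact ((congrArg (surplus · _) (by simp; lia)).trans (h₁ (f + 1) k)).symm
    · refine Eq.trans ?_ (h₁ f (k + 1)).symm
      cases k <;> rfl
  · obtain ⟨k, rfl⟩ := Nat.exists_eq_add_of_le h
    rw [Nat.succ_eq_add_one, add_assoc, h₂, add_comm 1 k]
    cases b
    · exact ((congrArg (surplus _) (by simp; lia)).trans (h₂ t (k + 2))).symm
    · exact ((congrArg (surplus _) (by simp; lia)).trans (h₂ (t + 1) k)).symm

theorem foldl_balStep (l : List Bool) (t f : ℕ) :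
    (l.map Symb.bit).foldl balStep (surplus t f) =
      surplus (t + l.countP fun b => b) (f + l.countP fun b => !b) := by
  induction l generalizing t f with
  | nil => rfl
  | cons b l ih =>
    rw [List.map_cons, List.foldl_cons, balStep_surplus, ih]
    cases b <;> simp <;> congr 1 <;> lia

theorem head?_surplus (t f : ℕ) : (surplus t f).head? =
    (if t + f < 2 * t then some true else if t + f < 2 * f then some false else none).map .bit := by
  unfold surplus
  split_ifs <;> first | lia | simp [List.head?_replicate]
  all_goals lia

/-- The top of the stack that counts the votes on an issue is the majority value. -/
theorem head?_balance {n : ℕ} {Γ : PropFormula} (R : Profile n Γ) (k : ℕ) :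
    (balance (R.ballots.map fun r => (Ballot.row r).drop k)).head? =
      ((majorityOutcome R).value k).map .bit := by
  rw [PartialBallot.value]
  split_ifs with h
  · have e : (R.ballots.map fun r => (Ballot.row r).drop k).filterMap List.head? =
        (R.ballots.map fun r => r ⟨k, h⟩).map .bit := by
      simp only [List.filterMap_map, List.map_map]
      rw [← List.filterMap_eq_map]
      refine List.filterMap_congr fun r _ => ?_
      simp [Ballot.row, h]
    have h₁ := foldl_balStep (R.ballots.map fun r => r ⟨k, h⟩) 0 0
    rw [balance, e]
    refine (congrArg List.head? h₁).trans ?_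
    have h₂ := List.length_eq_countP_add_countP (fun r : Ballot n => r ⟨k, h⟩) (l := R.ballots)
    have e₂ : R.ballots.countP (fun r => !r ⟨k, h⟩) =
        R.ballots.countP fun r => decide ¬ (r ⟨k, h⟩ = true) := by simp
    rw [head?_surplus, majorityOutcome, h₂, ← e₂]
    simp [List.countP_map, Function.comp_def]
  · have e : (R.ballots.map fun r => (Ballot.row r).drop k).filterMap List.head? = [] := by
      simp [Ballot.row, h]
    rw [balance, e]
    rfl

/-- The state after `k` rounds: the first `k` columns are gone, and the counter is at `k`. -/
theorem iterate_next {n : ℕ} {Γ : PropFormula} (R : Profile n Γ) (s : PartialBallot n)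
    (cl : List (Lit × Lit)) (k : ℕ) :
    Table.next^[k] ⟨[], s.row, R.ballots.map Ballot.row, encClauses cl⟩ =
      ⟨Computability.encodeNat k, s.row.drop k, R.ballots.map fun r => (Ballot.row r).drop k,
        encClauses (issueClauses (majorityOutcome R) s k ++ cl)⟩ := by
  induction k with
  | zero => simp [issueClauses]; rfl
  | succ k ih =>
    rw [Function.iterate_succ_apply', ih]
    simp only [Table.next, columnUnits, head?_balance, filter_head?_row, unitOf_eq_encClauses,
      issueClauses, encClauses_append, encodeNat_succ, List.tail_drop, List.map_map,
      List.append_assoc, Function.comp_def]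

theorem Instance.encode_eq (x : Instance) :
    x.encode = x.Γ.encode ++ encRows (x.s.row :: x.profile.ballots.map Ballot.row) := by
  simp [Instance.encode, encodePartialBallot, PartialBallot.row, encRows, List.flatMap_map,
    Ballot.row]
  rfl

/-! ### The outcome determination problem -/

/-- Under a Krom constraint the majority outcome is consistent. Hence a majority-consistent procedure
returns all rational ballots that the majority outcome agrees with. -/
theorem outcome_iff {F : Procedure} (hF : F.MajorityConsistent) (x : Instance) (hx : x.Γ.IsKrom) :
    Outcome F x ↔ ∃ v : ℕ → Bool, x.Γ.eval v = true ∧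
      (∀ (i : Fin x.n) b, majorityOutcome x.profile i = some b → v i = b) ∧
      ∀ (i : Fin x.n) b, x.s i = some b → v i = b := by
  rw [Outcome, hF _ _ _ (isConsistent_majorityOutcome hx x.profile)]
  constructor
  · rintro ⟨r, ⟨⟨v, hv, hΓ⟩, hm⟩, hs⟩
    exact ⟨v, hΓ, fun i b hb => (hv i).trans (hm i b hb), fun i b hb => (hv i).trans (hs i b hb)⟩
  · rintro ⟨v, hΓ, hm, hs⟩
    exact ⟨fun i => v i, ⟨⟨v, fun _ => rfl, hΓ⟩, hm⟩, hs⟩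

theorem outcome_iff_not_refuted {F : Procedure} (hF : F.MajorityConsistent) (x : Instance)
    (hx : x.Γ.IsKrom) {k : ℕ} (hk : x.n ≤ k) {cl : List (Lit × Lit)}
    (hcl : cl = issueClauses (majorityOutcome x.profile) x.s k ++ x.Γ.clauses) :
    Outcome F x ↔ x.Γ.hasFalsum = false ∧ ¬ ∃ l ∈ literals cl, Refuted cl l := by
  rw [outcome_iff hF x hx, ← exists_holds_iff, hcl]
  have key : ∀ u : List Bool → Bool,
      (x.Γ.hasFalsum = false ∧
        ∀ c ∈ issueClauses (majorityOutcome x.profile) x.s k ++ x.Γ.clauses,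
          c.1.Holds u ∨ c.2.Holds u) ↔
      x.Γ.eval (fun x => u (varName x)) = true ∧
      (∀ (i : Fin x.n) b, majorityOutcome x.profile i = some b → u (varName i) = b) ∧
      ∀ (i : Fin x.n) b, x.s i = some b → u (varName i) = b := by
    intro u
    rw [hx.eval_iff, ← forall_value_iff _ (fun j => u (varName j)) hk,
      ← forall_value_iff x.s (fun j => u (varName j)) hk]
    simp only [List.mem_append, or_imp, forall_and, holds_issueClauses]
    tauto
  constructor
  · rintro ⟨v, hv⟩
    have h := (key (nameAssignment v)).2 (by simpa using hv)
    exact ⟨h.1, _, h.2⟩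
  · rintro ⟨h, u, hu⟩
    exact ⟨_, (key u).1 ⟨h, hu⟩⟩

theorem outcomePolyTimeSolvable_isKrom {F : Procedure} (hF : F.MajorityConsistent) :
    OutcomePolyTimeSolvable F PropFormula.IsKrom := by
  classical
  refine Prog.nonempty_tm2ComputableInPolyTime decideOutcome .inp Ctl.init (fun c => !c.bad) _ _
    decidePolynomial fun x => ?_
  obtain ⟨x, hx⟩ := x
  obtain ⟨cl, hcl⟩ : ∃ cl, cl = issueClauses (majorityOutcome x.profile) x.s
    (encRows (x.s.row :: x.profile.ballots.map Ballot.row)).length ++ x.Γ.clauses := ⟨_, rfl⟩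
  -- there are at least as many rounds as issues
  have hn : x.n ≤ (encRows (x.s.row :: x.profile.ballots.map Ballot.row)).length := by
    simp [PartialBallot.row]
  have hrun := runs_decideOutcome x.Γ hx x.s.row (x.profile.ballots.map Ballot.row) ?_ ?_ cl
    (by rw [iterate_next, hcl])
  · obtain ⟨t, ht, he⟩ := hrun
    have e : ∀ w, (Mem.init w).get = Function.update (fun _ => []) .inp w := by
      intro w
      funext k
      cases k <;> rfl
    have e₀ : (Mem.init []).get = fun _ => [] := by
      funext k
      cases k <;> rfl
    rw [← x.encode_eq, e, e₀] at he
    rw [← x.encode_eq, ← eval_decidePolynomial] at ht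
    refine ⟨_, t, ht, ?_, he⟩
    change (!(x.Γ.hasFalsum || decide (∃ l ∈ literals cl, Refuted cl l))) = decide (Outcome F x)
    rw [Bool.eq_iff_iff, decide_eq_true_iff, outcome_iff_not_refuted hF x hx hn hcl]
    simp only [Bool.not_eq_true', Bool.or_eq_false_iff, decide_eq_false_iff_not]
  · intro a ha
    obtain ⟨i, rfl⟩ := List.mem_ofFn.1 ha
    cases x.s i
    · exact .inl rfl
    · exact .inr ⟨_, rfl⟩
  · intro r hr
    obtain ⟨r', -, rfl⟩ := List.mem_map.1 hr
    simp [Ballot.row, List.mem_ofFn]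

end JudgmentAggregation

/-- Outcome determination is polynomial-time solvable under Krom constraints for every
majority-consistent procedure; Kemeny and Slater are such procedures; and under a Krom constraint
every majority outcome is consistent. -/
theorem mainTheorem1 :
    (∀ F : JudgmentAggregation.Procedure, F.MajorityConsistent →
      JudgmentAggregation.OutcomePolyTimeSolvable F JudgmentAggregation.PropFormula.IsKrom) ∧
    JudgmentAggregation.kemeny.MajorityConsistent ∧
    JudgmentAggregation.slater.MajorityConsistent ∧
    (∀ (n : ℕ) (Γ : JudgmentAggregation.PropFormula), Γ.IsKrom →
      ∀ R : JudgmentAggregation.Profile n Γ,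
        JudgmentAggregation.IsConsistent Γ (JudgmentAggregation.majorityOutcome R)) := by
  exact ⟨fun _ hF => JudgmentAggregation.outcomePolyTimeSolvable_isKrom hF,
    JudgmentAggregation.kemeny_majorityConsistent, JudgmentAggregation.slater_majorityConsistent,
    fun _ _ hΓ R => JudgmentAggregation.isConsistent_majorityOutcome hΓ R⟩
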